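/- An instance of Stable Marriage with Ties (SMT) consists of a finite set $M$ of men and a finite set $W$ of women; every agent $a \in M \cup W$ has a function $p_a$ that assigns a rank to each member of some subset $\mathrm{dom}(p_a)$ of the opposite sex (his or her acceptable partners; a smaller rank is better), where the set of ranks used by $a$ is $\{1,\dots,t\}$ for some $t \ge 0$, and $w \in \mathrm{dom}(p_m)$ if and only if $m \in \mathrm{dom}(p_w)$. It is an instance of Stable Marriage (SM) if all $p_a$ are injective. A matching is an injective partial function $\mu$ from $M$ to $W$. It is stable if every matched pair is mutually acceptable and there is no mutually acceptable pair $(m,w)$ such that $m$ is unmatched or $p_m(w) < p_m(\mu(m))$, and $w$ is unmatched or $p_w(m) < p_w(\mu^{-1}(w))$. Write $\mathrm{sat}_M(\mu) = \sum_{(m,w)\in\mu} p_m(w)$ and $\mathrm{sat}_W(\mu) = \sum_{(m,w)\in\mu} p_w(m)$. Consider the following four problems. - SESM: given an instance of SM, find a stable matching $\mu$ that minimizes $|\mathrm{sat}_M(\mu) - \mathrm{sat}_W(\mu)|$ among all stable matchings. - BSM: given an instance of SM, find a stable matching $\mu$ that minimizes $\max\{\mathrm{sat}_M(\mu), \mathrm{sat}_W(\mu)\}$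 among all stable matchings. - max-SMT: given an instance of SMT, find a stable matching with the maximum number of matched pairs. - min-SMT: given an instance of SMT, find a stable matching with the minimum number of matched pairs. The primal graph of an instance has the agents as vertices and the mutually acceptable pairs as edges; let $n = |M| + |W|$, and let $\mathtt{tw}$ be the treewidth of the primal graph. Theorem. Each of SESM, BSM, max-SMT and min-SMT is solvable in time $n^{\mathcal{O}(\mathtt{tw})}$: for each of them there are an algorithm and a constant $c$ such that, on every input with $n$ agents (given by the tables of the ranks) whose primal graph has treewidth $\mathtt{tw}$, the algorithm outputs a solution after at most $\max\{n,2\}^{\,c \cdot \max\{\mathtt{tw},1\}}$ steps. (The maxima matter only if no pair is mutually acceptable; otherwise $n \ge 2$ and $\mathtt{tw} \ge 1$. Steps are those of first-order recursive programs over binary trees of cons cells, at unit cost per operation.) -/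

import Mathlib

namespace StableMarriage

/-! ### Stable marriage with ties and incomplete lists -/

/-- An instance with men `Fin a` and women `Fin b`.  `pM m w = some r` means that the man `m` accepts
the woman `w` and gives her rank `r` (a smaller rank is a better one); `pM m w = none` means that `w`
is not on his list.  Acceptability is mutual, and the set of the ranks used by an agent is
`{1, …, t}` for some `t`.  Several people may share a rank (ties). -/
structure Instance (a b : ℕ) where
  pM : Fin a → Fin b → Option ℕ
  pW : Fin b → Fin a → Option ℕ
  acceptable_iff : ∀ m w, (pM m w).isSome ↔ (pW w m).isSome
  ranksM : ∀ m, ∃ t : ℕ, {r | ∃ w, pM m w = some r} = Set.Icc 1 t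
  ranksW : ∀ w, ∃ t : ℕ, {r | ∃ m, pW w m = some r} = Set.Icc 1 t

namespace Instance

variable {a b : ℕ}

/-- There are no ties: every preference function is injective on its domain.  Together with the
condition on the ranks, an agent with `d` acceptable partners uses each of `1, …, d` once. -/
def Strict (I : Instance a b) : Prop :=
  (∀ m w w' r, I.pM m w = some r → I.pM m w' = some r → w = w') ∧
  (∀ w m m' r, I.pW w m = some r → I.pW w m' = some r → m = m')

/-- `m` strictly prefers `w` to `w'` (both on his list). -/
def ManPrefers (I : Instance a b) (m : Fin a) (w w' : Fin b) : Prop :=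
  ∃ r r', I.pM m w = some r ∧ I.pM m w' = some r' ∧ r < r'

/-- `w` strictly prefers `m` to `m'` (both on her list). -/
def WomanPrefers (I : Instance a b) (w : Fin b) (m m' : Fin a) : Prop :=
  ∃ r r', I.pW w m = some r ∧ I.pW w m' = some r' ∧ r < r'

/-- A matching is an injective partial function from men to women, i.e. a `PEquiv`;
`μ m` is the partner of the man `m` and `μ.symm w` that of the woman `w`, if any.
`(m, w)` blocks `μ` if they accept each other, `m` is unmatched or prefers `w` to his partner,
and `w` is unmatched or prefers `m` to her partner. -/
def Blocking (I : Instance a b) (μ : Fin a ≃. Fin b) (m : Fin a) (w : Fin b) : Prop :=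
  (I.pM m w).isSome ∧
  (μ m = none ∨ ∃ w', μ m = some w' ∧ I.ManPrefers m w w') ∧
  (μ.symm w = none ∨ ∃ m', μ.symm w = some m' ∧ I.WomanPrefers w m m')

/-- Only mutually acceptable people are matched, and there is no blocking pair. -/
def Stable (I : Instance a b) (μ : Fin a ≃. Fin b) : Prop :=
  (∀ m w, μ m = some w → (I.pM m w).isSome) ∧ ∀ m w, ¬ I.Blocking μ m w

/-- Total satisfaction of the men: the sum of `p_m(w)` over the matched pairs `(m, w)`. -/
def satM (I : Instance a b) (μ : Fin a ≃. Fin b) : ℕ :=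
  ∑ m, (μ m).elim 0 fun w => (I.pM m w).getD 0

/-- Total satisfaction of the women: the sum of `p_w(m)` over the matched pairs `(m, w)`. -/
def satW (I : Instance a b) (μ : Fin a ≃. Fin b) : ℕ :=
  ∑ m, (μ m).elim 0 fun w => (I.pW w m).getD 0

/-- The sex-equality measure. -/
def delta (I : Instance a b) (μ : Fin a ≃. Fin b) : ℤ := (I.satM μ : ℤ) - (I.satW μ : ℤ)

/-- The balance measure. -/
def bal (I : Instance a b) (μ : Fin a ≃. Fin b) : ℕ := max (I.satM μ) (I.satW μ)

/-- The primal graph: its vertices are the agents, its edges the mutually acceptable pairs. -/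
def primalGraph (I : Instance a b) : SimpleGraph (Fin a ⊕ Fin b) where
  Adj x y := (∃ m w, x = Sum.inl m ∧ y = Sum.inr w ∧ (I.pM m w).isSome) ∨
    (∃ m w, x = Sum.inr w ∧ y = Sum.inl m ∧ (I.pM m w).isSome)
  symm := ⟨by
    rintro x y (⟨m, w, hx, hy, h⟩ | ⟨m, w, hx, hy, h⟩)
    · exact Or.inr ⟨m, w, hy, hx, h⟩
    · exact Or.inl ⟨m, w, hy, hx, h⟩⟩
  loopless := ⟨by
    rintro x (⟨m, w, hx, hy, _⟩ | ⟨m, w, hx, hy, _⟩) <;> simp [hx] at hy⟩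

end Instance

/-- The number of matched pairs. -/
def matchingSize {a b : ℕ} (μ : Fin a ≃. Fin b) : ℕ :=
  (Finset.univ.filter fun m => (μ m).isSome).card

/-! ### The four optimization problems -/

/-- A search problem on instances: which instances are inputs, and which matchings are
solutions. -/
structure Problem where
  IsInput : ∀ {a b : ℕ}, Instance a b → Prop
  IsSolution : ∀ {a b : ℕ}, Instance a b → (Fin a ≃. Fin b) → Prop

/-- Sex-Equal Stable Marriage: find a stable matching that minimizes `|δ|` (no ties). -/
def SESM : Problem where
  IsInput I := I.Strict
  IsSolution I μ := I.Stable μ ∧ ∀ ν, I.Stable ν → |I.delta μ| ≤ |I.delta ν|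

/-- Balanced Stable Marriage: find a stable matching that minimizes `bal` (no ties). -/
def BSM : Problem where
  IsInput I := I.Strict
  IsSolution I μ := I.Stable μ ∧ ∀ ν, I.Stable ν → I.bal μ ≤ I.bal ν

/-- max-SMT: find a stable matching of maximum size (ties allowed). -/
def maxSMT : Problem where
  IsInput _ := True
  IsSolution I μ := I.Stable μ ∧ ∀ ν, I.Stable ν → matchingSize ν ≤ matchingSize μ

/-- min-SMT: find a stable matching of minimum size (ties allowed). -/
def minSMT : Problem where
  IsInput _ := True
  IsSolution I μ := I.Stable μ ∧ ∀ ν, I.Stable ν → matchingSize μ ≤ matchingSize ν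

/-! ### Treewidth -/

/-- A tree decomposition of `G` whose tree has the node set `Fin N`. -/
structure TreeDecomposition {V : Type} (G : SimpleGraph V) (N : ℕ) where
  tree : SimpleGraph (Fin N)
  isTree : tree.IsTree
  bag : Fin N → Finset V
  edge : ∀ x y, G.Adj x y → ∃ i, x ∈ bag i ∧ y ∈ bag i
  conn : ∀ x, (tree.induce {i | x ∈ bag i}).IsTree

/-- The maximum size of a bag, minus one (and `0` if all bags are empty). -/
def TreeDecomposition.width {V : Type} {G : SimpleGraph V} {N : ℕ}
    (D : TreeDecomposition G N) : ℕ :=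
  (Finset.univ.sup fun i => (D.bag i).card) - 1

/-- The minimum width over all tree decompositions (and `0` for the graph without vertices). -/
noncomputable def treewidth {V : Type} (G : SimpleGraph V) : ℕ :=
  sInf {w | ∃ (N : ℕ) (D : TreeDecomposition G N), D.width = w}

/-! ### The model of computation

First-order recursive programs over binary trees of `cons` cells (the pure first-order fragment of
a list language).  All values are immutable, so that a value is a pointer to a cell, and each step
does a bounded amount of work: it follows or creates one cell, tests a pointer against `nil`, or
binds a variable.  Numbers are not primitive.  Up to a polynomial, the number of steps is the running
time on a Turing machine or on a RAM with logarithmic cost. -/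

/-- The values: `nil` or a cell with two components. -/
inductive Val : Type
  | nil : Val
  | cons : Val → Val → Val

namespace Val

/-- First component (`nil` for `nil`). -/
def hd : Val → Val
  | nil => nil
  | cons x _ => x

/-- Second component (`nil` for `nil`). -/
def tl : Val → Val
  | nil => nil
  | cons _ y => y

/-- A number, in unary. -/
def ofNat : ℕ → Val
  | 0 => nil
  | k + 1 => cons nil (ofNat k)

/-- A list of values, as a chain of cells. -/
def ofList : List Val → Val
  | [] => nil
  | x :: xs => cons x (ofList xs)

end Val

/-- Expressions.  `var i` is the `i`-th most recently bound variable, `ite c x y` evaluates `x`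
if the value of `c` is a cell and `y` if it is `nil`, `bind x y` binds the value of `x` to a new
variable in `y`, and `call f x` calls the `f`-th function of the program. -/
inductive Expr : Type
  | var : ℕ → Expr
  | nil : Expr
  | cons : Expr → Expr → Expr
  | hd : Expr → Expr
  | tl : Expr → Expr
  | ite : Expr → Expr → Expr → Expr
  | bind : Expr → Expr → Expr
  | call : ℕ → Expr → Expr

/-- A program is a finite list of function bodies.  Each function has one argument, which is its
variable `0`; the functions may call one another and themselves. -/
abbrev Program : Type := List Expr

/-- `Eval P env e v t`: in the program `P`, under the variable values `env`, the expression `e`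
evaluates (call by value) to `v` in exactly `t` steps. -/
inductive Eval (P : Program) : List Val → Expr → Val → ℕ → Prop
  | var (env : List Val) (i : ℕ) : Eval P env (.var i) (env.getD i .nil) 1
  | nil (env : List Val) : Eval P env .nil .nil 1
  | cons {env : List Val} {e₁ e₂ : Expr} {v₁ v₂ : Val} {t₁ t₂ : ℕ} :
      Eval P env e₁ v₁ t₁ → Eval P env e₂ v₂ t₂ →
      Eval P env (.cons e₁ e₂) (.cons v₁ v₂) (t₁ + t₂ + 1)
  | hd {env : List Val} {e : Expr} {v : Val} {t : ℕ} :
      Eval P env e v t → Eval P env (.hd e) v.hd (t + 1)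
  | tl {env : List Val} {e : Expr} {v : Val} {t : ℕ} :
      Eval P env e v t → Eval P env (.tl e) v.tl (t + 1)
  | ite_cons {env : List Val} {c e₁ e₂ : Expr} {x y v : Val} {t t₁ : ℕ} :
      Eval P env c (.cons x y) t → Eval P env e₁ v t₁ →
      Eval P env (.ite c e₁ e₂) v (t + t₁ + 1)
  | ite_nil {env : List Val} {c e₁ e₂ : Expr} {v : Val} {t t₂ : ℕ} :
      Eval P env c .nil t → Eval P env e₂ v t₂ →
      Eval P env (.ite c e₁ e₂) v (t + t₂ + 1)
  | bind {env : List Val} {e₁ e₂ : Expr} {v₁ v₂ : Val} {t₁ t₂ : ℕ} :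
      Eval P env e₁ v₁ t₁ → Eval P (v₁ :: env) e₂ v₂ t₂ →
      Eval P env (.bind e₁ e₂) v₂ (t₁ + t₂ + 1)
  | call {env : List Val} {f : ℕ} {e body : Expr} {v r : Val} {t t' : ℕ} :
      Eval P env e v t → P[f]? = some body → Eval P [v] body r t' →
      Eval P env (.call f e) r (t + t' + 1)

/-- On the input `x`, the program `P` (whose main function is its function `0`) halts with the
output `y` after `t` steps. -/
def Program.Outputs (P : Program) (x y : Val) (t : ℕ) : Prop :=
  Eval P [x] (.call 0 (.var 0)) y t

/-- Evaluation is deterministic: output and number of steps are determined by the input. -/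
theorem Eval.deterministic {P : Program} {env : List Val} {e : Expr} {v : Val} {t : ℕ}
    (h : Eval P env e v t) : ∀ {v' : Val} {t' : ℕ}, Eval P env e v' t' → v = v' ∧ t = t' := by
  induction h with
  | var => intro _ _ h'; cases h'; exact ⟨rfl, rfl⟩
  | nil => intro _ _ h'; cases h'; exact ⟨rfl, rfl⟩
  | cons _ _ ih₁ ih₂ =>
    intro _ _ h'
    cases h' with | cons k₁ k₂ => simp [ih₁ k₁, ih₂ k₂]
  | hd _ ih =>
    intro _ _ h'
    cases h' with | hd k => simp [ih k]
  | tl _ ih =>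
    intro _ _ h'
    cases h' with | tl k => simp [ih k]
  | ite_cons _ _ ih₁ ih₂ =>
    intro _ _ h'
    cases h' with
    | ite_cons k₁ k₂ => simp [ih₁ k₁, ih₂ k₂]
    | ite_nil k₁ _ => exact Val.noConfusion (ih₁ k₁).1
  | ite_nil _ _ ih₁ ih₂ =>
    intro _ _ h'
    cases h' with
    | ite_cons k₁ _ => exact Val.noConfusion (ih₁ k₁).1
    | ite_nil k₁ k₂ => simp [ih₁ k₁, ih₂ k₂]
  | bind _ _ ih₁ ih₂ =>
    intro _ _ h'
    cases h' with
    | bind k₁ k₂ =>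
      obtain ⟨rfl, rfl⟩ := ih₁ k₁
      simp [ih₂ k₂]
  | call _ hb _ ih₁ ih₂ =>
    intro _ _ h'
    cases h' with
    | call k₁ hb' k₂ =>
      obtain ⟨rfl, rfl⟩ := ih₁ k₁
      cases hb.symm.trans hb'
      simp [ih₂ k₂]

/-! ### Encodings, and solvability in time `n ^ O(tw)` -/

/-- An instance is given by the table of the men's ranks and the table of the women's ranks, row by
row, where `0` stands for an unacceptable partner. -/
def Instance.encode {a b : ℕ} (I : Instance a b) : Val :=
  .cons
    (.ofList (List.ofFn fun m => .ofList (List.ofFn fun w => .ofNat ((I.pM m w).getD 0))))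
    (.ofList (List.ofFn fun w => .ofList (List.ofFn fun m => .ofNat ((I.pW w m).getD 0))))

/-- A matching is given by the list of the men's partners: `0` for an unmatched man, and `w + 1` for
a man matched to the woman `w`. -/
def encodeMatching {a b : ℕ} (μ : Fin a ≃. Fin b) : Val :=
  .ofList (List.ofFn fun m => .ofNat ((μ m).elim 0 fun w => w.val + 1))

/-- A single program solves the problem, and on an instance with `n` agents whose primal graph has
treewidth `tw` it takes at most `n ^ (c * tw)` steps, where `c` is a constant.  The maxima only
matter if there is no acceptable pair at all: otherwise `2 ≤ n` and `1 ≤ tw`. -/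
def Problem.SolvableInXPTime (Q : Problem) : Prop :=
  ∃ (P : Program) (c : ℕ), ∀ (a b : ℕ) (I : Instance a b), Q.IsInput I →
    ∃ (μ : Fin a ≃. Fin b) (t : ℕ), Q.IsSolution I μ ∧
      P.Outputs I.encode (encodeMatching μ) t ∧
      t ≤ (max (a + b) 2) ^ (c * max (treewidth I.primalGraph) 1)

end StableMarriage

/-! Give every agent a value: unmatched, or the name of a partner. Stability is then a conjunction
of conditions on single agents (the partner is acceptable) and on edges of the primal graph (the two
ends name each other or neither names the other, and they do not both want each other). Hence a set
`C` of agents interacts with the rest only through the values on its neighbourhood N(C). The four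
objectives are functions of the triple (sat of the men, sat of the women, number of pairs). This
triple is additive over the men, and only polynomially many triples occur, because the ranks of an
agent fill an interval `{1, …, t}` and so are at most n (`card_le_of_ranks`). A dynamic program can
therefore keep, for each `C`, each assignment on N(C) and each triple, a single solution on `C`;
non-additive objectives such as |δ| are minimized only at the very end.

No tree decomposition is ever computed. For j = 0, 1, 2, … the program takes the connected
components `C` left after deleting at most j agents. It fills the table of `C` as soon as some `v ∈
C` satisfies |N(C) ∪ {v}| ≤ j and the components of `C \ {v}` already have tables: their
neighbourhoods lie in N(C) ∪ {v}, so the tables can be glued there (`partExact_thin_join`,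
`exact_of_solveAt`). Tables obtained in this way are exact whatever j is (`exact_attempt`);
treewidth matters only for success. If some tree decomposition has bags of size at most j, root it
and let `v` be a vertex of `C` whose topmost node is nearest to the root. As long as the neighbours
of `C` have topmost nodes no deeper than those of `C`, the bag at the topmost node of `v` contains
N(C) ∪ {v} (`mem_bag_of_adj`), and the components of `C \ {v}` inherit this property. So the search
stops at j = tw + 1 at the latest.

There are n^O(j) assignments with at most j defined values, and one attempt is polynomial in the
size of the list of them. This is proved inside the given machine model through a calculus of
polynomial-time functions (`PT`), whose only loop is a fold with polynomially bounded intermediate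
states. Only the search over j lies outside this calculus (`exists_search_program`). An output
exists because stable matchings always do (`exists_stable`). -/

namespace StableMarriage

/-! ### Linking programs -/

/-- Add `d` to the indices of all called functions. -/
def Expr.shift (d : ℕ) : Expr → Expr
  | .var i => .var i
  | .nil => .nil
  | .cons x y => .cons (x.shift d) (y.shift d)
  | .hd x => .hd (x.shift d)
  | .tl x => .tl (x.shift d)
  | .ite c x y => .ite (c.shift d) (x.shift d) (y.shift d)
  | .bind x y => .bind (x.shift d) (y.shift d)
  | .call f x => .call (f + d) (x.shift d)

/-- The functions of `P` stand in `R` from index `d` on. -/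
def LinkedAt (P R : Program) (d : ℕ) : Prop :=
  ∀ f body, P[f]? = some body → R[f + d]? = some (body.shift d)

/-- A derivation refers to the program only through the bodies that it calls, so it can be copied
rule by rule with the same number of steps. -/
theorem Eval.shift {P R : Program} {d : ℕ} (h : LinkedAt P R d) {env : List Val} {e : Expr}
    {v : Val} {t : ℕ} (he : Eval P env e v t) : Eval R env (e.shift d) v t := by
  induction he with
  | var => exact .var _ _
  | nil => exact .nil _
  | cons _ _ h₁ h₂ => exact .cons h₁ h₂
  | hd _ h₁ => exact .hd h₁
  | tl _ h₁ => exact .tl h₁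
  | ite_cons _ _ h₁ h₂ => exact .ite_cons h₁ h₂
  | ite_nil _ _ h₁ h₂ => exact .ite_nil h₁ h₂
  | bind _ _ h₁ h₂ => exact .bind h₁ h₂
  | call _ hb _ h₁ h₂ => exact .call h₁ (h _ _ hb) h₂

theorem linkedAt_append (A P B : Program) :
    LinkedAt P (A ++ (P.map (Expr.shift A.length) ++ B)) A.length := by
  intro f body hf
  have hlt : f < P.length := by
    by_contra hc
    rw [List.getElem?_eq_none (by omega)] at hf
    cases hf
  rw [List.getElem?_append_right (by omega), Nat.add_sub_cancel,
    List.getElem?_append_left (by simpa using hlt), List.getElem?_map, hf]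
  rfl

/-- Evaluation in at most `T` steps. -/
def EvalLE (P : Program) (env : List Val) (e : Expr) (v : Val) (T : ℕ) : Prop :=
  ∃ t ≤ T, Eval P env e v t

namespace EvalLE

variable {P : Program} {env : List Val} {e e₁ e₂ c : Expr} {v v₁ v₂ x y : Val} {T T₁ T₂ : ℕ}

theorem mono (h : EvalLE P env e v T₁) (hT : T₁ ≤ T₂) : EvalLE P env e v T₂ :=
  let ⟨t, ht, he⟩ := h
  ⟨t, ht.trans hT, he⟩

theorem var {i : ℕ} (h : env.getD i .nil = v) : EvalLE P env (.var i) v 1 :=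
  ⟨1, le_rfl, h ▸ .var _ _⟩

theorem nil : EvalLE P env .nil .nil 1 := ⟨1, le_rfl, .nil _⟩

theorem cons (h₁ : EvalLE P env e₁ v₁ T₁) (h₂ : EvalLE P env e₂ v₂ T₂) :
    EvalLE P env (.cons e₁ e₂) (.cons v₁ v₂) (T₁ + T₂ + 1) :=
  let ⟨_, ht₁, he₁⟩ := h₁
  let ⟨_, ht₂, he₂⟩ := h₂
  ⟨_, by omega, .cons he₁ he₂⟩

theorem hd (h : EvalLE P env e v T) : EvalLE P env (.hd e) v.hd (T + 1) :=
  let ⟨_, ht, he⟩ := h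
  ⟨_, by omega, .hd he⟩

theorem tl (h : EvalLE P env e v T) : EvalLE P env (.tl e) v.tl (T + 1) :=
  let ⟨_, ht, he⟩ := h
  ⟨_, by omega, .tl he⟩

theorem ite_cons (h₁ : EvalLE P env c (.cons x y) T₁) (h₂ : EvalLE P env e₁ v T₂) :
    EvalLE P env (.ite c e₁ e₂) v (T₁ + T₂ + 1) :=
  let ⟨_, ht₁, he₁⟩ := h₁
  let ⟨_, ht₂, he₂⟩ := h₂
  ⟨_, by omega, .ite_cons he₁ he₂⟩

theorem ite_nil (h₁ : EvalLE P env c .nil T₁) (h₂ : EvalLE P env e₂ v T₂) :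
    EvalLE P env (.ite c e₁ e₂) v (T₁ + T₂ + 1) :=
  let ⟨_, ht₁, he₁⟩ := h₁
  let ⟨_, ht₂, he₂⟩ := h₂
  ⟨_, by omega, .ite_nil he₁ he₂⟩

theorem bind (h₁ : EvalLE P env e₁ v₁ T₁) (h₂ : EvalLE P (v₁ :: env) e₂ v₂ T₂) :
    EvalLE P env (.bind e₁ e₂) v₂ (T₁ + T₂ + 1) :=
  let ⟨_, ht₁, he₁⟩ := h₁
  let ⟨_, ht₂, he₂⟩ := h₂
  ⟨_, by omega, .bind he₁ he₂⟩

theorem call {f : ℕ} {body : Expr} (h₁ : EvalLE P env e v T₁) (hb : P[f]? = some body)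
    (h₂ : EvalLE P [v] body x T₂) : EvalLE P env (.call f e) x (T₁ + T₂ + 1) :=
  let ⟨_, ht₁, he₁⟩ := h₁
  let ⟨_, ht₂, he₂⟩ := h₂
  ⟨_, by omega, .call he₁ hb he₂⟩

/-- Calling the main function of a linked program. -/
theorem callLinked {Q : Program} {d : ℕ} (hl : LinkedAt Q P d)
    (hq : EvalLE Q [v] (.call 0 (.var 0)) x T) (h : EvalLE P env e v T₁) :
    EvalLE P env (.call d e) x (T₁ + T) := by
  obtain ⟨t, ht, he⟩ := hq
  obtain ⟨t₁, ht₁, he₁⟩ := h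
  -- The bound `T` includes one step for the argument `var 0` and one for the call. Replacing that
  -- argument by `e` exchanges the former for at most `T₁` steps.
  cases he with
  | call hv hb hbody =>
    cases hv
    have hb' := hl _ _ hb
    rw [Nat.zero_add] at hb'
    exact ⟨_, by omega, .call he₁ hb' (hbody.shift hl)⟩

end EvalLE

/-- Running `P` and then `Q`. -/
theorem exists_program_comp (P Q : Program) : ∃ R : Program, ∀ {a b c : Val} {T S : ℕ},
    EvalLE P [a] (.call 0 (.var 0)) b T → EvalLE Q [b] (.call 0 (.var 0)) c S →
    EvalLE R [a] (.call 0 (.var 0)) c (T + S + 3) := by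
  -- Function `0` is the glue; the functions of `P` start at index `1`, and those of `Q` directly
  -- after them.
  let A : Program := [.call (1 + P.length) (.call 1 (.var 0))]
  let B := Q.map (Expr.shift (1 + P.length))
  have lP : LinkedAt P (A ++ (P.map (Expr.shift 1) ++ B)) 1 := linkedAt_append A P B
  have lQ : LinkedAt Q (A ++ (P.map (Expr.shift 1) ++ B)) (1 + P.length) := by
    have h := linkedAt_append (A ++ P.map (Expr.shift 1)) Q []
    have hl : (A ++ P.map (Expr.shift 1)).length = 1 + P.length := by simp [A]; omega
    rw [hl] at h
    simpa [B] using h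
  exact ⟨_, fun hP hQ => (EvalLE.call (.var rfl) rfl
    (.callLinked lQ hQ (.callLinked lP hP (.var rfl)))).mono (by omega)⟩

/-! ### Polynomial bounds -/

/-- The number of cells of a value, as a tree. -/
def Val.size : Val → ℕ
  | .nil => 0
  | .cons x y => x.size + y.size + 1

/-- `T i` is bounded by a polynomial in `s i`. -/
def PolyBd {ι : Type} (s T : ι → ℕ) : Prop := ∃ c, ∀ i, T i ≤ (s i + 2) ^ c

namespace PolyBd

variable {ι : Type} {s T T₁ T₂ : ι → ℕ}

theorem mono (h : PolyBd s T₂) (hT : ∀ i, T₁ i ≤ T₂ i) : PolyBd s T₁ :=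
  let ⟨c, hc⟩ := h
  ⟨c, fun i => (hT i).trans (hc i)⟩

theorem self : PolyBd s s := ⟨1, fun i => by simp⟩

/-- The base `s i + 2` is at least `2` even for an empty input, so constants, and the factor `2`
that arises from sums, are absorbed by the exponent. -/
theorem const (k : ℕ) : PolyBd s fun _ => k :=
  ⟨k, fun i => by
    calc k ≤ 2 ^ k := Nat.lt_two_pow_self.le
      _ ≤ (s i + 2) ^ k := Nat.pow_le_pow_left (by omega) _⟩

theorem mul (h₁ : PolyBd s T₁) (h₂ : PolyBd s T₂) : PolyBd s fun i => T₁ i * T₂ i := by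
  obtain ⟨c, hc⟩ := h₁
  obtain ⟨d, hd⟩ := h₂
  exact ⟨c + d, fun i => by rw [pow_add]; exact Nat.mul_le_mul (hc i) (hd i)⟩

theorem add (h₁ : PolyBd s T₁) (h₂ : PolyBd s T₂) : PolyBd s fun i => T₁ i + T₂ i := by
  obtain ⟨c, hc⟩ := h₁
  obtain ⟨d, hd⟩ := h₂
  refine ⟨max c d + 1, fun i => ?_⟩
  have h₁ : (s i + 2) ^ c ≤ (s i + 2) ^ max c d := Nat.pow_le_pow_right (by omega) (by omega)
  have h₂ : (s i + 2) ^ d ≤ (s i + 2) ^ max c d := Nat.pow_le_pow_right (by omega) (by omega)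
  have h₃ : (s i + 2) ^ max c d * 2 ≤ (s i + 2) ^ (max c d + 1) := by
    rw [pow_succ]
    exact Nat.mul_le_mul_left _ (by omega)
  have h₄ := hc i
  have h₅ := hd i
  show T₁ i + T₂ i ≤ _
  omega

theorem pow (h : PolyBd s T) (k : ℕ) : PolyBd s fun i => T i ^ k := by
  induction k with
  | zero => simpa using const 1
  | succ k ih => simpa [pow_succ] using ih.mul h

theorem trans {r : ι → ℕ} (h₁ : PolyBd s T) (h₂ : PolyBd r s) : PolyBd r T := by
  obtain ⟨c, hc⟩ := h₁
  exact ((h₂.add (const 2)).pow c).mono hc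

theorem reindex {κ : Type} (h : PolyBd s T) (g : κ → ι) :
    PolyBd (fun k => s (g k)) fun k => T (g k) :=
  let ⟨c, hc⟩ := h
  ⟨c, fun k => hc (g k)⟩

end PolyBd

/-! ### Polynomial-time computable families of values -/

/-- A single program computes `b i` from `a i`, for all `i`, in time polynomial in the size of `a i`,
and the size of `b i` is polynomial in that of `a i`. -/
def PolyComp {ι : Type} (a b : ι → Val) : Prop :=
  PolyBd (fun i => (a i).size) (fun i => (b i).size) ∧
  ∃ (P : Program) (T : ι → ℕ), PolyBd (fun i => (a i).size) T ∧
    ∀ i, EvalLE P [a i] (.call 0 (.var 0)) (b i) (T i)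

namespace PolyComp

variable {ι : Type} {a b c d : ι → Val}

theorem of_expr (e : Expr) (k : ℕ) (h : ∀ i, EvalLE [e] [a i] e (b i) k)
    (hs : PolyBd (fun i => (a i).size) fun i => (b i).size) : PolyComp a b :=
  ⟨hs, [e], fun _ => 1 + k + 1, .const _, fun i => .call (.var rfl) rfl (h i)⟩

protected theorem id (a : ι → Val) : PolyComp a a :=
  of_expr (.var 0) 1 (fun _ => .var rfl) .self

/-- The second running time is polynomial in the size of the intermediate value; this is why the
definition bounds output sizes as well as times. -/
theorem comp (hg : PolyComp b c) (hf : PolyComp a b) : PolyComp a c := by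
  obtain ⟨sf, P, T, hT, hP⟩ := hf
  obtain ⟨sg, Q, S, hS, hQ⟩ := hg
  obtain ⟨R, hR⟩ := exists_program_comp P Q
  exact ⟨sg.trans sf, R, fun i => T i + S i + 3, (hT.add (hS.trans sf)).add (.const 3),
    fun i => hR (hP i) (hQ i)⟩

theorem pair (hf : PolyComp a b) (hg : PolyComp a c) :
    PolyComp a fun i => .cons (b i) (c i) := by
  obtain ⟨sf, P, T, hT, hP⟩ := hf
  obtain ⟨sg, Q, S, hS, hQ⟩ := hg
  let A : Program := [.cons (.call 1 (.var 0)) (.call (1 + P.length) (.var 0))]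
  let B := Q.map (Expr.shift (1 + P.length))
  have lP : LinkedAt P (A ++ (P.map (Expr.shift 1) ++ B)) 1 := linkedAt_append A P B
  have lQ : LinkedAt Q (A ++ (P.map (Expr.shift 1) ++ B)) (1 + P.length) := by
    have h := linkedAt_append (A ++ P.map (Expr.shift 1)) Q []
    have hl : (A ++ P.map (Expr.shift 1)).length = 1 + P.length := by simp [A]; omega
    rw [hl] at h
    simpa [B] using h
  refine ⟨(sf.add sg).add (.const 1), _, fun i => 1 + ((1 + T i) + (1 + S i) + 1) + 1,
    ((PolyBd.const 1).add ((((PolyBd.const 1).add hT).add ((PolyBd.const 1).add hS)).add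
      (.const 1))).add (.const 1),
    fun i => .call (.var rfl) rfl (.cons (.callLinked lP (hP i) (.var rfl))
      (.callLinked lQ (hQ i) (.var rfl)))⟩

theorem nil : PolyComp a fun _ => .nil :=
  of_expr .nil 1 (fun _ => .nil) (.const 0)

theorem size_hd_le (v : Val) : v.hd.size ≤ v.size := by
  cases v <;> simp [Val.hd, Val.size]; omega

theorem size_tl_le (v : Val) : v.tl.size ≤ v.size := by
  cases v <;> simp [Val.tl, Val.size]; omega

theorem hd (hf : PolyComp a b) : PolyComp a fun i => (b i).hd :=
  .comp (of_expr (.hd (.var 0)) 2 (fun _ => .hd (.var rfl))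
    (PolyBd.self.mono fun i => size_hd_le (b i))) hf

theorem tl (hf : PolyComp a b) : PolyComp a fun i => (b i).tl :=
  .comp (of_expr (.tl (.var 0)) 2 (fun _ => .tl (.var rfl))
    (PolyBd.self.mono fun i => size_tl_le (b i))) hf

/-- Case distinction on whether a value is `nil`. -/
def _root_.StableMarriage.Val.sel : Val → Val → Val → Val
  | .nil, _, y => y
  | .cons _ _, x, _ => x

/-- Both branches are computed before the test, so that only a constant-time program on triples is
needed. -/
theorem sel (hc : PolyComp a b) (hf : PolyComp a c) (hg : PolyComp a d) :
    PolyComp a fun i => (b i).sel (c i) (d i) := by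
  refine .comp (b := fun i => .cons (b i) (.cons (c i) (d i)))
    (of_expr (.ite (.hd (.var 0)) (.hd (.tl (.var 0))) (.tl (.tl (.var 0)))) 6 ?_ ?_)
    (hc.pair (hf.pair hg))
  · intro i
    cases h : b i with
    | nil => exact (EvalLE.ite_nil (.hd (.var rfl)) (.tl (.tl (.var rfl)))).mono (by omega)
    | cons x y =>
      exact (EvalLE.ite_cons (x := x) (y := y) (.hd (.var rfl)) (.hd (.tl (.var rfl)))).mono
        (by omega)
  · refine PolyBd.self.mono fun i => ?_
    cases b i <;> simp only [Val.sel, Val.size] <;> omega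

end PolyComp

/-! ### Typed values -/

/-- A type whose elements are represented by values. -/
class Enc (α : Type) where
  enc : α → Val

open Enc

instance : Enc Unit := ⟨fun _ => .nil⟩
instance : Enc ℕ := ⟨Val.ofNat⟩
instance : Enc Bool := ⟨fun b => cond b (.cons .nil .nil) .nil⟩
instance {α β : Type} [Enc α] [Enc β] : Enc (α × β) := ⟨fun p => .cons (enc p.1) (enc p.2)⟩
instance {α : Type} [Enc α] : Enc (List α) := ⟨fun l => .ofList (l.map enc)⟩
instance {α : Type} [Enc α] : Enc (Option α) := ⟨fun o => o.elim .nil fun x => .cons (enc x) .nil⟩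

/-- The size of the representation. -/
def sz {α : Type} [Enc α] (x : α) : ℕ := (enc x).size

section Size

variable {α β : Type} [Enc α] [Enc β]

theorem size_ofNat (n : ℕ) : (Val.ofNat n).size = n := by
  induction n with
  | zero => rfl
  | succ n ih => simp [Val.ofNat, Val.size, ih]

@[simp] theorem sz_nat (n : ℕ) : sz n = n := size_ofNat n

@[simp] theorem sz_pair (p : α × β) : sz p = sz p.1 + sz p.2 + 1 := rfl
@[simp] theorem sz_nil : sz ([] : List α) = 0 := rfl
@[simp] theorem sz_cons (x : α) (l : List α) : sz (x :: l) = sz x + sz l + 1 := rfl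
@[simp] theorem sz_none : sz (none : Option α) = 0 := rfl
@[simp] theorem sz_some (x : α) : sz (some x) = sz x + 1 := rfl

@[simp] theorem sz_append (l l' : List α) : sz (l ++ l') = sz l + sz l' := by
  induction l with
  | nil => simp
  | cons x l ih => simp [ih]; omega

theorem length_le_sz (l : List α) : l.length ≤ sz l := by
  induction l with
  | nil => simp
  | cons x l ih => simp; omega

theorem sz_le_of_mem {x : α} {l : List α} (h : x ∈ l) : sz x ≤ sz l := by
  induction l with
  | nil => simp at h
  | cons y l ih =>
    rcases List.mem_cons.1 h with rfl | h
    · simp; omega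
    · have := ih h
      simp; omega

theorem sz_list_le {l : List α} {B n : ℕ} (hl : l.length ≤ n) (h : ∀ x ∈ l, sz x ≤ B) :
    sz l ≤ n * (B + 1) := by
  induction l generalizing n with
  | nil => simp
  | cons x l ih =>
    obtain _ | n := n
    · simp at hl
    · have h₁ := ih (n := n) (by simpa using hl) fun y hy => h y (List.mem_cons_of_mem _ hy)
      have h₂ := h x List.mem_cons_self
      rw [sz_cons, Nat.add_mul]
      omega

theorem sz_sublist {l l' : List α} (h : l.Sublist l') : sz l ≤ sz l' := by
  induction h with
  | slnil => simp
  | cons _ _ ih => simp; omega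
  | cons_cons _ _ ih => simp; omega

theorem sz_flatten (l : List (List α)) : sz l.flatten + l.length = sz l := by
  induction l with
  | nil => simp
  | cons x l ih => simp; omega

end Size

end StableMarriage

namespace StableMarriage
open Enc

/-! ### Polynomial-time computable functions -/

/-- `f` is computed by a program in polynomial time, and the size of its values is polynomially
bounded. -/
@[fun_prop]
def PT {α β : Type} [Enc α] [Enc β] (f : α → β) : Prop :=
  PolyComp (fun x => enc x) fun x => enc (f x)

namespace PT

variable {α β γ δ σ : Type} [Enc α] [Enc β] [Enc γ] [Enc δ] [Enc σ]

theorem polyBd {f : α → β} (hf : PT f) : PolyBd sz fun x => sz (f x) := hf.1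

@[fun_prop] protected theorem id : PT fun x : α => x := PolyComp.id _

@[fun_prop] theorem comp {g : β → γ} {f : α → β} (hg : PT g) (hf : PT f) : PT fun x => g (f x) := by
  obtain ⟨sg, P, T, hT, hP⟩ := hg
  exact PolyComp.comp (b := fun x => enc (f x))
    ⟨sg.reindex f, P, fun x => T (f x), hT.reindex f, fun x => hP (f x)⟩ hf

omit [Enc α] in
theorem constVal (v : Val) {a : α → Val} : PolyComp a fun _ => v := by
  induction v with
  | nil => exact .nil
  | cons _ _ h₁ h₂ => exact h₁.pair h₂

@[fun_prop] theorem const (y : β) : PT fun _ : α => y := constVal (enc y)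

@[fun_prop] theorem pair {f : α → β} {g : α → γ} (hf : PT f) (hg : PT g) :
    PT fun x => (f x, g x) := PolyComp.pair hf hg

@[fun_prop] theorem fst {f : α → β × γ} (hf : PT f) : PT fun x => (f x).1 := PolyComp.hd hf

@[fun_prop] theorem snd {f : α → β × γ} (hf : PT f) : PT fun x => (f x).2 := PolyComp.tl hf

@[fun_prop] theorem cond {c : α → Bool} {f g : α → β} (hc : PT c) (hf : PT f) (hg : PT g) :
    PT fun x => bif c x then f x else g x := by
  refine cast (congrArg (PolyComp _) (funext fun x => ?_)) (PolyComp.sel hc hf hg)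
  beta_reduce
  cases c x <;> rfl

@[fun_prop] theorem some {f : α → β} (hf : PT f) : PT fun x => Option.some (f x) :=
  PolyComp.pair hf .nil

@[fun_prop] theorem isSome {f : α → Option β} (hf : PT f) : PT fun x => (f x).isSome := by
  refine cast (congrArg (PolyComp _) (funext fun x => ?_)) (PolyComp.sel hf
    (constVal (enc true)) (constVal (enc false)))
  beta_reduce
  cases f x <;> rfl

@[fun_prop] theorem consList {f : α → β} {l : α → List β} (hf : PT f) (hl : PT l) :
    PT fun x => f x :: l x := PolyComp.pair hf hl

/-- The option-valued head. -/
@[fun_prop] theorem head? {l : α → List β} (hl : PT l) : PT fun x => (l x).head? := by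
  refine cast (congrArg (PolyComp _) (funext fun x => ?_)) (PolyComp.sel hl
    (.pair (.hd hl) .nil) .nil)
  beta_reduce
  cases l x <;> rfl

@[fun_prop] theorem tail {l : α → List β} (hl : PT l) : PT fun x => (l x).tail := by
  refine cast (congrArg (PolyComp _) (funext fun x => ?_)) (PolyComp.tl hl)
  beta_reduce
  cases l x <;> rfl

@[fun_prop] theorem isEmpty {l : α → List β} (hl : PT l) : PT fun x => (l x).isEmpty := by
  refine cast (congrArg (PolyComp _) (funext fun x => ?_)) (PolyComp.sel hl
    (constVal (enc false)) (constVal (enc true)))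
  beta_reduce
  cases l x <;> rfl

/-! ### Loops with polynomially bounded states -/

/-- Loop for `List.foldl`: the argument is `(x, s, l)`, and function `1` maps `(x, s, y)` to the
next state. -/
def foldlBody : Expr :=
  .ite (.tl (.tl (.var 0)))
    (.call 0 (.cons (.hd (.var 0)) (.cons
      (.call 1 (.cons (.hd (.var 0)) (.cons (.hd (.tl (.var 0))) (.hd (.tl (.tl (.var 0)))))))
      (.tl (.tl (.tl (.var 0)))))))
    (.hd (.tl (.var 0)))

/-- The step bound `M` is demanded only at states reached on a prefix of the list: the cost of a
step depends on the size of its state, and arbitrary states can be arbitrarily large. The `25` per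
round and the final `10` pay for taking the triple apart and rebuilding it. -/
theorem eval_foldl {R : Program} (h0 : R[0]? = Option.some foldlBody) {F : α → σ → β → σ}
    {x : α} {M : ℕ} (l : List β) (s : σ)
    (hF : ∀ l₁ y, l₁ ++ [y] <+: l → ∀ env e T,
      EvalLE R env e (enc (x, l₁.foldl (F x) s, y)) T →
      EvalLE R env (.call 1 e) (enc (F x (l₁.foldl (F x) s) y)) (T + M))
    (env : List Val) (e : Expr) (T : ℕ) (he : EvalLE R env e (enc (x, s, l)) T) :
    EvalLE R env (.call 0 e) (enc (l.foldl (F x) s)) (T + (M + 25) * l.length + 10) := by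
  induction l generalizing s env e T with
  | nil =>
    refine (EvalLE.call he h0 (T₂ := 7) ?_).mono (by simp)
    exact (EvalLE.ite_nil (.tl (.tl (.var rfl))) (.hd (.tl (.var rfl)))).mono (by omega)
  | cons y l ih =>
    have hs : ∀ env e T, EvalLE R env e (enc (x, s, y)) T →
        EvalLE R env (.call 1 e) (enc (F x s y)) (T + M) :=
      hF [] y ⟨l, rfl⟩
    have hl := ih (F x s y) (fun l₁ z hz env e T h =>
      hF (y :: l₁) z (List.cons_prefix_cons.2 ⟨rfl, hz⟩) env e T h)
    refine (EvalLE.call he h0 (T₂ := M + 20 + (M + 25) * l.length + 10 + 4) ?_).mono ?_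
    · refine (EvalLE.ite_cons (x := enc y) (y := enc l) (T₁ := 3)
        (T₂ := M + 20 + (M + 25) * l.length + 10) (.tl (.tl (.var rfl))) ?_).mono (by omega)
      refine (hl _ _ (M + 20) ?_)
      refine (EvalLE.cons (T₁ := 2) (.hd (.var rfl)) (.cons (v₁ := enc (F x s y)) (T₁ := 11 + M)
        (T₂ := 4) ?_ (.tl (.tl (.tl (.var rfl)))))).mono (by omega)
      refine hs _ _ 11 ?_
      exact (EvalLE.cons (.hd (.var rfl)) (.cons (.hd (.tl (.var rfl)))
        (.hd (.tl (.tl (.var rfl)))))).mono (by omega)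
    · rw [List.length_cons, Nat.mul_add]
      omega

/-- Bounded recursion: a loop over a polynomially long list is polynomial as soon as all the
intermediate states have polynomial size. Without the hypothesis on sizes, a step that doubles its
state would be a counterexample. -/
theorem foldl {L : α → List β} {s : α → σ} {F : α → σ → β → σ} (hL : PT L) (hs : PT s)
    (hF : PT fun p : α × σ × β => F p.1 p.2.1 p.2.2)
    (hb : ∃ B : α → ℕ, PolyBd sz B ∧ ∀ x l, l <+: L x → sz (l.foldl (F x) (s x)) ≤ B x) :
    PT fun x => (L x).foldl (F x) (s x) := by
  obtain ⟨B, hB, hbd⟩ := hb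
  refine PolyComp.comp (b := fun x => enc (x, s x, L x)) ?_ (pair .id (pair hs hL))
  have self : PolyBd (fun x : α => (enc (x, s x, L x)).size) (fun x => sz x) :=
    PolyBd.self.mono fun x => show sz x ≤ sz (x, s x, L x) by simp; omega
  have selfL : PolyBd (fun x : α => (enc (x, s x, L x)).size) (fun x => sz (L x)) :=
    PolyBd.self.mono fun x => show sz (L x) ≤ sz (x, s x, L x) by simp; omega
  have hB' := hB.trans self
  obtain ⟨-, P, T, ⟨c, hc⟩, hP⟩ := hF
  -- A step runs on a triple of size at most `sz x + (B x + sz (L x) + 1) + 1`, which gives its time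
  -- bound; `sz (L x)` bounds the number of rounds.
  refine ⟨hB'.mono fun x => hbd x _ (List.prefix_refl _), foldlBody :: P.map (Expr.shift 1),
    fun x => 1 + ((sz x + (B x + sz (L x) + 1) + 1 + 2) ^ c + 25) * sz (L x) + 10, ?_, ?_⟩
  · refine (PolyBd.add ?_ (.const 10))
    refine (PolyBd.const 1).add (.mul ((PolyBd.pow ?_ c).add (.const 25)) selfL)
    exact (((self.add ((hB'.add selfL).add (.const 1))).add (.const 1)).add (.const 2))
  · intro x
    have hl : LinkedAt P (foldlBody :: P.map (Expr.shift 1)) 1 := by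
      simpa using linkedAt_append [foldlBody] P []
    refine (eval_foldl (M := (sz x + (B x + sz (L x) + 1) + 1 + 2) ^ c) rfl (L x) (s x) ?_ _ _ 1
      (.var rfl)).mono ?_
    · intro l₁ y hy env e T' he
      refine (EvalLE.callLinked hl (hP (x, l₁.foldl (F x) (s x), y)) he).mono ?_
      refine Nat.add_le_add_left ((hc _).trans (Nat.pow_le_pow_left ?_ _)) _
      show sz (x, l₁.foldl (F x) (s x), y) + 2 ≤ _
      have h₁ := hbd x l₁ ((List.prefix_append _ _).trans hy)
      have h₂ : sz y ≤ sz (L x) := sz_le_of_mem (hy.subset (by simp))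
      simp only [sz_pair]
      omega
    · have := Nat.mul_le_mul_left ((sz x + (B x + sz (L x) + 1) + 1 + 2) ^ c + 25)
        (length_le_sz (L x))
      beta_reduce
      omega

/-- A fold in which each step adds a bounded amount to the size of the state. -/
theorem foldl_of_size_le {L : α → List β} {s : α → σ} {F : α → σ → β → σ} (hL : PT L) (hs : PT s)
    (hF : PT fun p : α × σ × β => F p.1 p.2.1 p.2.2)
    (hb : ∃ B : α → ℕ, PolyBd sz B ∧ ∀ x, ∀ y ∈ L x, ∀ t, sz (F x t y) ≤ sz t + B x) :
    PT fun x => (L x).foldl (F x) (s x) := by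
  obtain ⟨B, hB, hbd⟩ := hb
  refine foldl hL hs hF ⟨fun x => sz (s x) + sz (L x) * B x, hs.polyBd.add (hL.polyBd.mul hB), ?_⟩
  intro x l hl
  have key : ∀ (l : List β) (t : σ), (∀ y ∈ l, y ∈ L x) →
      sz (l.foldl (F x) t) ≤ sz t + l.length * B x := by
    intro l
    induction l with
    | nil => simp
    | cons y l ih =>
      intro t hm
      have h₁ := ih (F x t y) fun z hz => hm z (List.mem_cons_of_mem _ hz)
      have h₂ := hbd x y (hm y List.mem_cons_self) t
      rw [List.foldl_cons, List.length_cons, Nat.add_mul]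
      omega
  refine (key l (s x) fun y hy => hl.subset hy).trans ?_
  exact Nat.add_le_add_left (Nat.mul_le_mul_right _ (hl.length_le.trans (length_le_sz _))) _

/-- A fold in which the size of each new state is bounded. -/
theorem foldl_of_bounded {L : α → List β} {s : α → σ} {F : α → σ → β → σ} (hL : PT L) (hs : PT s)
    (hF : PT fun p : α × σ × β => F p.1 p.2.1 p.2.2)
    (hb : ∃ B : α → ℕ, PolyBd sz B ∧ ∀ x, ∀ y ∈ L x, ∀ t, sz (F x t y) ≤ B x) :
    PT fun x => (L x).foldl (F x) (s x) := by
  obtain ⟨B, hB, hbd⟩ := hb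
  refine foldl hL hs hF ⟨fun x => sz (s x) + B x, hs.polyBd.add hB, ?_⟩
  intro x l hl
  rcases List.eq_nil_or_concat l with rfl | ⟨l, y, rfl⟩
  · simp
  · rw [List.concat_eq_append, List.foldl_append]
    exact (hbd x y (hl.subset (by simp)) _).trans (by simp)

/-- The bound for the size of `G (x, y)` when `y` is a member of a list computed from `x`. -/
theorem bound_of_mem {L : α → List β} {G : α × β → γ} (hL : PT L) (hG : PT G) :
    ∃ B : α → ℕ, PolyBd sz B ∧ ∀ x, ∀ y ∈ L x, sz (G (x, y)) ≤ B x := by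
  obtain ⟨c, hc⟩ := hG.polyBd
  refine ⟨fun x => (sz x + sz (L x) + 1 + 2) ^ c,
    (((PolyBd.self.add hL.polyBd).add (.const 1)).add (.const 2)).pow c, fun x y hy =>
      (hc (x, y)).trans (Nat.pow_le_pow_left ?_ c)⟩
  have := sz_le_of_mem hy
  simp only [sz_pair]
  omega

/-- An option and the list of its members are encoded by the same value, so there is nothing to
compute. -/
theorem toList {f : α → Option β} (hf : PT f) : PT fun x => (f x).toList := by
  refine cast (congrArg (PolyComp _) (funext fun x => ?_)) hf
  beta_reduce
  cases f x <;> rfl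

-- A loop over at most one member; this hands the member to `g` when there is one.
@[fun_prop] theorem optionElim {f : α → Option β} {d : α → γ} {g : α → β → γ} (hf : PT f)
    (hd : PT d) (hg : PT fun p : α × β => g p.1 p.2) :
    PT fun x => (f x).elim (d x) (g x) := by
  have h : PT fun x => (f x).toList.foldl (fun _ y => g x y) (d x) := by
    refine foldl_of_bounded hf.toList hd ?_ ?_
    · fun_prop
    · obtain ⟨B, hB, h⟩ := bound_of_mem hf.toList hg
      exact ⟨B, hB, fun x y hy _ => h x y hy⟩
  refine cast (congrArg PT (funext fun x => ?_)) h
  cases f x <;> rfl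

@[fun_prop] theorem optionBind {f : α → Option β} {g : α → β → Option γ} (hf : PT f)
    (hg : PT fun p : α × β => g p.1 p.2) : PT fun x => (f x).bind (g x) := by
  refine cast (congrArg PT (funext fun x => ?_)) (hf.optionElim (const Option.none) hg)
  cases f x <;> rfl

@[fun_prop] theorem optionMap {f : α → Option β} {g : α → β → γ} (hf : PT f)
    (hg : PT fun p : α × β => g p.1 p.2) : PT fun x => (f x).map (g x) := by
  refine cast (congrArg PT (funext fun x => ?_)) (hf.optionElim (g := fun x y => Option.some (g x y)) (const Option.none) hg.some)
  cases f x <;> rfl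

@[fun_prop] theorem optionGetD {f : α → Option β} {d : α → β} (hf : PT f) (hd : PT d) :
    PT fun x => (f x).getD (d x) := by
  refine cast (congrArg PT (funext fun x => ?_)) (hf.optionElim (g := fun _ y => y) hd (.snd .id))
  cases f x <;> rfl

/-! ### List operations -/

@[fun_prop] theorem reverse {l : α → List β} (hl : PT l) : PT fun x => (l x).reverse := by
  have h : PT fun x => (l x).foldl (fun s y => y :: s) [] := by
    refine foldl_of_size_le hl (const []) ?_ ⟨_, hl.polyBd.add (.const 1), fun x y hy t => ?_⟩
    · fun_prop
    · have := sz_le_of_mem hy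
      simp only [sz_cons]
      omega
  simpa using h

@[fun_prop] theorem append {l l' : α → List β} (hl : PT l) (hl' : PT l') :
    PT fun x => l x ++ l' x := by
  have h : PT fun x => (l x).reverse.foldl (fun s y => y :: s) (l' x) := by
    refine foldl_of_size_le hl.reverse hl' ?_ ⟨_, hl.polyBd.add (.const 1), fun x y hy t => ?_⟩
    · fun_prop
    · have := sz_le_of_mem (List.mem_reverse.1 hy)
      simp only [sz_cons]
      omega
  simpa using h

@[fun_prop] theorem map {L : α → List β} {g : α → β → γ} (hL : PT L)
    (hg : PT fun p : α × β => g p.1 p.2) : PT fun x => (L x).map (g x) := by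
  have h : PT fun x => ((L x).foldl (fun s y => g x y :: s) []).reverse := by
    refine reverse (foldl_of_size_le hL (const []) ?_ ?_)
    · exact consList (hg.comp (pair (fst .id) (snd (snd .id)))) (by fun_prop)
    · obtain ⟨B, hB, h⟩ := bound_of_mem hL hg
      refine ⟨_, hB.add (.const 1), fun x y hy t => ?_⟩
      have : sz (g x y) ≤ B x := h x y hy
      simp only [sz_cons]
      omega
  refine cast (congrArg PT (funext fun x => ?_)) h
  simp

@[fun_prop] theorem flatten {L : α → List (List β)} (hL : PT L) : PT fun x => (L x).flatten := by
  have h : PT fun x => (L x).foldl (fun s y => s ++ y) [] := by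
    refine foldl_of_size_le hL (const []) ?_ ⟨_, hL.polyBd, fun x y hy t => ?_⟩
    · fun_prop
    · have := sz_le_of_mem hy
      simp only [sz_append]
      omega
  refine cast (congrArg PT (funext fun x => ?_)) h
  suffices ∀ (l : List (List β)) (s : List β), l.foldl (fun s y => s ++ y) s =
      s ++ l.flatten by simp [this (L x) []]
  intro l
  induction l with
  | nil => simp
  | cons y l ih => simp [ih]

@[fun_prop] theorem flatMap {L : α → List β} {g : α → β → List γ} (hL : PT L)
    (hg : PT fun p : α × β => g p.1 p.2) : PT fun x => (L x).flatMap (g x) := by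
  simpa only [List.flatMap] using (hL.map hg).flatten

@[fun_prop] theorem filter {L : α → List β} {g : α → β → Bool} (hL : PT L)
    (hg : PT fun p : α × β => g p.1 p.2) : PT fun x => (L x).filter (g x) := by
  have h : PT fun x => (L x).flatMap fun y => bif g x y then [y] else [] := by
    refine hL.flatMap ?_
    fun_prop
  refine cast (congrArg PT (funext fun x => ?_)) h
  induction L x with
  | nil => rfl
  | cons y l ih =>
    rw [List.flatMap_cons, ih, List.filter_cons]
    cases g x y <;> rfl

@[fun_prop] theorem filterMap {L : α → List β} {g : α → β → Option γ} (hL : PT L)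
    (hg : PT fun p : α × β => g p.1 p.2) : PT fun x => (L x).filterMap (g x) := by
  have h : PT fun x => (L x).flatMap fun y => (g x y).toList := by
    refine hL.flatMap ?_
    exact hg.toList
  refine cast (congrArg PT (funext fun x => ?_)) h
  induction L x with
  | nil => rfl
  | cons y l ih =>
    rw [List.flatMap_cons, ih, List.filterMap_cons]
    cases g x y <;> rfl

@[fun_prop] theorem find? {L : α → List β} {g : α → β → Bool} (hL : PT L)
    (hg : PT fun p : α × β => g p.1 p.2) : PT fun x => (L x).find? (g x) := by
  simpa only [List.head?_filter] using (hL.filter hg).head?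

/-! ### Boolean operations and quantifiers over lists -/

@[fun_prop] theorem not {f : α → Bool} (hf : PT f) : PT fun x => !f x := by
  refine cast (congrArg PT (funext fun x => ?_)) (hf.cond (const false) (const true))
  cases f x <;> rfl

@[fun_prop] theorem and {f g : α → Bool} (hf : PT f) (hg : PT g) : PT fun x => f x && g x := by
  refine cast (congrArg PT (funext fun x => ?_)) (hf.cond hg (const false))
  cases f x <;> rfl

@[fun_prop] theorem or {f g : α → Bool} (hf : PT f) (hg : PT g) : PT fun x => f x || g x := by
  refine cast (congrArg PT (funext fun x => ?_)) (hf.cond (const true) hg)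
  cases f x <;> rfl

@[fun_prop] theorem beq {f g : α → Bool} (hf : PT f) (hg : PT g) : PT fun x => f x == g x := by
  refine cast (congrArg PT (funext fun x => ?_)) (hf.cond hg hg.not)
  cases f x <;> cases g x <;> rfl

@[fun_prop] theorem any {L : α → List β} {g : α → β → Bool} (hL : PT L)
    (hg : PT fun p : α × β => g p.1 p.2) : PT fun x => (L x).any (g x) := by
  refine cast (congrArg PT (funext fun x => ?_)) (hL.find? hg).isSome
  induction L x with
  | nil => rfl
  | cons y l ih =>
    rw [List.find?_cons, List.any_cons, ← ih]
    cases g x y <;> rfl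

@[fun_prop] theorem all {L : α → List β} {g : α → β → Bool} (hL : PT L)
    (hg : PT fun p : α × β => g p.1 p.2) : PT fun x => (L x).all (g x) := by
  refine cast (congrArg PT (funext fun x => ?_)) (hL.any (g := fun x y => !g x y) hg.not).not
  rw [List.all_eq_not_any_not]

/-! #### Numbers -/

/-- Unary numbers are encoded like lists of units, so arithmetic reduces to list operations. -/
theorem enc_replicate_unit (n : ℕ) : enc (List.replicate n ()) = enc n := by
  induction n with
  | zero => rfl
  | succ n ih => exact congrArg (Val.cons .nil) ih

theorem replicate_unit {f : α → ℕ} (hf : PT f) : PT fun x => List.replicate (f x) () := by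
  refine cast (congrArg (PolyComp _) (funext fun x => ?_)) hf
  exact (enc_replicate_unit _).symm

@[fun_prop] theorem length {l : α → List β} (hl : PT l) : PT fun x => (l x).length := by
  have h : PT fun x => (l x).map fun _ => () := hl.map (const ())
  refine cast (congrArg (PolyComp _) (funext fun x => ?_)) h
  rw [← enc_replicate_unit]
  beta_reduce
  rw [List.map_const']

@[fun_prop] theorem replicate {f : α → ℕ} {g : α → β} (hf : PT f) (hg : PT g) :
    PT fun x => List.replicate (f x) (g x) := by
  have h : PT fun x => (List.replicate (f x) ()).map fun _ => g x := by
    refine hf.replicate_unit.map ?_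
    fun_prop
  simpa using h

@[fun_prop] theorem natAdd {f g : α → ℕ} (hf : PT f) (hg : PT g) : PT fun x => f x + g x := by
  simpa using (hf.replicate_unit.append hg.replicate_unit).length

@[fun_prop] theorem natPred {f : α → ℕ} (hf : PT f) : PT fun x => f x - 1 := by
  simpa using hf.replicate_unit.tail.length

omit [Enc β] in
theorem foldl_replicate_unit (F : β → β) (n : ℕ) (s : β) :
    (List.replicate n ()).foldl (fun s _ => F s) s = F^[n] s := by
  induction n generalizing s with
  | zero => rfl
  | succ n ih => rw [List.replicate_succ, List.foldl_cons, ih, Function.iterate_succ_apply]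

@[fun_prop] theorem natSub {f g : α → ℕ} (hf : PT f) (hg : PT g) : PT fun x => f x - g x := by
  have h : PT fun x => (List.replicate (g x) ()).foldl (fun s _ => s - 1) (f x) := by
    refine foldl_of_size_le hg.replicate_unit hf ?_ ⟨_, .const 0, fun x y hy t => ?_⟩
    · fun_prop
    · simp
  refine cast (congrArg PT (funext fun x => ?_)) h
  rw [foldl_replicate_unit]
  generalize g x = n
  induction n with
  | zero => rfl
  | succ n ih => rw [Function.iterate_succ_apply', ih]; omega

@[fun_prop] theorem natMul {f g : α → ℕ} (hf : PT f) (hg : PT g) : PT fun x => f x * g x := by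
  have h : PT fun x => ((List.replicate (f x) ()).flatMap fun _ => List.replicate (g x) ()).length := by
    refine length (hf.replicate_unit.flatMap ?_)
    exact replicate_unit (by fun_prop)
  simpa [List.length_flatMap] using h

@[fun_prop] theorem natPos {f : α → ℕ} (hf : PT f) : PT fun x => decide (0 < f x) := by
  refine cast (congrArg PT (funext fun x => ?_)) hf.replicate_unit.isEmpty.not
  cases f x <;> simp [List.replicate_succ]

@[fun_prop] theorem natLt {f g : α → ℕ} (hf : PT f) (hg : PT g) :
    PT fun x => decide (f x < g x) := by
  simpa using (hg.natSub hf).natPos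

@[fun_prop] theorem natEq {f g : α → ℕ} (hf : PT f) (hg : PT g) :
    PT fun x => decide (f x = g x) := by
  refine cast (congrArg PT (funext fun x => ?_)) ((hf.natLt hg).or (hg.natLt hf)).not
  rw [Bool.eq_iff_iff]
  simp
  omega

@[fun_prop] theorem natLe {f g : α → ℕ} (hf : PT f) (hg : PT g) :
    PT fun x => decide (f x ≤ g x) := by
  refine cast (congrArg PT (funext fun x => ?_)) (hg.natLt hf).not
  rw [Bool.eq_iff_iff]
  simp

@[fun_prop] theorem natSum {l : α → List ℕ} (hl : PT l) : PT fun x => (l x).sum := by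
  have h : PT fun x => ((l x).flatMap fun y => List.replicate y ()).length := by
    refine length (hl.flatMap ?_)
    exact replicate_unit (by fun_prop)
  simpa [List.length_flatMap] using h

@[fun_prop] theorem range {f : α → ℕ} (hf : PT f) : PT fun x => List.range (f x) := by
  -- The guard never fails during the run. It is there so that a step adds at most `f x + 1` to the
  -- size of any state, reachable or not.
  have h : PT fun x => ((List.replicate (f x) ()).foldl
      (fun (s : List ℕ) _ => bif decide (s.length < f x) then s.length :: s else s) []).reverse := by
    refine reverse (foldl_of_size_le hf.replicate_unit (const []) ?_
      ⟨_, hf.polyBd.add (.const 1), fun x y hy t => ?_⟩)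
    · fun_prop
    · by_cases h : t.length < f x
      · simp [h]; omega
      · simp [h]
  refine cast (congrArg PT (funext fun x => ?_)) h
  rw [foldl_replicate_unit]
  suffices ∀ k ≤ f x, (fun (s : List ℕ) =>
      bif decide (s.length < f x) then s.length :: s else s)^[k] [] = (List.range k).reverse by
    rw [this _ le_rfl, List.reverse_reverse]
  intro k
  induction k with
  | zero => simp
  | succ k ih =>
    intro hk
    rw [Function.iterate_succ_apply', ih (by omega), List.range_succ]
    simp [show k < f x by omega]

@[fun_prop] theorem drop {f : α → ℕ} {l : α → List β} (hf : PT f) (hl : PT l) :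
    PT fun x => (l x).drop (f x) := by
  have h : PT fun x => (List.replicate (f x) ()).foldl (fun s _ => s.tail) (l x) := by
    refine foldl_of_size_le hf.replicate_unit hl ?_ ⟨_, .const 0, fun x y hy t => ?_⟩
    · fun_prop
    · exact sz_sublist (List.tail_sublist t)
  refine cast (congrArg PT (funext fun x => ?_)) h
  rw [foldl_replicate_unit]
  generalize f x = n
  induction n with
  | zero => rfl
  | succ n ih => rw [Function.iterate_succ_apply', ih, List.tail_drop]

@[fun_prop] theorem getElem? {f : α → ℕ} {l : α → List β} (hf : PT f) (hl : PT l) :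
    PT fun x => (l x)[f x]? := by
  simpa using (hf.drop hl).head?

@[fun_prop] theorem getD {f : α → ℕ} {l : α → List β} {d : α → β} (hl : PT l) (hf : PT f)
    (hd : PT d) : PT fun x => (l x).getD (f x) (d x) := by
  simpa using (hf.getElem? hl).optionGetD hd

end PT

/-! ### Iteration until success -/

/-- The body of the search loop: function `1` maps a state to the pair of the optional result and the
next state. -/
def searchBody : Expr :=
  .bind (.call 1 (.var 0)) (.ite (.hd (.var 0)) (.hd (.hd (.var 0))) (.call 0 (.tl (.var 0))))

/-- The number of rounds `m` is not bounded in terms of the start state, so this loop is outside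
`PT`. The program and the exponent `c` are uniform, while `m` and the bound `M` on the states met
before success are supplied run by run. -/
theorem exists_search_program {α β : Type} [Enc α] [Enc β] {result : α → Option β} {next : α → α}
    (hs : PT result) (hn : PT next) : ∃ (P : Program) (c : ℕ), ∀ (m : ℕ) (s : α) (y : β) (M : ℕ),
      (∀ j < m, result (next^[j] s) = none) → result (next^[m] s) = some y →
      (∀ j ≤ m, sz (next^[j] s) ≤ M) →
      EvalLE P [enc s] (.call 0 (.var 0)) (enc y) ((m + 1) * ((M + 2) ^ c + 10)) := by
  obtain ⟨-, Q, T, ⟨c, hc⟩, hQ⟩ := hs.pair hn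
  have hl : LinkedAt Q (searchBody :: Q.map (Expr.shift 1)) 1 := by
    simpa using linkedAt_append [searchBody] Q []
  refine ⟨searchBody :: Q.map (Expr.shift 1), c, ?_⟩
  -- The recursive call is made in another environment with argument `tl (var 0)`, so the induction
  -- needs arbitrary environments and argument expressions.
  suffices h : ∀ (m : ℕ) (s : α) (y : β) (M : ℕ),
      (∀ j < m, result (next^[j] s) = none) → result (next^[m] s) = some y →
      (∀ j ≤ m, sz (next^[j] s) ≤ M) → ∀ env e T',
      EvalLE (searchBody :: Q.map (Expr.shift 1)) env e (enc s) T' →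
      EvalLE (searchBody :: Q.map (Expr.shift 1)) env (.call 0 e) (enc y)
        (T' + (m + 1) * ((M + 2) ^ c + 9)) by
    intro m s y M h₁ h₂ h₃
    refine (h m s y M h₁ h₂ h₃ _ _ 1 (.var rfl)).mono ?_
    simp only [Nat.mul_add]
    omega
  intro m
  induction m with
  | zero =>
    intro s y M _ h₂ h₃ env e T' he
    have hT : T s ≤ (M + 2) ^ c := (hc s).trans (Nat.pow_le_pow_left
      (Nat.add_le_add_right (h₃ 0 le_rfl) 2) c)
    have hv : EvalLE (searchBody :: Q.map (Expr.shift 1)) [enc s] (.call 1 (.var 0))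
        (enc (result s, next s)) (1 + T s) := .callLinked hl (hQ s) (.var rfl)
    rw [show result s = some y from h₂] at hv
    have hh : EvalLE (searchBody :: Q.map (Expr.shift 1)) [enc (some y, next s), enc s]
        (.hd (.var 0)) (.cons (enc y) .nil) 2 := .hd (v := enc (some y, next s)) (.var rfl)
    refine (EvalLE.call he rfl (.bind hv (.ite_cons hh (.hd hh)))).mono ?_
    omega
  | succ m ih =>
    intro s y M h₁ h₂ h₃ env e T' he
    have hT : T s ≤ (M + 2) ^ c := (hc s).trans (Nat.pow_le_pow_left
      (Nat.add_le_add_right (h₃ 0 (by omega)) 2) c)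
    have hv : EvalLE (searchBody :: Q.map (Expr.shift 1)) [enc s] (.call 1 (.var 0))
        (enc (result s, next s)) (1 + T s) := .callLinked hl (hQ s) (.var rfl)
    rw [show result s = none from h₁ 0 (by omega)] at hv
    have hr := ih (next s) y M (fun j hj => h₁ (j + 1) (by omega)) h₂
      (fun j hj => h₃ (j + 1) (by omega)) [enc ((none : Option β), next s), enc s]
      (.tl (.var 0)) 2 (.tl (.var rfl))
    refine (EvalLE.call he rfl (.bind hv (.ite_nil (.hd (.var rfl)) hr))).mono ?_
    simp only [Nat.add_mul, Nat.mul_add]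
    omega

end StableMarriage

namespace StableMarriage
open Enc

/-! ### The algorithm

The agents are numbered, first the men and then the women.  An assignment gives each agent a
*value*: `0` for undefined, `1` for unmatched, and `w + 2` for matched to the agent `w`. -/

/-- The number of men, and the table of the ranks between all agents, with `0` for unacceptable
pairs. -/
abbrev RankData : Type := ℕ × List (List ℕ)

/-- The total satisfactions of the men and of the women, and the number of pairs. -/
abbrev Cost : Type := ℕ × ℕ × ℕ

/-- A partial assignment with its cost. -/
abbrev Row : Type := Cost × List ℕ

section Definitions

variable (G : RankData)

/-- Indices outside the table count as unacceptable. -/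
def rk (u w : ℕ) : ℕ := (G.2.getD u []).getD w 0

def verts : List ℕ := List.range G.2.length

def adj (u w : ℕ) : Bool := decide (0 < rk G u w)

def look (r : List ℕ) (u : ℕ) : ℕ := r.getD u 0

/-- `x` is a possible value of `u`. -/
def fits (u x : ℕ) : Bool := decide (x = 1) || (decide (2 ≤ x) && decide (0 < rk G u (x - 2)))

/-- With value `x`, the agent `u` prefers `w`. -/
def wants (u x w : ℕ) : Bool := decide (x = 1) || decide (rk G u w < rk G u (x - 2))

/-- The values `x` of `u` and `y` of `w` are consistent, and `u` and `w` do not block. -/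
def compat (u x w y : ℕ) : Bool :=
  !adj G u w || ((decide (x = w + 2) == decide (y = u + 2)) && !(wants G u x w && wants G w y u))

/-- Only men are charged, with both ranks of their pair, so that every matched pair counts once. -/
def cost (u x : ℕ) : Cost :=
  bif decide (u < G.1) && decide (2 ≤ x) then (rk G u (x - 2), rk G (x - 2) u, 1) else (0, 0, 0)

/-- The neighbours of the set `C` outside `C`. -/
def nbhd (C : List ℕ) : List ℕ :=
  (verts G).filter fun w => !decide (w ∈ C) && C.any fun u => adj G u w

/-- The step of `comps`: add the vertex `u` to the components. -/
def addVertex (B : List (List ℕ)) (u : ℕ) : List (List ℕ) :=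
  (u :: (B.filter fun K => K.any fun w => adj G u w).flatten) ::
    B.filter fun K => !K.any fun w => adj G u w

/-- The connected components of the subgraph induced by `L`. -/
def comps (L : List ℕ) : List (List ℕ) := L.foldl (fun B u => addVertex G B u) []

def sameSet (K L : List ℕ) : Bool :=
  (K.all fun x => decide (x ∈ L)) && L.all fun x => decide (x ∈ K)

/-- Genuine values are at most n + 1 and are unchanged; clipping only serves to bound the size of
`overlay` for arbitrary arguments. -/
def clip (x : ℕ) : ℕ := bif decide (x ≤ G.2.length + 1) then x else 0

/-- The assignment that is `s` on `K` and `r` elsewhere. -/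
def overlay (K r s : List ℕ) : List ℕ :=
  (verts G).map fun u => clip G (bif decide (u ∈ K) then look s u else look r u)

def agree (B r s : List ℕ) : Bool := B.all fun u => decide (look r u = look s u)

/-- Each agent contributes at most the sum of all ranks to a satisfaction, and at most `1` to the
number of pairs. -/
def costBound : ℕ := G.2.length * (G.2.flatten.sum + 1)

def costs : List Cost :=
  (List.range (costBound G + 1)).flatMap fun x => (List.range (costBound G + 1)).flatMap fun y =>
    (List.range (costBound G + 1)).map fun z => (x, y, z)

def addCost (c d : Cost) : Cost := (c.1 + d.1, c.2.1 + d.2.1, c.2.2 + d.2.2)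

/-- All combinations of rows that agree on the neighbourhood of `K`. -/
def join (K : List ℕ) (R Q : List Row) : List Row :=
  R.flatMap fun r => (Q.filter fun s => agree (nbhd G K) r.2 s.2).map fun s =>
    (addCost r.1 s.1, overlay G K r.2 s.2)

/-- For each assignment in `U` and each cost, one row of this cost with these values on `B`. -/
def thin (U : List (List ℕ)) (B : List ℕ) (R : List Row) : List Row :=
  U.flatMap fun t => (costs G).filterMap fun c => R.find? fun r =>
    decide (r.1.1 = c.1) && decide (r.1.2.1 = c.2.1) && decide (r.1.2.2 = c.2.2) && agree B r.2 t

/-- Tables of rows, indexed by vertex sets. -/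
abbrev Table : Type := List (List ℕ × List Row)

/-- Combine the rows `R` with the tables of the sets in `Ks`. -/
def assemble (U : List (List ℕ)) (B : List ℕ) (tab : Table) (Ks : List (List ℕ)) (R : List Row) :
    Option (List Row) :=
  Ks.foldl (fun st K => st.bind fun R => (tab.find? fun e => sameSet e.1 K).map fun e =>
    thin G U B (join G K R e.2)) (some R)

/-- Only the constraints between `v` and N(C) are tested here. Those between `v` and the rest of `C`
are part of the tables of the components, and those within N(C) are left to larger sets. -/
def initRows (U : List (List ℕ)) (C : List ℕ) (v : ℕ) : List Row :=
  (U.filter fun t => fits G v (look t v) &&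
    (nbhd G C).all fun w => compat G v (look t v) w (look t w)).map fun t =>
      (cost G v (look t v), t)

/-- The table of `C` from those of the components of `C` without `v`. -/
def solveAt (j : ℕ) (U : List (List ℕ)) (tab : Table) (C : List ℕ) (v : ℕ) : Option (List Row) :=
  bif decide ((v :: nbhd G C).length ≤ j) then
    assemble G U (v :: nbhd G C) tab (comps G (C.filter fun u => !decide (u = v)))
      (initRows G U C v)
  else none

def nextTable (j : ℕ) (U : List (List ℕ)) (tab : Table) : Table :=
  U.flatMap fun t => (comps G ((verts G).filter fun u => decide (look t u = 0))).filterMap fun C =>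
    (C.filterMap fun v => solveAt G j U tab C v).head?.map fun R => (C, R)

def zeroRow : List ℕ := (verts G).map fun _ => 0

/-- All costs of solutions, with solutions, if bags of size `j` suffice. -/
def attempt (j : ℕ) (U : List (List ℕ)) : Option (List Row) :=
  assemble G U [] ((verts G).foldl (fun tab _ => nextTable G j U tab) []) (comps G (verts G))
    [((0, 0, 0), zeroRow G)]

def best (le : Cost → Cost → Bool) (R : List Row) : Option Row :=
  R.foldl (fun b r => some (b.elim r fun b => bif le r.1 b.1 then r else b)) none

/-- Set one more position of the assignments in `U`. -/
def extend (U : List (List ℕ)) : List (List ℕ) :=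
  U ++ U.flatMap fun t => (verts G).flatMap fun u => (List.range (G.2.length + 2)).map fun x =>
    (verts G).map fun w => bif decide (w = u) then x else look t w

/-- The data, a bound for the sizes of the bags, and the assignments of at most that many agents. -/
abbrev State : Type := RankData × ℕ × List (List ℕ)

def result (le : Cost → Cost → Bool) (s : State) : Option (List ℕ) :=
  (attempt s.1 s.2.1 s.2.2).bind fun R => (best le R).map fun r =>
    -- With a men, the value `a + w + 2` of a man becomes `w + 1`, and the value `1` for unmatched
    -- becomes `0` by truncated subtraction, as the output format requires.
    (List.range s.1.1).map fun m => look r.2 m - (s.1.1 + 1)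

def next (s : State) : State := (s.1, s.2.1 + 1, extend s.1 s.2.2)

/-- The two rectangular tables become the off-diagonal blocks of a square matrix over all agents,
with zero blocks for pairs of the same sex. -/
def rankData (p : List (List ℕ) × List (List ℕ)) : RankData :=
  (p.1.length, (p.1.map fun l => List.replicate p.1.length 0 ++ l) ++
    p.2.map fun l => l ++ List.replicate p.2.length 0)

def start (p : List (List ℕ) × List (List ℕ)) : State :=
  (rankData p, 0, [zeroRow (rankData p)])

end Definitions

/-! ### The algorithm runs in polynomial time in the number of assignments -/

namespace PT

variable {α : Type} [Enc α] {G : α → RankData} {u w x y j : α → ℕ} {B C K r s : α → List ℕ}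
  {U Ks : α → List (List ℕ)} {Q R : α → List Row} {tab : α → Table} {c d : α → Cost}

@[fun_prop] theorem mem (hu : PT u) (hB : PT B) : PT fun a => decide (u a ∈ B a) := by
  have h : PT fun a => (B a).any fun y => decide (u a = y) := by fun_prop
  refine cast (congrArg PT (funext fun a => ?_)) h
  rw [Bool.eq_iff_iff]
  simp

@[fun_prop] theorem rk (hG : PT G) (hu : PT u) (hw : PT w) :
    PT fun a => rk (G a) (u a) (w a) := by
  unfold StableMarriage.rk; fun_prop

@[fun_prop] theorem verts (hG : PT G) : PT fun a => verts (G a) := by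
  unfold StableMarriage.verts; fun_prop

@[fun_prop] theorem adj (hG : PT G) (hu : PT u) (hw : PT w) :
    PT fun a => adj (G a) (u a) (w a) := by
  unfold StableMarriage.adj; fun_prop

@[fun_prop] theorem look (hr : PT r) (hu : PT u) : PT fun a => look (r a) (u a) := by
  unfold StableMarriage.look; fun_prop

@[fun_prop] theorem fits (hG : PT G) (hu : PT u) (hx : PT x) :
    PT fun a => fits (G a) (u a) (x a) := by
  unfold StableMarriage.fits; fun_prop

@[fun_prop] theorem wants (hG : PT G) (hu : PT u) (hx : PT x) (hw : PT w) :
    PT fun a => wants (G a) (u a) (x a) (w a) := by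
  unfold StableMarriage.wants; fun_prop

@[fun_prop] theorem compat (hG : PT G) (hu : PT u) (hx : PT x) (hw : PT w) (hy : PT y) :
    PT fun a => compat (G a) (u a) (x a) (w a) (y a) := by
  unfold StableMarriage.compat; fun_prop

@[fun_prop] theorem cost (hG : PT G) (hu : PT u) (hx : PT x) :
    PT fun a => cost (G a) (u a) (x a) := by
  unfold StableMarriage.cost; fun_prop

@[fun_prop] theorem nbhd (hG : PT G) (hC : PT C) : PT fun a => nbhd (G a) (C a) := by
  unfold StableMarriage.nbhd; fun_prop

@[fun_prop] theorem addVertex (hG : PT G) (hU : PT U) (hu : PT u) :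
    PT fun a => addVertex (G a) (U a) (u a) := by
  unfold StableMarriage.addVertex; fun_prop

/-- Blocks are only moved or merged, and merging drops cells, so the size grows by the new vertex
alone. A bound by a factor instead of a summand would not survive the iteration in `comps`. -/
theorem _root_.StableMarriage.sz_addVertex_le (G : RankData) (B : List (List ℕ)) (u : ℕ) :
    sz (StableMarriage.addVertex G B u) ≤ sz B + (u + 2) := by
  have h : ∀ p : List ℕ → Bool, sz (B.filter p) + sz (B.filter fun K => !p K) = sz B := by
    intro p
    induction B with
    | nil => rfl
    | cons K B ih =>
      rw [List.filter_cons, List.filter_cons]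
      cases p K <;> simp <;> omega
  have h₁ := h fun K => K.any fun w => StableMarriage.adj G u w
  have h₂ := sz_flatten (B.filter fun K => K.any fun w => StableMarriage.adj G u w)
  simp only [StableMarriage.addVertex, sz_cons, sz_nat]
  omega

@[fun_prop] theorem comps (hG : PT G) (hC : PT C) : PT fun a => comps (G a) (C a) := by
  unfold StableMarriage.comps
  refine foldl_of_size_le hC (const []) (by fun_prop)
    ⟨_, hC.polyBd.add (.const 2), fun a u hu B => (sz_addVertex_le _ _ _).trans ?_⟩
  have := sz_le_of_mem hu
  rw [sz_nat] at this
  omega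

@[fun_prop] theorem sameSet (hB : PT B) (hC : PT C) : PT fun a => sameSet (B a) (C a) := by
  unfold StableMarriage.sameSet; fun_prop

@[fun_prop] theorem clip (hG : PT G) (hx : PT x) : PT fun a => clip (G a) (x a) := by
  unfold StableMarriage.clip; fun_prop

@[fun_prop] theorem overlay (hG : PT G) (hK : PT K) (hr : PT r) (hs : PT s) :
    PT fun a => overlay (G a) (K a) (r a) (s a) := by
  unfold StableMarriage.overlay; fun_prop

@[fun_prop] theorem agree (hB : PT B) (hr : PT r) (hs : PT s) :
    PT fun a => agree (B a) (r a) (s a) := by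
  unfold StableMarriage.agree; fun_prop

@[fun_prop] theorem costBound (hG : PT G) : PT fun a => costBound (G a) := by
  unfold StableMarriage.costBound; fun_prop

@[fun_prop] theorem costs (hG : PT G) : PT fun a => costs (G a) := by
  unfold StableMarriage.costs; fun_prop

@[fun_prop] theorem addCost (hc : PT c) (hd : PT d) : PT fun a => addCost (c a) (d a) := by
  unfold StableMarriage.addCost; fun_prop

@[fun_prop] theorem join (hG : PT G) (hK : PT K) (hR : PT R) (hQ : PT Q) :
    PT fun a => join (G a) (K a) (R a) (Q a) := by
  unfold StableMarriage.join; fun_prop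

@[fun_prop] theorem thin (hG : PT G) (hU : PT U) (hB : PT B) (hR : PT R) :
    PT fun a => thin (G a) (U a) (B a) (R a) := by
  unfold StableMarriage.thin; fun_prop

/-- A bound for the sizes of the values of `thin`. -/
def _root_.StableMarriage.thinBound (G : RankData) (U : List (List ℕ)) : ℕ :=
  sz U * (sz (StableMarriage.costs G) *
    (sz (StableMarriage.costs G) + G.2.length * (G.2.length + 2) + 1 + 1))

theorem _root_.StableMarriage.polyBd_thinBound (hG : PT G) (hU : PT U) :
    PolyBd sz fun a => thinBound (G a) (U a) := by
  have h₁ : PolyBd sz fun a => sz (StableMarriage.costs (G a)) := hG.costs.polyBd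
  have h₂ : PolyBd sz fun a => (G a).2.length := hG.snd.length.polyBd.mono fun a => by simp
  exact hU.polyBd.mul (h₁.mul (((h₁.add (h₂.mul (h₂.add (.const 2)))).add (.const 1)).add
    (.const 1)))

theorem _root_.StableMarriage.clip_le (G : RankData) (x : ℕ) :
    StableMarriage.clip G x ≤ G.2.length + 1 := by
  unfold StableMarriage.clip
  by_cases h : x ≤ G.2.length + 1 <;> simp [h]

theorem _root_.StableMarriage.sz_overlay_le (G : RankData) (K r s : List ℕ) :
    sz (StableMarriage.overlay G K r s) ≤ G.2.length * (G.2.length + 2) := by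
  refine sz_list_le (by simp [StableMarriage.overlay, StableMarriage.verts]) fun x hx => ?_
  obtain ⟨u, -, rfl⟩ := List.mem_map.1 hx
  simpa using clip_le G _

/-- There is at most one row per member of `U` and cost in the grid, and a surviving row consists of
a grid cost and a clipped assignment. The bound does not depend on `R` and `Q`, so repeated joins do
not compound. -/
theorem _root_.StableMarriage.sz_thin_join_le (G : RankData) (U : List (List ℕ)) (B K : List ℕ)
    (R Q : List Row) :
    sz (StableMarriage.thin G U B (StableMarriage.join G K R Q)) ≤ thinBound G U := by
  have hlen : (StableMarriage.thin G U B (StableMarriage.join G K R Q)).length ≤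
      sz U * sz (StableMarriage.costs G) := by
    rw [StableMarriage.thin, List.length_flatMap]
    refine (List.sum_le_card_nsmul _ (sz (StableMarriage.costs G)) ?_).trans ?_
    · intro k hk
      obtain ⟨t, -, rfl⟩ := List.mem_map.1 hk
      exact (List.length_filterMap_le _ _).trans (length_le_sz _)
    · rw [List.length_map, smul_eq_mul]
      exact Nat.mul_le_mul_right _ (length_le_sz _)
  refine (sz_list_le hlen fun r hr => ?_).trans_eq (by rw [thinBound, Nat.mul_assoc])
  obtain ⟨t, -, hr⟩ := List.mem_flatMap.1 hr
  obtain ⟨c, hc, hr⟩ := List.mem_filterMap.1 hr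
  have h₁ := List.find?_some hr
  have h₂ := List.mem_of_find?_eq_some hr
  simp only [Bool.and_eq_true, decide_eq_true_eq] at h₁
  obtain ⟨p, -, hp⟩ := List.mem_flatMap.1 h₂
  obtain ⟨q, -, rfl⟩ := List.mem_map.1 hp
  have h₃ : StableMarriage.addCost p.1 q.1 = c :=
    Prod.ext h₁.1.1.1 (Prod.ext h₁.1.1.2 h₁.1.2)
  have h₄ := sz_le_of_mem hc
  have h₅ := sz_overlay_le G K p.2 q.2
  rw [sz_pair]
  simp only [h₃]
  omega

/-- Only the last join matters for the size; the summand `sz R` is for an empty list of components.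
-/
theorem _root_.StableMarriage.sz_assemble_le (G : RankData) (U : List (List ℕ)) (B : List ℕ)
    (tab : Table) (Ks : List (List ℕ)) (R : List Row) :
    sz (StableMarriage.assemble G U B tab Ks R) ≤ sz R + 1 + (thinBound G U + 1) := by
  rcases List.eq_nil_or_concat Ks with rfl | ⟨Ks, K, rfl⟩
  · simp [StableMarriage.assemble]
  · rw [StableMarriage.assemble, List.concat_eq_append, List.foldl_append, List.foldl_cons,
      List.foldl_nil]
    cases List.foldl _ (Option.some R) Ks with
    | none => simp
    | some R' =>
      rw [Option.bind_some]
      cases List.find? _ tab with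
      | none => simp
      | some e =>
        have := sz_thin_join_le G U B K R' e.2
        simp only [Option.map_some, sz_some]
        omega

@[fun_prop] theorem assemble (hG : PT G) (hU : PT U) (hB : PT B) (htab : PT tab) (hKs : PT Ks)
    (hR : PT R) : PT fun a => assemble (G a) (U a) (B a) (tab a) (Ks a) (R a) := by
  unfold StableMarriage.assemble
  refine foldl_of_bounded hKs hR.some (by fun_prop)
    ⟨_, (polyBd_thinBound hG hU).add (.const 1), fun a K _ st => ?_⟩
  cases st with
  | none => simp
  | some R' =>
    rw [Option.bind_some]
    cases List.find? _ (tab a) with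
    | none => simp
    | some e => simpa using sz_thin_join_le _ _ _ _ _ _

@[fun_prop] theorem initRows (hG : PT G) (hU : PT U) (hC : PT C) (hu : PT u) :
    PT fun a => initRows (G a) (U a) (C a) (u a) := by
  unfold StableMarriage.initRows; fun_prop

@[fun_prop] theorem solveAt (hG : PT G) (hj : PT j) (hU : PT U) (htab : PT tab) (hC : PT C)
    (hu : PT u) : PT fun a => solveAt (G a) (j a) (U a) (tab a) (C a) (u a) := by
  unfold StableMarriage.solveAt; fun_prop

@[fun_prop] theorem nextTable (hG : PT G) (hj : PT j) (hU : PT U) (htab : PT tab) :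
    PT fun a => nextTable (G a) (j a) (U a) (tab a) := by
  unfold StableMarriage.nextTable; fun_prop

@[fun_prop] theorem zeroRow (hG : PT G) : PT fun a => zeroRow (G a) := by
  unfold StableMarriage.zeroRow; fun_prop

/-- The vertex sets for which tables are computed. -/
def _root_.StableMarriage.candidates (G : RankData) (U : List (List ℕ)) : List (List ℕ) :=
  U.flatMap fun t => StableMarriage.comps G ((StableMarriage.verts G).filter fun u =>
    decide (StableMarriage.look t u = 0))

theorem _root_.StableMarriage.mem_nextTable {G : RankData} {j : ℕ} {U : List (List ℕ)}
    {tab : Table} {e : List ℕ × List Row} : e ∈ StableMarriage.nextTable G j U tab ↔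
      e.1 ∈ candidates G U ∧
        (e.1.filterMap fun v => StableMarriage.solveAt G j U tab e.1 v).head? = Option.some e.2 := by
  simp only [StableMarriage.nextTable, candidates, List.mem_flatMap, List.mem_filterMap,
    Option.map_eq_some_iff]
  constructor
  · rintro ⟨t, ht, C, hC, R, hR, rfl⟩
    exact ⟨⟨t, ht, hC⟩, hR⟩
  · rintro ⟨⟨t, ht, hC⟩, hR⟩
    exact ⟨t, ht, e.1, hC, e.2, hR, rfl⟩

theorem _root_.StableMarriage.length_nextTable_le (G : RankData) (j : ℕ) (U : List (List ℕ))
    (tab : Table) : (StableMarriage.nextTable G j U tab).length ≤ (candidates G U).length := by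
  rw [StableMarriage.nextTable, candidates, List.length_flatMap, List.length_flatMap]
  exact List.sum_le_sum fun t _ => List.length_filterMap_le _ _

@[fun_prop] theorem attempt (hG : PT G) (hj : PT j) (hU : PT U) :
    PT fun a => attempt (G a) (j a) (U a) := by
  have hc : PT fun a => candidates (G a) (U a) := by unfold candidates; fun_prop
  unfold StableMarriage.attempt
  refine assemble hG hU (const _) ?_ (by fun_prop) (by fun_prop)
  -- Each round rebuilds the table from scratch, with at most one entry per candidate set, and the
  -- rows of an entry are bounded whatever the previous table was. So one bound serves all rounds.
  refine foldl_of_bounded (by fun_prop) (const []) (by fun_prop) ?_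
  obtain ⟨B, hB, hBC⟩ := bound_of_mem (G := fun p : α × List ℕ => (p.2.map fun v =>
    StableMarriage.initRows (G p.1) (U p.1) p.2 v)) hc (by fun_prop)
  have hcs : PolyBd sz fun a => sz (candidates (G a) (U a)) := hc.polyBd
  refine ⟨fun a => sz (candidates (G a) (U a)) * (sz (candidates (G a) (U a)) +
    (B a + 1 + (thinBound (G a) (U a) + 1)) + 1 + 1), hcs.mul (((hcs.add ((hB.add (.const 1)).add
      ((polyBd_thinBound hG hU).add (.const 1)))).add (.const 1)).add (.const 1)), ?_⟩
  intro a _ _ t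
  refine sz_list_le ((length_nextTable_le _ _ _ _).trans (length_le_sz _)) fun e he => ?_
  obtain ⟨h₁, h₂⟩ := mem_nextTable.1 he
  have h₃ := sz_le_of_mem h₁
  obtain ⟨v, hv, h₄⟩ := List.mem_filterMap.1 (List.mem_of_mem_head? h₂)
  have h₅ : sz (StableMarriage.initRows (G a) (U a) e.1 v) ≤ B a :=
    (sz_le_of_mem (List.mem_map_of_mem hv)).trans (hBC a e.1 h₁)
  have h₆ : sz e.2 ≤ B a + 1 + (thinBound (G a) (U a) + 1) := by
    unfold StableMarriage.solveAt at h₄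
    cases hd : decide ((v :: StableMarriage.nbhd (G a) e.1).length ≤ j a) with
    | false => rw [hd, cond_false] at h₄; cases h₄
    | true =>
      rw [hd, cond_true] at h₄
      have := sz_assemble_le (G a) (U a) (v :: StableMarriage.nbhd (G a) e.1) t
        (StableMarriage.comps (G a) (e.1.filter fun u => !decide (u = v)))
        (StableMarriage.initRows (G a) (U a) e.1 v)
      rw [h₄, sz_some] at this
      omega
  rw [sz_pair]
  omega

@[fun_prop] theorem extend (hG : PT G) (hU : PT U) : PT fun a => extend (G a) (U a) := by
  unfold StableMarriage.extend; fun_prop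

@[fun_prop] theorem best {le : Cost → Cost → Bool} (hle : PT fun p : Cost × Cost => le p.1 p.2)
    (hR : PT R) : PT fun a => best le (R a) := by
  unfold StableMarriage.best
  have hle' : ∀ {β : Type} [Enc β] {f g : β → Cost}, PT f → PT g →
    PT fun b => le (f b) (g b) := fun hf hg => hle.comp (hf.pair hg)
  refine foldl_of_size_le hR (const Option.none) ?_ ⟨_, hR.polyBd.add (.const 1),
    fun a r hr t => ?_⟩
  · refine some (optionElim (by fun_prop) (by fun_prop) ?_)
    exact cond (hle' (by fun_prop) (by fun_prop)) (by fun_prop) (by fun_prop)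
  · have h := sz_le_of_mem hr
    cases t with
    | none =>
      simp only [Option.elim, sz_some, sz_none]
      omega
    | some b =>
      simp only [Option.elim, sz_some]
      cases le r.1 b.1 <;> simp only [cond_true, cond_false] <;> omega

@[fun_prop] theorem result {le : Cost → Cost → Bool} (hle : PT fun p : Cost × Cost => le p.1 p.2) :
    PT (result le) := by
  unfold StableMarriage.result
  refine optionBind (by fun_prop) (optionMap (best hle (by fun_prop)) ?_)
  fun_prop

@[fun_prop] theorem next : PT next := by
  unfold StableMarriage.next; fun_prop

@[fun_prop] theorem start : PT start := by
  unfold StableMarriage.start StableMarriage.rankData; fun_prop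

end PT
end StableMarriage

namespace StableMarriage

/-! ### Correctness of the algorithm -/

section Correctness

variable {G : RankData}

/-- Acceptability is mutual and irreflexive. -/
structure RankData.Proper (G : RankData) : Prop where
  symm : ∀ u w, adj G u w = adj G w u
  irrefl : ∀ u, adj G u u = false

theorem adj_lt_left {u w : ℕ} (h : adj G u w = true) : u < G.2.length := by
  by_contra hc
  rw [adj, rk, List.getD_eq_default (l := G.2) _ (by omega)] at h
  simp at h

theorem RankData.Proper.adj_lt_right (hG : G.Proper) {u w : ℕ} (h : adj G u w = true) :
    w < G.2.length := adj_lt_left (hG.symm u w ▸ h)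

@[simp] theorem mem_verts {u : ℕ} : u ∈ verts G ↔ u < G.2.length := by simp [verts]

theorem nodup_verts : (verts G).Nodup := List.nodup_range

theorem compat_of_not_adj {u x w y : ℕ} (h : adj G u w = false) : compat G u x w y = true := by
  simp [compat, h]

theorem RankData.Proper.compat_symm (hG : G.Proper) {u x w y : ℕ}
    (h : compat G u x w y = true) : compat G w y u x = true := by
  rw [compat, hG.symm w u, Bool.and_comm (wants G w y u), Bool.beq_comm]
  exact h

theorem RankData.Proper.le_of_fits (hG : G.Proper) {u x : ℕ} (h : fits G u x = true) :
    x ≤ G.2.length + 1 := by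
  simp only [fits, Bool.or_eq_true, Bool.and_eq_true, decide_eq_true_eq] at h
  rcases h with h | ⟨h₁, h₂⟩
  · omega
  · have := hG.adj_lt_right (u := u) (w := x - 2) (by simpa [adj] using h₂)
    omega

theorem mem_nbhd {C : List ℕ} {w : ℕ} :
    w ∈ nbhd G C ↔ w < G.2.length ∧ w ∉ C ∧ ∃ u ∈ C, adj G u w = true := by
  simp [nbhd]

theorem nodup_nbhd (C : List ℕ) : (nbhd G C).Nodup := nodup_verts.filter _

theorem nbhd_congr {C K : List ℕ} (h : ∀ u, u ∈ C ↔ u ∈ K) : nbhd G C = nbhd G K := by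
  refine List.filter_congr fun w _ => ?_
  rw [Bool.eq_iff_iff]
  simp [h]

/-! #### Connected components -/

/-- The set `K` is nonempty and connected. -/
def Conn (G : RankData) (K : List ℕ) : Prop :=
  K ≠ [] ∧ ∀ A : ℕ → Prop, (∃ x ∈ K, A x) → (∀ x ∈ K, A x → ∀ y ∈ K, adj G x y = true → A y) →
    ∀ y ∈ K, A y

/-- There are no edges between `K` and `K'`. -/
def Apart (G : RankData) (K K' : List ℕ) : Prop := ∀ u ∈ K, ∀ w ∈ K', adj G u w = false

theorem RankData.Proper.apart_symm (hG : G.Proper) : Std.Symm (Apart G) :=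
  ⟨fun _ _ h u hu w hw => (hG.symm u w).trans (h w hw u hu)⟩

theorem flatten_addVertex_perm (B : List (List ℕ)) (u : ℕ) :
    (addVertex G B u).flatten.Perm (u :: B.flatten) := by
  have h : ∀ p : List ℕ → Bool,
      ((B.filter p).flatten ++ (B.filter fun K => !p K).flatten).Perm B.flatten := by
    intro p
    rw [← List.flatten_append]
    exact (List.filter_append_perm p B).flatten
  exact (h _).cons u

/-- The blocks merged with `u` are connected and each has an edge to `u`; the remaining blocks have
no edge to `u`, and none to the merged blocks by assumption. -/
theorem RankData.Proper.addVertex_spec (hG : G.Proper) {B : List (List ℕ)} (u : ℕ)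
    (hp : B.Pairwise (Apart G)) (hc : ∀ K ∈ B, Conn G K) :
    (addVertex G B u).Pairwise (Apart G) ∧ ∀ K ∈ addVertex G B u, Conn G K := by
  have := hG.apart_symm
  have hp' : ∀ K ∈ B, ∀ K' ∈ B, K ≠ K' → Apart G K K' := fun K hK K' hK' hne =>
    hp.forall hK hK' hne
  refine ⟨List.pairwise_cons.2 ⟨fun K' hK' x hx w hw => ?_, hp.filter _⟩, fun K hK => ?_⟩
  · obtain ⟨hK'B, hK'u⟩ := List.mem_filter.1 hK'
    rcases List.mem_cons.1 hx with rfl | hx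
    · simp only [Bool.not_eq_true', List.any_eq_false] at hK'u
      simpa using hK'u w hw
    · obtain ⟨K, hK, hx⟩ := List.mem_flatten.1 hx
      obtain ⟨hKB, hKu⟩ := List.mem_filter.1 hK
      refine hp' K hKB K' hK'B ?_ x hx w hw
      rintro rfl
      simp [hKu] at hK'u
  · rcases List.mem_cons.1 hK with rfl | hK
    · refine ⟨by simp, fun A hA hcl => ?_⟩
      have hmem : ∀ K ∈ B.filter (fun K => K.any fun w => adj G u w), ∀ x ∈ K,
          x ∈ u :: (B.filter fun K => K.any fun w => adj G u w).flatten := fun K hK x hx =>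
        List.mem_cons_of_mem _ (List.mem_flatten.2 ⟨K, hK, hx⟩)
      have hsub : ∀ K ∈ B.filter (fun K => K.any fun w => adj G u w), (∃ x ∈ K, A x) →
          ∀ y ∈ K, A y := fun K hK hx => (hc K (List.mem_filter.1 hK).1).2 A hx
        fun x hx hAx y hy hxy => hcl x (hmem K hK x hx) hAx y (hmem K hK y hy) hxy
      have hu : A u := by
        obtain ⟨x, hx, hAx⟩ := hA
        rcases List.mem_cons.1 hx with rfl | hx
        · exact hAx
        · obtain ⟨K, hK, hxK⟩ := List.mem_flatten.1 hx
          obtain ⟨w, hw, huw⟩ := List.any_eq_true.1 (List.mem_filter.1 hK).2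
          exact hcl w (hmem K hK w hw) (hsub K hK ⟨x, hxK, hAx⟩ w hw) u List.mem_cons_self
            ((hG.symm w u).trans huw)
      intro y hy
      rcases List.mem_cons.1 hy with rfl | hy
      · exact hu
      · obtain ⟨K, hK, hyK⟩ := List.mem_flatten.1 hy
        obtain ⟨w, hw, huw⟩ := List.any_eq_true.1 (List.mem_filter.1 hK).2
        exact hsub K hK ⟨w, hw, hcl u List.mem_cons_self hu w (hmem K hK w hw) huw⟩ y hyK
    · exact hc K (List.mem_filter.1 hK).1

/-- A partition of `L` into connected blocks without edges between them: nothing else about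
components is used later. -/
theorem RankData.Proper.comps_spec (hG : G.Proper) (L : List ℕ) :
    (comps G L).flatten.Perm L ∧ (comps G L).Pairwise (Apart G) ∧ ∀ K ∈ comps G L, Conn G K := by
  induction L using List.reverseRecOn with
  | nil => simp [comps]
  | append_singleton L u ih =>
    have h : comps G (L ++ [u]) = addVertex G (comps G L) u := by
      simp [comps, List.foldl_append]
    rw [h]
    refine ⟨?_, hG.addVertex_spec u ih.2.1 ih.2.2⟩
    exact ((flatten_addVertex_perm _ u).trans (ih.1.cons u)).trans
      (List.perm_append_singleton u L).symm

theorem RankData.Proper.mem_comps_subset (hG : G.Proper) {L K : List ℕ} (hK : K ∈ comps G L)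
    {x : ℕ} (hx : x ∈ K) : x ∈ L :=
  (hG.comps_spec L).1.subset (List.mem_flatten.2 ⟨K, hK, hx⟩)

theorem RankData.Proper.comps_closed (hG : G.Proper) {L K : List ℕ} (hK : K ∈ comps G L)
    {x y : ℕ} (hx : x ∈ K) (hy : y ∈ L) (hxy : adj G x y = true) : y ∈ K := by
  obtain ⟨K', hK', hyK'⟩ := List.mem_flatten.1 ((hG.comps_spec L).1.symm.subset hy)
  by_cases h : K = K'
  · exact h ▸ hyK'
  · have := hG.apart_symm
    have := (hG.comps_spec L).2.1.forall hK hK' h x hx y hyK'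
    simp [hxy] at this

theorem RankData.Proper.nodup_of_mem_comps (hG : G.Proper) {L K : List ℕ} (hL : L.Nodup)
    (hK : K ∈ comps G L) : K.Nodup :=
  (List.nodup_flatten.1 ((hG.comps_spec L).1.nodup_iff.2 hL)).1 K hK

/-! #### Solutions and tables -/

/-- The values of `f` on `D` are possible, and compatible with those on `E`. -/
def Sat (G : RankData) (f : ℕ → ℕ) (D E : List ℕ) : Prop :=
  ∀ u ∈ D, fits G u (f u) = true ∧ ∀ w ∈ E, compat G u (f u) w (f w) = true

/-- The total cost of the agents in `D`. -/
def totalCost (G : RankData) (D : List ℕ) (f : ℕ → ℕ) : Cost :=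
  (D.map fun u => cost G u (f u)).sum

theorem totalCost_congr {D : List ℕ} {f g : ℕ → ℕ} (h : ∀ u ∈ D, f u = g u) :
    totalCost G D f = totalCost G D g := by
  unfold totalCost
  congr 1
  exact List.map_congr_left fun u hu => by rw [h u hu]

theorem totalCost_append (D E : List ℕ) (f : ℕ → ℕ) :
    totalCost G (D ++ E) f = totalCost G D f + totalCost G E f := by
  simp [totalCost]

theorem totalCost_perm {D E : List ℕ} (h : D.Perm E) (f : ℕ → ℕ) :
    totalCost G D f = totalCost G E f := (h.map _).sum_eq

theorem addCost_eq (c d : Cost) : addCost c d = c + d := rfl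

theorem rk_le (u w : ℕ) : rk G u w ≤ G.2.flatten.sum := by
  unfold rk
  rw [List.getD_eq_getElem?_getD, List.getD_eq_getElem?_getD]
  rcases h : G.2[u]? with _ | l
  · simp
  · rcases h' : l[w]? with _ | x
    · simp [h']
    · simp only [Option.getD_some, h']
      exact List.le_sum_of_mem (List.mem_flatten.2 ⟨l, List.mem_of_getElem? h,
        List.mem_of_getElem? h'⟩)

theorem cost_le (u x : ℕ) : cost G u x ≤ (G.2.flatten.sum + 1, G.2.flatten.sum + 1,
    G.2.flatten.sum + 1) := by
  unfold cost
  cases decide (u < G.1) && decide (2 ≤ x)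
  · exact ⟨by simp, by simp, by simp⟩
  · exact ⟨(rk_le _ _).trans (by simp), (rk_le _ _).trans (by simp), by simp⟩

/-- Guarantees that thinning, which looks only at costs in the grid, loses no cost of an actual
solution. -/
theorem totalCost_mem_costs {D : List ℕ} (hD : D.Nodup) (hDV : ∀ u ∈ D, u < G.2.length)
    (f : ℕ → ℕ) : totalCost G D f ∈ costs G := by
  have hlen : D.length ≤ G.2.length := by
    simpa using (List.subperm_of_subset hD (l₂ := List.range G.2.length) fun u hu =>
      List.mem_range.2 (hDV u hu)).length_le
  have h : totalCost G D f ≤ D.length • (G.2.flatten.sum + 1, G.2.flatten.sum + 1,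
      G.2.flatten.sum + 1) := by
    have := List.sum_le_card_nsmul (D.map fun u => cost G u (f u)) _ (by
      intro c hc
      obtain ⟨u, -, rfl⟩ := List.mem_map.1 hc
      exact cost_le u (f u))
    simpa [totalCost] using this
  have hb : D.length * (G.2.flatten.sum + 1) ≤ costBound G := Nat.mul_le_mul_right _ hlen
  have h₁ : (totalCost G D f).1 ≤ D.length * (G.2.flatten.sum + 1) := h.1
  have h₂ : (totalCost G D f).2.1 ≤ D.length * (G.2.flatten.sum + 1) := h.2.1
  have h₃ : (totalCost G D f).2.2 ≤ D.length * (G.2.flatten.sum + 1) := h.2.2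
  simp only [costs, List.mem_flatMap, List.mem_map, List.mem_range]
  exact ⟨(totalCost G D f).1, by omega, (totalCost G D f).2.1, by omega, (totalCost G D f).2.2,
    by omega, rfl⟩

/-- The rows `R` are the solutions on `C`, up to their costs and their values around `C`. -/
structure Exact (G : RankData) (C : List ℕ) (R : List Row) : Prop where
  sound : ∀ r ∈ R, Sat G (look r.2) C (verts G) ∧ r.1 = totalCost G C (look r.2)
  complete : ∀ f : ℕ → ℕ, (∀ u, f u ≤ G.2.length + 1) → Sat G f C (verts G) →
    ∃ r ∈ R, (∀ w ∈ nbhd G C, look r.2 w = f w) ∧ r.1 = totalCost G C f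

theorem Exact.perm {C K : List ℕ} {R : List Row} (h : Exact G C R) (hp : C.Perm K) :
    Exact G K R where
  sound r hr := ⟨fun u hu => (h.sound r hr).1 u (hp.symm.subset hu),
    (h.sound r hr).2.trans (totalCost_perm hp _)⟩
  complete f hf hs := by
    obtain ⟨r, hr, h₁, h₂⟩ := h.complete f hf fun u hu => hs u (hp.subset hu)
    exact ⟨r, hr, nbhd_congr (G := G) (fun _ => hp.mem_iff) ▸ h₁, h₂.trans (totalCost_perm hp f)⟩

/-! ### Gluing tables along neighbourhoods -/

/-- Partial tables: the constraints within `D ∪ N` have been checked for the agents in `D`, and the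
assignments with `F` are represented up to their costs on `D` and their values on `B`. -/
structure PartExact (G : RankData) (F : (ℕ → ℕ) → Prop) (N B D : List ℕ) (R : List Row) :
    Prop where
  le : ∀ r ∈ R, ∀ u ∈ D ++ N, look r.2 u ≤ G.2.length + 1
  sat : ∀ r ∈ R, Sat G (look r.2) D (D ++ N)
  cost_eq : ∀ r ∈ R, r.1 = totalCost G D (look r.2)
  complete : ∀ f, F f → ∃ r ∈ R, (∀ u ∈ B, look r.2 u = f u) ∧ r.1 = totalCost G D f

theorem PartExact.perm {F : (ℕ → ℕ) → Prop} {N B D E : List ℕ} {R : List Row}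
    (h : PartExact G F N B D R) (hp : D.Perm E) : PartExact G F N B E R where
  le r hr u hu := h.le r hr u ((hp.symm.append_right N).subset hu)
  sat r hr u hu := ⟨(h.sat r hr u (hp.symm.subset hu)).1, fun w hw =>
    (h.sat r hr u (hp.symm.subset hu)).2 w ((hp.symm.append_right N).subset hw)⟩
  cost_eq r hr := (h.cost_eq r hr).trans (totalCost_perm hp _)
  complete f hf := by
    obtain ⟨r, hr, h₁, h₂⟩ := h.complete f hf
    exact ⟨r, hr, h₁, h₂.trans (totalCost_perm hp f)⟩

theorem look_overlay {K r s : List ℕ} {u : ℕ} (hu : u < G.2.length)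
    (hK : u ∈ K → look s u ≤ G.2.length + 1) (hr : u ∉ K → look r u ≤ G.2.length + 1) :
    look (overlay G K r s) u = if u ∈ K then look s u else look r u := by
  have h : look (overlay G K r s) u = clip G (bif decide (u ∈ K) then look s u else look r u) := by
    rw [look, overlay, List.getD_eq_getElem?_getD, List.getElem?_map, verts,
      List.getElem?_range hu]
    rfl
  rw [h]
  by_cases hu : u ∈ K
  · simp [hu, clip, hK hu]
  · simp [hu, clip, hr hu]

theorem agree_iff {B r s : List ℕ} : agree B r s = true ↔ ∀ u ∈ B, look r u = look s u := by
  simp [agree]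

theorem mem_thin {U : List (List ℕ)} {B : List ℕ} {R : List Row} {r : Row}
    (h : r ∈ thin G U B R) : r ∈ R := by
  obtain ⟨t, -, h⟩ := List.mem_flatMap.1 h
  obtain ⟨c, -, h⟩ := List.mem_filterMap.1 h
  exact List.mem_of_find?_eq_some h

/-- Thinning may discard the row itself, but it keeps one with the same cost and the same values on
`B`, and nothing more is ever asked of a row. -/
theorem exists_mem_thin {U : List (List ℕ)} {B : List ℕ} {R : List Row} {r : Row} (hr : r ∈ R)
    (hc : r.1 ∈ costs G) {t : List ℕ} (ht : t ∈ U) (hrt : ∀ u ∈ B, look r.2 u = look t u) :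
    ∃ s ∈ thin G U B R, s.1 = r.1 ∧ ∀ u ∈ B, look s.2 u = look t u := by
  let p : Row → Bool := fun s => decide (s.1.1 = r.1.1) && decide (s.1.2.1 = r.1.2.1) &&
    decide (s.1.2.2 = r.1.2.2) && agree B s.2 t
  have hp : p r = true := by simpa [p] using agree_iff.2 hrt
  obtain ⟨s, hs⟩ := Option.isSome_iff_exists.1 (List.find?_isSome.2 ⟨r, hr, hp⟩)
  refine ⟨s, List.mem_flatMap.2 ⟨t, ht, List.mem_filterMap.2 ⟨r.1, hc, hs⟩⟩, ?_⟩
  have := List.find?_some hs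
  simp only [p, Bool.and_eq_true, decide_eq_true_eq] at this
  exact ⟨Prod.ext this.1.1.1 (Prod.ext this.1.1.2 this.1.2), agree_iff.1 this.2⟩

/-- Every edge leaving `K` ends in N(K), where joined rows agree, so overlaying the two partial
solutions violates no constraint; the costs add up because `K` and `D` are disjoint. Conversely,
both tables represent a given `f`, and since N(K) lies in `B` the two representatives agree there
and are joined. The result has the cost of `f` and its values on `B`, so it survives thinning up to
equivalence. -/
theorem RankData.Proper.partExact_thin_join (hG : G.Proper) {F : (ℕ → ℕ) → Prop}
    {U : List (List ℕ)} {N B D K : List ℕ} {R Q : List Row}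
    (hU : ∀ f, F f → ∃ t ∈ U, ∀ u ∈ B, look t u = f u)
    (hF : ∀ f, F f → (∀ u, f u ≤ G.2.length + 1) ∧ Sat G f K (verts G))
    (hB : ∀ u ∈ B, u ∈ D ++ N) (hN : ∀ u ∈ N, u < G.2.length) (hnd : (K ++ D).Nodup)
    (hV : ∀ u ∈ K ++ D, u < G.2.length) (hKN : ∀ u ∈ K, u ∉ N) (hnb : ∀ u ∈ nbhd G K, u ∈ B)
    (hR : PartExact G F N B D R) (hQ : Exact G K Q) :
    PartExact G F N B (K ++ D) (thin G U B (join G K R Q)) := by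
  have hKD : ∀ u ∈ K, u ∉ D ++ N := by
    intro u hu hu'
    rcases List.mem_append.1 hu' with h | h
    · exact (List.disjoint_of_nodup_append hnd) hu h
    · exact hKN u hu h
  have hlt : ∀ u ∈ D ++ N, u < G.2.length := by
    intro u hu
    rcases List.mem_append.1 hu with h | h
    · exact hV u (List.mem_append_right _ h)
    · exact hN u h
  have hlook : ∀ p ∈ R, ∀ q ∈ Q, (∀ u ∈ K, look (overlay G K p.2 q.2) u = look q.2 u) ∧
      ∀ u ∈ D ++ N, look (overlay G K p.2 q.2) u = look p.2 u := by
    intro p hp q hq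
    constructor
    · intro u hu
      rw [look_overlay (hV u (List.mem_append_left _ hu))
        (fun _ => hG.le_of_fits ((hQ.sound q hq).1 u hu).1) (fun h => absurd hu h), if_pos hu]
    · intro u hu
      have hK : u ∉ K := fun h => hKD u h hu
      rw [look_overlay (hlt u hu) (fun h => absurd h hK) (fun _ => hR.le p hp u hu), if_neg hK]
  have hmem : ∀ r ∈ thin G U B (join G K R Q), ∃ p ∈ R, ∃ q ∈ Q,
      (∀ u ∈ nbhd G K, look p.2 u = look q.2 u) ∧
        r = (addCost p.1 q.1, overlay G K p.2 q.2) := by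
    intro r hr
    obtain ⟨p, hp, hr⟩ := List.mem_flatMap.1 (mem_thin hr)
    obtain ⟨q, hq, rfl⟩ := List.mem_map.1 hr
    obtain ⟨hq, hpq⟩ := List.mem_filter.1 hq
    exact ⟨p, hp, q, hq, agree_iff.1 hpq, rfl⟩
  have hsplit : ∀ u, u ∈ (K ++ D) ++ N → u ∈ K ∨ u ∈ D ++ N := by
    intro u hu
    simp only [List.mem_append] at hu ⊢
    tauto
  refine ⟨?_, ?_, ?_, ?_⟩
  · intro r hr u hu
    obtain ⟨p, hp, q, hq, hpq, rfl⟩ := hmem r hr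
    rcases hsplit u hu with hu | hu
    · rw [(hlook p hp q hq).1 u hu]
      exact hG.le_of_fits ((hQ.sound q hq).1 u hu).1
    · rw [(hlook p hp q hq).2 u hu]
      exact hR.le p hp u hu
  · intro r hr
    obtain ⟨p, hp, q, hq, hpq, rfl⟩ := hmem r hr
    obtain ⟨h₁, h₂⟩ := hlook p hp q hq
    -- Only an edge needs checking. Its end outside `K` lies in N(K), where `p` and `q` coincide,
    -- and `q` satisfies all the constraints at `u`.
    have hcross : ∀ u ∈ K, ∀ w ∈ D ++ N, compat G u (look q.2 u) w (look p.2 w) = true := by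
      intro u hu w hw
      cases huw : adj G u w with
      | false => exact compat_of_not_adj huw
      | true =>
        have hwK : w ∈ nbhd G K := mem_nbhd.2 ⟨hlt w hw, fun h => hKD w h hw, u, hu, huw⟩
        rw [hpq w hwK]
        exact ((hQ.sound q hq).1 u hu).2 w (mem_verts.2 (hlt w hw))
    intro u hu
    rcases List.mem_append.1 hu with hu | hu
    · rw [h₁ u hu]
      refine ⟨((hQ.sound q hq).1 u hu).1, fun w hw => ?_⟩
      rcases hsplit w hw with hw | hw
      · rw [h₁ w hw]
        exact ((hQ.sound q hq).1 u hu).2 w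
          (mem_verts.2 (hV w (List.mem_append_left _ hw)))
      · rw [h₂ w hw]
        exact hcross u hu w hw
    · rw [h₂ u (List.mem_append_left _ hu)]
      refine ⟨(hR.sat p hp u hu).1, fun w hw => ?_⟩
      rcases hsplit w hw with hw | hw
      · rw [h₁ w hw]
        exact hG.compat_symm (hcross w hw u (List.mem_append_left _ hu))
      · rw [h₂ w hw]
        exact (hR.sat p hp u hu).2 w hw
  · intro r hr
    obtain ⟨p, hp, q, hq, hpq, rfl⟩ := hmem r hr
    obtain ⟨h₁, h₂⟩ := hlook p hp q hq
    rw [totalCost_append, totalCost_congr (g := look q.2) h₁,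
      totalCost_congr (g := look p.2) fun u hu => h₂ u (List.mem_append_left _ hu),
      ← hR.cost_eq p hp, ← (hQ.sound q hq).2, addCost_eq, add_comm]
  · intro f hf
    obtain ⟨p, hp, hpf, hpc⟩ := hR.complete f hf
    obtain ⟨q, hq, hqf, hqc⟩ := hQ.complete f (hF f hf).1 (hF f hf).2
    obtain ⟨t, ht, htf⟩ := hU f hf
    have hc : addCost p.1 q.1 = totalCost G (K ++ D) f := by
      rw [totalCost_append, hpc, hqc, addCost_eq, add_comm]
    have hj : (addCost p.1 q.1, overlay G K p.2 q.2) ∈ join G K R Q :=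
      List.mem_flatMap.2 ⟨p, hp, List.mem_map.2 ⟨q, List.mem_filter.2 ⟨hq, agree_iff.2 fun u hu =>
        (hpf u (hnb u hu)).trans (hqf u hu).symm⟩, rfl⟩⟩
    obtain ⟨s, hs, hsc, hst⟩ := exists_mem_thin (B := B) hj
      (hc ▸ totalCost_mem_costs hnd hV f) ht fun u hu =>
        ((hlook p hp q hq).2 u (hB u hu)).trans ((hpf u hu).trans (htf u hu).symm)
    exact ⟨s, hs, fun u hu => (hst u hu).trans (htf u hu), hsc.trans hc⟩

/-- All sets in the table are free of duplicates and come with exact rows. -/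
def Table.Exact (G : RankData) (tab : Table) : Prop :=
  ∀ e ∈ tab, e.1.Nodup ∧ StableMarriage.Exact G e.1 e.2

theorem perm_of_sameSet {K L : List ℕ} (hK : K.Nodup) (hL : L.Nodup)
    (h : sameSet K L = true) : K.Perm L := by
  simp only [sameSet, Bool.and_eq_true, List.all_eq_true, decide_eq_true_eq] at h
  exact (List.perm_ext_iff_of_nodup hK hL).2 fun a => ⟨h.1 a, h.2 a⟩

theorem RankData.Proper.partExact_assemble (hG : G.Proper) {F : (ℕ → ℕ) → Prop}
    {U : List (List ℕ)} {N B : List ℕ} {tab : Table}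
    (hU : ∀ f, F f → ∃ t ∈ U, ∀ u ∈ B, look t u = f u) (hN : ∀ u ∈ N, u < G.2.length)
    (htab : tab.Exact G) (Ks : List (List ℕ)) {D : List ℕ} {R R' : List Row}
    (hF : ∀ f, F f → (∀ u, f u ≤ G.2.length + 1) ∧ ∀ K ∈ Ks, Sat G f K (verts G))
    (hB : ∀ u ∈ B, u ∈ D ++ N) (hnd : (Ks.flatten ++ D).Nodup)
    (hV : ∀ u ∈ Ks.flatten ++ D, u < G.2.length)
    (hKN : ∀ K ∈ Ks, ∀ u ∈ K, u ∉ N) (hnb : ∀ K ∈ Ks, ∀ u ∈ nbhd G K, u ∈ B)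
    (hR : PartExact G F N B D R) (h : assemble G U B tab Ks R = some R') :
    PartExact G F N B (Ks.flatten ++ D) R' := by
  induction Ks generalizing D R with
  | nil =>
    cases h
    exact hR
  | cons K Ks ih =>
    have hp : (Ks.flatten ++ (K ++ D)).Perm ((K :: Ks).flatten ++ D) := by
      rw [List.flatten_cons, ← List.append_assoc]
      exact List.perm_append_comm.append_right D
    have hnd' := hp.symm.nodup hnd
    have hnn : (K ++ D).Nodup := (List.nodup_append.1 hnd').2.1
    rw [assemble, List.foldl_cons, Option.bind_some] at h
    cases he : tab.find? fun e => sameSet e.1 K with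
    | none =>
      rw [he, Option.map_none] at h
      -- A missing table makes the state `none`, and it stays `none` through the remaining
      -- components.
      exfalso
      clear ih hF hnd hV hKN hnb hp hnd'
      induction Ks with
      | nil => cases h
      | cons K' Ks ih' => exact ih' h
    | some e =>
      rw [he, Option.map_some] at h
      obtain ⟨hen, heE⟩ := htab e (List.mem_of_find?_eq_some he)
      have hperm := perm_of_sameSet hen (List.nodup_append.1 hnn).1
        (List.find?_some (p := fun e : List ℕ × List Row => sameSet e.1 K) he)
      have hstep := hG.partExact_thin_join hU
        (fun f hf => ⟨(hF f hf).1, (hF f hf).2 K List.mem_cons_self⟩) hB hN hnn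
        (fun u hu => hV u (hp.subset (List.mem_append_right _ hu))) (hKN K List.mem_cons_self)
        (hnb K List.mem_cons_self) hR (heE.perm hperm)
      refine (ih (fun f hf => ⟨(hF f hf).1, fun L hL => (hF f hf).2 L (List.mem_cons_of_mem _ hL)⟩)
        (fun u hu => ?_) hnd' (fun u hu => hV u (hp.subset hu))
        (fun L hL => hKN L (List.mem_cons_of_mem _ hL))
        (fun L hL => hnb L (List.mem_cons_of_mem _ hL)) hstep h).perm hp
      rw [List.append_assoc]
      exact List.mem_append_right _ (hB u hu)

/-! ### Assignments of bounded support and exactness of the tables -/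

/-- `U` consists of the partial assignments with at most `j` defined values. -/
structure Universe (G : RankData) (j : ℕ) (U : List (List ℕ)) : Prop where
  le : ∀ t ∈ U, ∀ u, look t u ≤ G.2.length + 1
  exists_mem : ∀ f : ℕ → ℕ, (∀ u, f u ≤ G.2.length + 1) → ∀ B : List ℕ, B.length ≤ j →
    (∀ u ∈ B, u < G.2.length) → ∃ t ∈ U, ∀ u, look t u = if u ∈ B then f u else 0

theorem look_map_verts (f : ℕ → ℕ) (u : ℕ) :
    look ((verts G).map f) u = if u < G.2.length then f u else 0 := by
  rw [look, List.getD_eq_getElem?_getD, List.getElem?_map, verts]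
  by_cases h : u < G.2.length
  · rw [List.getElem?_range h, if_pos h]
    rfl
  · rw [List.getElem?_eq_none (by simpa using h), if_neg h]
    rfl

theorem universe_zero : Universe G 0 [zeroRow G] where
  le t ht u := by
    rw [List.mem_singleton.1 ht, zeroRow, look_map_verts]
    simp
  exists_mem f _ B hB _ := by
    obtain rfl := List.length_eq_zero_iff.1 (Nat.le_zero.1 hB)
    exact ⟨_, List.mem_singleton_self _, fun u => by rw [zeroRow, look_map_verts]; simp⟩

theorem Universe.extend {j : ℕ} {U : List (List ℕ)} (h : Universe G j U) :
    Universe G (j + 1) (extend G U) where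
  le t ht u := by
    rcases List.mem_append.1 ht with ht | ht
    · exact h.le t ht u
    · simp only [List.mem_flatMap, List.mem_map, List.mem_range] at ht
      obtain ⟨t, ht', w, -, x, hx, rfl⟩ := ht
      rw [look_map_verts]
      by_cases huw : u = w
      · split_ifs <;> simp [huw]
        omega
      · split_ifs <;> simp [huw, h.le t ht' u]
  exists_mem f hf B hB hBV := by
    obtain _ | ⟨b, B⟩ := B
    · obtain ⟨t, ht, htf⟩ := h.exists_mem f hf [] (by simp) (by simp)
      exact ⟨t, List.mem_append_left _ ht, htf⟩
    · obtain ⟨t, ht, htf⟩ := h.exists_mem f hf B (by simpa using hB)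
        fun u hu => hBV u (List.mem_cons_of_mem _ hu)
      refine ⟨_, List.mem_append_right _ (List.mem_flatMap.2 ⟨t, ht, List.mem_flatMap.2
        ⟨b, mem_verts.2 (hBV b List.mem_cons_self), List.mem_map.2 ⟨f b, List.mem_range.2
          (Nat.lt_succ_of_le (hf b)), rfl⟩⟩⟩), fun u => ?_⟩
      rw [look_map_verts]
      by_cases hub : u = b
      · simp [hub, hBV b List.mem_cons_self]
      · have : ¬ u < G.2.length → u ∉ B := fun h h' => h (hBV u (List.mem_cons_of_mem _ h'))
        by_cases hu : u < G.2.length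
        · simp [hub, hu, htf]
        · simp [hub, hu, this hu]

/-- Start with the rows for `v` alone and glue in the components of `C \ {v}` one by one, keeping
the values on N(C) ∪ {v}. Afterwards all constraints inside `C` ∪ N(C) at agents of `C` have been
checked, and an agent of `C` has no edges to anywhere else. -/
theorem RankData.Proper.exact_of_solveAt (hG : G.Proper) {j : ℕ} {U : List (List ℕ)}
    (hU : Universe G j U) {tab : Table} (htab : tab.Exact G) {C : List ℕ} (hC : C.Nodup)
    (hCV : ∀ u ∈ C, u < G.2.length) {v : ℕ} (hv : v ∈ C) {R : List Row}
    (h : solveAt G j U tab C v = some R) : Exact G C R := by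
  rw [solveAt] at h
  by_cases hj : (v :: nbhd G C).length ≤ j
  swap
  · rw [decide_eq_false hj, cond_false] at h
    cases h
  rw [decide_eq_true hj, cond_true] at h
  have hBV : ∀ u ∈ v :: nbhd G C, u < G.2.length := by
    intro u hu
    rcases List.mem_cons.1 hu with rfl | hu
    · exact hCV u hv
    · exact (mem_nbhd.1 hu).1
  let F : (ℕ → ℕ) → Prop := fun f => (∀ u, f u ≤ G.2.length + 1) ∧ Sat G f C (verts G)
  have hUF : ∀ f, F f → ∃ t ∈ U, ∀ u ∈ v :: nbhd G C, look t u = f u := by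
    intro f hf
    obtain ⟨t, ht, htf⟩ := hU.exists_mem f hf.1 _ hj hBV
    exact ⟨t, ht, fun u hu => by rw [htf, if_pos hu]⟩
  have hsub : ∀ K ∈ comps G (C.filter fun u => !decide (u = v)), ∀ u ∈ K, u ∈ C ∧ u ≠ v := by
    intro K hK u hu
    simpa using List.mem_filter.1 (hG.mem_comps_subset hK hu)
  have hperm : ((comps G (C.filter fun u => !decide (u = v))).flatten ++ [v]).Perm C := by
    refine ((hG.comps_spec _).1.append_right [v]).trans ?_
    refine (List.perm_ext_iff_of_nodup ?_ hC).2 fun u => ?_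
    · rw [List.nodup_append]
      refine ⟨hC.filter _, by simp, ?_⟩
      rintro a ha b hb rfl
      simp at ha hb
      exact ha.2 hb
    · simp only [List.mem_append, List.mem_filter, List.mem_singleton, Bool.not_eq_true',
        decide_eq_false_iff_not]
      constructor
      · rintro (h | rfl)
        exacts [h.1, hv]
      · intro h
        by_cases huv : u = v
        · exact Or.inr huv
        · exact Or.inl ⟨h, huv⟩
  have hinit : PartExact G F (nbhd G C) (v :: nbhd G C) [v] (initRows G U C v) := by
    have hmem : ∀ r ∈ initRows G U C v, r.2 ∈ U ∧ fits G v (look r.2 v) = true ∧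
        (∀ w ∈ nbhd G C, compat G v (look r.2 v) w (look r.2 w) = true) ∧
          r.1 = cost G v (look r.2 v) := by
      intro r hr
      obtain ⟨t, ht, rfl⟩ := List.mem_map.1 hr
      obtain ⟨ht, hs⟩ := List.mem_filter.1 ht
      simp only [Bool.and_eq_true, List.all_eq_true] at hs
      exact ⟨ht, hs.1, hs.2, rfl⟩
    refine ⟨fun r hr u _ => hU.le _ (hmem r hr).1 u, fun r hr u hu => ?_, fun r hr => ?_,
      fun f hf => ?_⟩
    · rw [List.mem_singleton.1 hu]
      refine ⟨(hmem r hr).2.1, fun w hw => ?_⟩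
      rcases List.mem_cons.1 hw with rfl | hw
      · exact compat_of_not_adj (hG.irrefl w)
      · exact (hmem r hr).2.2.1 w hw
    · rw [(hmem r hr).2.2.2]
      simp [totalCost]
    · obtain ⟨t, ht, htf⟩ := hUF f hf
      refine ⟨(cost G v (look t v), t), List.mem_map.2 ⟨t, List.mem_filter.2 ⟨ht, ?_⟩, rfl⟩, htf, ?_⟩
      · simp only [Bool.and_eq_true, List.all_eq_true]
        rw [htf v List.mem_cons_self]
        refine ⟨(hf.2 v hv).1, fun w hw => ?_⟩
        rw [htf w (List.mem_cons_of_mem _ hw)]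
        exact (hf.2 v hv).2 w (mem_verts.2 (mem_nbhd.1 hw).1)
      · rw [htf v List.mem_cons_self]
        simp [totalCost]
  -- The last side condition: a neighbour of a component `K` that is different from `v` cannot lie
  -- in `C`, since it would belong to `K`; so it lies in N(C).
  have hres := (hG.partExact_assemble hUF (fun u hu => (mem_nbhd.1 hu).1) htab _
    (fun f hf => ⟨hf.1, fun K hK u hu => hf.2 u (hsub K hK u hu).1⟩) (fun u hu => by simpa using hu)
    (hperm.nodup_iff.2 hC) (fun u hu => hCV u (hperm.subset hu))
    (fun K hK u hu hu' => (mem_nbhd.1 hu').2.1 (hsub K hK u hu).1) (fun K hK w hw => by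
      obtain ⟨hwV, hwK, u, hu, huw⟩ := mem_nbhd.1 hw
      by_cases hwv : w = v
      · simp [hwv]
      · refine List.mem_cons_of_mem _ (mem_nbhd.2 ⟨hwV, fun hwC => hwK ?_, u, (hsub K hK u hu).1, huw⟩)
        exact hG.comps_closed hK hu (List.mem_filter.2 ⟨hwC, by simp [hwv]⟩) huw)
    hinit h).perm hperm
  refine ⟨fun r hr => ⟨fun u hu => ⟨(hres.sat r hr u hu).1, fun w hw => ?_⟩, hres.cost_eq r hr⟩,
    fun f hf hs => ?_⟩
  · by_cases hwC : w ∈ C ++ nbhd G C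
    · exact (hres.sat r hr u hu).2 w hwC
    · rw [List.mem_append, not_or] at hwC
      refine compat_of_not_adj (Bool.eq_false_iff.2 fun huw => hwC.2 ?_)
      exact mem_nbhd.2 ⟨mem_verts.1 hw, hwC.1, u, hu, huw⟩
  · obtain ⟨r, hr, h₁, h₂⟩ := hres.complete f ⟨hf, hs⟩
    exact ⟨r, hr, fun w hw => h₁ w (List.mem_cons_of_mem _ hw), h₂⟩

theorem RankData.Proper.candidates_spec (hG : G.Proper) {U : List (List ℕ)} {C : List ℕ}
    (hC : C ∈ candidates G U) : C.Nodup ∧ ∀ u ∈ C, u < G.2.length := by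
  obtain ⟨t, -, hC⟩ := List.mem_flatMap.1 hC
  exact ⟨hG.nodup_of_mem_comps (nodup_verts.filter _) hC, fun u hu =>
    mem_verts.1 (List.mem_filter.1 (hG.mem_comps_subset hC hu)).1⟩

theorem RankData.Proper.exact_nextTable (hG : G.Proper) {j : ℕ} {U : List (List ℕ)}
    (hU : Universe G j U) {tab : Table} (htab : tab.Exact G) : (nextTable G j U tab).Exact G := by
  intro e he
  obtain ⟨h₁, h₂⟩ := mem_nextTable.1 he
  obtain ⟨v, hv, h₃⟩ := List.mem_filterMap.1 (List.mem_of_mem_head? h₂)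
  obtain ⟨hn, hV⟩ := hG.candidates_spec h₁
  exact ⟨hn, hG.exact_of_solveAt hU htab hn hV hv h₃⟩

/-- The table after `i` rounds. -/
def tableAt (G : RankData) (j : ℕ) (U : List (List ℕ)) (i : ℕ) : Table :=
  (nextTable G j U)^[i] []

theorem RankData.Proper.exact_tableAt (hG : G.Proper) {j : ℕ} {U : List (List ℕ)}
    (hU : Universe G j U) (i : ℕ) : (tableAt G j U i).Exact G := by
  induction i with
  | zero => intro e he; cases he
  | succ i ih =>
    rw [tableAt, Function.iterate_succ_apply']
    exact hG.exact_nextTable hU ih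

theorem attempt_eq (G : RankData) (j : ℕ) (U : List (List ℕ)) :
    attempt G j U = assemble G U [] (tableAt G j U G.2.length) (comps G (verts G))
      [((0, 0, 0), zeroRow G)] := by
  have h : ∀ (l : List ℕ) (tab : Table), l.foldl (fun tab _ => nextTable G j U tab) tab =
      (nextTable G j U)^[l.length] tab := by
    intro l
    induction l with
    | nil => intro tab; rfl
    | cons _ l ih => intro tab; exact ih _
  rw [attempt, h, tableAt, verts, List.length_range]

/-- The components of the whole graph have no neighbours, so they are glued over the empty set.
Treewidth plays no role: every successful attempt is exact. -/
theorem RankData.Proper.exact_attempt (hG : G.Proper) {j : ℕ} {U : List (List ℕ)}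
    (hU : Universe G j U) {R : List Row} (h : attempt G j U = some R) : Exact G (verts G) R := by
  rw [attempt_eq] at h
  have hperm := (hG.comps_spec (verts G)).1
  let F : (ℕ → ℕ) → Prop := fun f => (∀ u, f u ≤ G.2.length + 1) ∧ Sat G f (verts G) (verts G)
  have hres := (hG.partExact_assemble (F := F) (N := []) (D := [])
    (fun f hf => ?_) (by simp) (hG.exact_tableAt hU _) _
    (fun f hf => ⟨hf.1, fun K hK u hu => hf.2 u (hG.mem_comps_subset hK hu)⟩) (by simp)
    (by simpa using hperm.nodup_iff.2 nodup_verts)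
    (fun u hu => mem_verts.1 (hperm.subset (by simpa using hu))) (by simp)
    (fun K hK w hw => ?_) ?_ h).perm (by simpa using hperm)
  · refine ⟨fun r hr => ⟨fun u hu => ?_, hres.cost_eq r hr⟩, fun f hf hs => ?_⟩
    · simpa using hres.sat r hr u hu
    · obtain ⟨r, hr, -, h₂⟩ := hres.complete f ⟨hf, hs⟩
      refine ⟨r, hr, fun w hw => ?_, h₂⟩
      obtain ⟨h₁, h₂, -⟩ := mem_nbhd.1 hw
      exact absurd (mem_verts.2 h₁) h₂
  · obtain ⟨t, ht, -⟩ := hU.exists_mem f hf.1 [] (by simp) (by simp)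
    exact ⟨t, ht, by simp⟩
  · obtain ⟨hwV, hwK, u, hu, huw⟩ := mem_nbhd.1 hw
    exact absurd (hG.comps_closed hK hu (mem_verts.2 hwV) huw) hwK
  · refine ⟨by simp, by simp [Sat], ?_, fun f _ => ⟨_, List.mem_singleton_self _, by simp, ?_⟩⟩
    · intro r hr
      rw [List.mem_singleton.1 hr]
      rfl
    · rfl

end Correctness
end StableMarriage

namespace StableMarriage

/-! ### Rooted tree decompositions -/

/-- `i` is a descendant of `t`, where `p` is the parent function and `d` the depth. -/
inductive Desc {ι : Type} (p : ι → ι) (d : ι → ℕ) (t : ι) : ι → Prop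
  | refl : Desc p d t t
  | step {i : ι} : d (p i) < d i → Desc p d t (p i) → Desc p d t i

theorem Desc.eq_or_lt {ι : Type} {p : ι → ι} {d : ι → ℕ} {t i : ι} (h : Desc p d t i) :
    i = t ∨ d t < d i := by
  induction h with
  | refl => exact .inl rfl
  | step hlt _ ih =>
    rcases ih with ih | ih
    · exact .inr (ih ▸ hlt)
    · exact .inr (ih.trans hlt)

theorem Desc.parent {ι : Type} {p : ι → ι} {d : ι → ℕ} {t i : ι} (h : Desc p d t i)
    (hne : i ≠ t) : Desc p d t (p i) := by
  cases h with
  | refl => exact absurd rfl hne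
  | step _ h => exact h

/-- A tree decomposition with nodes `ι` described by its parent function `p`, the depths `d` of the
nodes, and the topmost node `top x` of each vertex. -/
structure RootedDecomp {V : Type} (H : SimpleGraph V) (ι : Type) where
  bag : ι → Finset V
  p : ι → ι
  d : ι → ℕ
  top : V → ι
  mem_top : ∀ x, x ∈ bag (top x)
  mem_parent : ∀ x i, x ∈ bag i → i ≠ top x → x ∈ bag (p i)
  parent_lt : ∀ x i, x ∈ bag i → i ≠ top x → d (p i) < d i
  edge : ∀ x y, H.Adj x y → ∃ i, x ∈ bag i ∧ y ∈ bag i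

/-- Root the tree at any node `r`: the parent of `i` is the penultimate node of the path from `r` to
`i`, and every edge joins a node to its parent. The topmost node of `x` is a node of least depth
among those whose bags contain `x`. The value of `p` at the root is irrelevant, as parents matter
only at nodes other than the topmost one. -/
theorem TreeDecomposition.exists_rootedDecomp {V : Type} {H : SimpleGraph V} {N : ℕ}
    (D : TreeDecomposition H N) : ∃ E : RootedDecomp H (Fin N), E.bag = D.bag := by
  classical
  obtain ⟨r⟩ := D.isTree.connected.nonempty
  choose q hq hlen using fun i => D.isTree.connected.exists_path_of_dist r i
  let p : Fin N → Fin N := fun i => (q i).penultimate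
  let d : Fin N → ℕ := fun i => D.tree.dist r i
  have hedge : ∀ i j, D.tree.Adj i j → (p i = j ∧ d j < d i) ∨ (p j = i ∧ d i < d j) := by
    have h : ∀ i j, D.tree.Adj i j → j ∈ (q i).support → p i = j ∧ d j < d i := by
      intro i j hij hj
      refine ⟨(D.isTree.isAcyclic.eq_penultimate_of_adj_end (hq i) hij hj).symm, ?_⟩
      have := congrArg SimpleGraph.Walk.length
        (D.isTree.isAcyclic.path_concat (hq j) (hq i) hij.symm hj)
      rw [SimpleGraph.Walk.length_concat, hlen, hlen] at this
      show D.tree.dist r j < D.tree.dist r i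
      omega
    intro i j hij
    by_cases hj : j ∈ (q i).support
    · exact .inl (h i j hij hj)
    · exact .inr (h j i hij.symm
        (D.isTree.isAcyclic.mem_support_of_ne_mem_support_of_adj_of_isPath (hq j) (hq i)
          hij.symm hj))
  have htop : ∀ x, ∃ t, x ∈ D.bag t ∧ ∀ i, x ∈ D.bag i → d t ≤ d i := by
    intro x
    obtain ⟨⟨i, hi⟩⟩ := (D.conn x).connected.nonempty
    obtain ⟨t, ht, hmin⟩ := (Finset.univ.filter fun i => x ∈ D.bag i).exists_min_image d
      ⟨i, by simpa using hi⟩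
    exact ⟨t, by simpa using ht, fun i hi => hmin i (by simpa using hi)⟩
  choose top hmem hmin using htop
  have hup : ∀ x i, x ∈ D.bag i → i ≠ top x → x ∈ D.bag (p i) ∧ d (p i) < d i := by
    intro x i hi hne
    by_contra hcon
    -- If the step from `i` to its parent left the subtree of `x`, then a walk from `i` inside this
    -- subtree could never leave the descendants of `i`. But it reaches `top x`, which is not below
    -- `i`.
    have hclosed : ∀ j j' : {i | x ∈ D.bag i}, (D.tree.induce {i | x ∈ D.bag i}).Adj j j' →
        Desc p d i j → Desc p d i j' := by
      rintro ⟨j, hj⟩ ⟨j', hj'⟩ hadj hd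
      rcases hedge j j' hadj with ⟨h₁, h₂⟩ | ⟨h₁, h₂⟩
      · by_cases hji : j = i
        · subst hji
          subst h₁
          exact absurd ⟨hj', h₂⟩ hcon
        · exact h₁ ▸ hd.parent hji
      · refine .step ?_ ?_ <;> simpa only [h₁]
    obtain ⟨w⟩ := (D.conn x).connected ⟨i, hi⟩ ⟨top x, hmem x⟩
    have hwalk : ∀ {j j' : {i | x ∈ D.bag i}}, (D.tree.induce {i | x ∈ D.bag i}).Walk j j' →
        Desc p d i j → Desc p d i j' := by
      intro j j' w
      induction w with
      | nil => exact id
      | cons h _ ih => exact fun hd => ih (hclosed _ _ h hd)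
    rcases (hwalk w .refl).eq_or_lt with h | h
    · exact hne h.symm
    · exact absurd (hmin x i hi) (Nat.not_le.2 h)
  exact ⟨⟨D.bag, p, d, top, hmem, fun x i hi hne => (hup x i hi hne).1,
    fun x i hi hne => (hup x i hi hne).2, D.edge⟩, rfl⟩

namespace RootedDecomp

variable {V ι : Type} {H : SimpleGraph V} (E : RootedDecomp H ι)

theorem desc_top_of_mem {i : ι} {x : V} (hx : x ∈ E.bag i) :
    Desc E.p E.d (E.top x) i := by
  induction hd : E.d i using Nat.strong_induction_on generalizing i with
  | _ n ih =>
    subst hd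
    by_cases hi : i = E.top x
    · exact hi ▸ .refl
    · exact .step (E.parent_lt x i hx hi)
        (ih _ (E.parent_lt x i hx hi) (E.mem_parent x i hx hi) rfl)

theorem depth_top_le {i : ι} {x : V} (hx : x ∈ E.bag i) : E.d (E.top x) ≤ E.d i := by
  rcases (E.desc_top_of_mem hx).eq_or_lt with h | h
  · rw [h]
  · exact h.le

/-- Climb from `i` to `t`: the topmost node of `x` is no deeper than `t`, so `x` stays in the bags
all the way. -/
theorem mem_of_desc {t i : ι} (h : Desc E.p E.d t i) {x : V} (hx : x ∈ E.bag i)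
    (hd : E.d (E.top x) ≤ E.d t) : x ∈ E.bag t := by
  induction h with
  | refl => exact hx
  | @step i hlt hdesc ih =>
    refine ih (E.mem_parent x i hx ?_)
    rintro rfl
    rcases hdesc.eq_or_lt with h | h
    · rw [h] at hlt; omega
    · omega

/-- Climbing from `i`, the topmost node of `x` is met no later than `t`. So it lies below `t`, and
all the bags containing `x` lie below it. -/
theorem desc_of_mem {t i : ι} (h : Desc E.p E.d t i) {x : V} (hx : x ∈ E.bag i)
    (hd : E.d t ≤ E.d (E.top x)) {j : ι} (hj : x ∈ E.bag j) : Desc E.p E.d t j := by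
  have htop : Desc E.p E.d t (E.top x) := by
    induction h with
    | refl =>
      by_cases ht : t = E.top x
      · exact ht ▸ .refl
      · have := E.parent_lt x t hx ht
        have := E.depth_top_le (E.mem_parent x t hx ht)
        omega
    | @step i hlt hdesc ih =>
      by_cases hi : i = E.top x
      · exact hi ▸ .step hlt hdesc
      · exact ih (E.mem_parent x i hx hi)
  have := E.desc_top_of_mem hj
  induction this with
  | refl => exact htop
  | @step j hlt _ ih =>
    by_cases hjt : j = E.top x
    · exact hjt ▸ htop
    · exact .step hlt (ih (E.mem_parent x j hj hjt))

/-- If `C` is connected with topmost node `t`, then the neighbours of `C` with topmost node above `t`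
lie in the bag of `t`. -/
theorem mem_bag_of_adj {C : V → Prop} {v : V}
    (hconn : ∀ A : V → Prop, A v → (∀ x, C x → A x → ∀ y, C y → H.Adj x y → A y) → ∀ y, C y → A y)
    (htop : ∀ w, C w → E.d (E.top v) ≤ E.d (E.top w)) {u w : V} (hw : C w) (hwu : H.Adj w u)
    (hu : E.d (E.top u) ≤ E.d (E.top v)) : u ∈ E.bag (E.top v) := by
  -- Adjacent vertices share a bag, so the property that all bags containing a vertex lie below `top
  -- v` spreads from `v` over the connected set `C`. The bag shared by `w` and `u` is then below
  -- `top v`.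
  have hall := hconn (fun x => ∀ j, x ∈ E.bag j → Desc E.p E.d (E.top v) j)
    (fun j hj => E.desc_top_of_mem hj) fun x hx hA y hy hxy j hj => by
      obtain ⟨i, hi, hi'⟩ := E.edge x y hxy
      exact E.desc_of_mem (hA i hi) hi' (htop y hy) hj
  obtain ⟨i, hi, hi'⟩ := E.edge w u hwu
  exact E.mem_of_desc (hall w hw i hi) hi' hu

end RootedDecomp

/-! ### The algorithm succeeds on graphs of bounded treewidth -/

section Success

variable {G : RankData}

theorem assemble_isSome {U : List (List ℕ)} {B : List ℕ} {tab : Table} (Ks : List (List ℕ))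
    (h : ∀ K ∈ Ks, ∃ e ∈ tab, sameSet e.1 K = true) (R : List Row) :
    (assemble G U B tab Ks R).isSome := by
  induction Ks generalizing R with
  | nil => rfl
  | cons K Ks ih =>
    obtain ⟨e, he, hs⟩ := h K List.mem_cons_self
    obtain ⟨e', he'⟩ := Option.isSome_iff_exists.1
      (List.find?_isSome (p := fun e : List ℕ × List Row => sameSet e.1 K) |>.2 ⟨e, he, hs⟩)
    rw [assemble, List.foldl_cons, Option.bind_some, he', Option.map_some]
    exact ih (fun L hL => h L (List.mem_cons_of_mem _ hL)) _

/-- A connected `C` is a component of the graph without N(C). The constant value `1` merely marks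
the deleted vertices; the component found has the members of `C`, possibly in another order. -/
theorem RankData.Proper.exists_candidate (hG : G.Proper) {j : ℕ} {U : List (List ℕ)}
    (hU : Universe G j U) {C : List ℕ} (hCV : ∀ u ∈ C, u < G.2.length)
    (hconn : Conn G C) (hj : (nbhd G C).length ≤ j) :
    ∃ K ∈ candidates G U, ∀ u, u ∈ K ↔ u ∈ C := by
  obtain ⟨t, ht, htf⟩ := hU.exists_mem (fun _ => 1) (by simp) (nbhd G C) hj
    fun u hu => (mem_nbhd.1 hu).1
  have hL : ∀ u, u ∈ (verts G).filter (fun u => decide (look t u = 0)) ↔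
      u < G.2.length ∧ u ∉ nbhd G C := by
    intro u
    rw [List.mem_filter, mem_verts, htf]
    by_cases h : u ∈ nbhd G C <;> simp [h]
  have hCL : ∀ u ∈ C, u ∈ (verts G).filter (fun u => decide (look t u = 0)) := fun u hu =>
    (hL u).2 ⟨hCV u hu, fun h => (mem_nbhd.1 h).2.1 hu⟩
  obtain ⟨x, hx⟩ := List.exists_mem_of_ne_nil _ hconn.1
  obtain ⟨K, hK, hxK⟩ := List.mem_flatten.1
    ((hG.comps_spec _).1.symm.subset (hCL x hx))
  refine ⟨K, List.mem_flatMap.2 ⟨t, ht, hK⟩, fun u => ⟨fun hu => ?_, fun hu => ?_⟩⟩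
  · refine ((hG.comps_spec _).2.2 K hK).2 (· ∈ C) ⟨x, hxK, hx⟩ (fun y _ hyC z hz hyz => ?_) u hu
    by_contra hzC
    have hzL := (hL z).1 (hG.mem_comps_subset hK hz)
    exact hzL.2 (mem_nbhd.2 ⟨hzL.1, hzC, y, hyC, hyz⟩)
  · exact hconn.2 (· ∈ K) ⟨x, hx, hxK⟩
      (fun y _ hyK z hz hyz => hG.comps_closed hK hyK (hCL z hz) hyz) u hu

/-- Sufficient condition for success: a property of connected sets from which tables can be
computed recursively. -/
theorem RankData.Proper.attempt_isSome (hG : G.Proper) {j : ℕ} {U : List (List ℕ)}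
    (hU : Universe G j U) (P : List ℕ → Prop)
    (hP : ∀ C, C.Nodup → (∀ u ∈ C, u < G.2.length) → Conn G C → P C →
      ∃ v ∈ C, (v :: nbhd G C).length ≤ j ∧ ∀ K, (∀ u ∈ K, u ∈ C ∧ u ≠ v) →
        (∀ w ∈ nbhd G K, w = v ∨ w ∈ nbhd G C) → P K)
    (h₀ : ∀ K, nbhd G K = [] → P K) :
    (attempt G j U).isSome := by
  -- The components of `C \ {v}` are smaller than `C`, so sets of size at most `i` have their tables
  -- after `i` rounds, and n rounds suffice.
  have key : ∀ (i : ℕ) (C : List ℕ), C.Nodup → (∀ u ∈ C, u < G.2.length) → Conn G C → P C →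
      C.length ≤ i → ∃ e ∈ tableAt G j U i, sameSet e.1 C = true := by
    intro i
    induction i with
    | zero =>
      intro C _ _ hconn _ hlen
      exact absurd (List.length_eq_zero_iff.1 (Nat.le_zero.1 hlen)) hconn.1
    | succ i ih =>
      intro C hC hCV hconn hPC hlen
      obtain ⟨v, hv, hj, hrec⟩ := hP C hC hCV hconn hPC
      obtain ⟨K, hK, hKC⟩ := hG.exists_candidate hU hCV hconn
        ((Nat.le_succ _).trans (by simpa using hj))
      obtain ⟨hKn, hKV⟩ := hG.candidates_spec hK
      have hsome : (solveAt G j U (tableAt G j U i) K v).isSome := by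
        rw [solveAt, nbhd_congr (G := G) hKC, decide_eq_true hj, cond_true]
        refine assemble_isSome _ (fun L hL => ?_) _
        have hLK : ∀ u ∈ L, u ∈ K ∧ u ≠ v := fun u hu => by
          simpa using List.mem_filter.1 (hG.mem_comps_subset hL hu)
        have hLn : L.Nodup := hG.nodup_of_mem_comps (hKn.filter _) hL
        refine ih L hLn (fun u hu => hKV u (hLK u hu).1) ((hG.comps_spec _).2.2 L hL) ?_ ?_
        · refine hrec L (fun u hu => ⟨(hKC u).1 (hLK u hu).1, (hLK u hu).2⟩) fun w hw => ?_
          obtain ⟨hwV, hwL, u, hu, huw⟩ := mem_nbhd.1 hw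
          by_cases hwv : w = v
          · exact .inl hwv
          · refine .inr (mem_nbhd.2 ⟨hwV, fun hwC => hwL ?_, u, (hKC u).1 (hLK u hu).1, huw⟩)
            exact hG.comps_closed hL hu (List.mem_filter.2 ⟨(hKC w).2 hwC, by simp [hwv]⟩) huw
        · have : (v :: L).length ≤ C.length :=
            (List.subperm_of_subset (List.nodup_cons.2 ⟨fun h => (hLK v h).2 rfl, hLn⟩)
              fun u hu => by
                rcases List.mem_cons.1 hu with rfl | hu
                · exact hv
                · exact (hKC u).1 (hLK u hu).1).length_le
          rw [List.length_cons] at this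
          omega
      obtain ⟨R, hR⟩ := Option.isSome_iff_exists.1 hsome
      -- The entry comes from the first vertex that works, which need not be `v`; this does no harm,
      -- because exactness holds for every choice.
      have hne : K.filterMap (fun v => solveAt G j U (tableAt G j U i) K v) ≠ [] :=
        List.ne_nil_of_mem (List.mem_filterMap.2 ⟨v, (hKC v).2 hv, hR⟩)
      refine ⟨(K, List.head _ hne), ?_, ?_⟩
      · rw [tableAt, Function.iterate_succ_apply']
        exact mem_nextTable.2 ⟨hK, List.head?_eq_some_head hne⟩
      · simp only [sameSet, Bool.and_eq_true, List.all_eq_true, decide_eq_true_eq]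
        exact ⟨fun u hu => (hKC u).1 hu, fun u hu => (hKC u).2 hu⟩
  rw [attempt_eq]
  refine assemble_isSome _ (fun K hK => ?_) _
  have hKV : ∀ u ∈ K, u < G.2.length := fun u hu => mem_verts.1 (hG.mem_comps_subset hK hu)
  have hKn := hG.nodup_of_mem_comps nodup_verts hK
  refine key _ K hKn hKV ((hG.comps_spec _).2.2 K hK) (h₀ K ?_) ?_
  · refine List.eq_nil_iff_forall_not_mem.2 fun w hw => ?_
    obtain ⟨hwV, hwK, u, hu, huw⟩ := mem_nbhd.1 hw
    exact hwK (hG.comps_closed hK hu (mem_verts.2 hwV) huw)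
  · simpa [verts] using (List.subperm_of_subset hKn (l₂ := verts G) fun u hu =>
      mem_verts.2 (hKV u hu)).length_le

/-- The algorithm succeeds as soon as `j` is the size of the bags of some tree decomposition. -/
theorem RankData.Proper.attempt_isSome_of_rootedDecomp (hG : G.Proper) {j : ℕ}
    {U : List (List ℕ)} (hU : Universe G j U) {V ι : Type} {H : SimpleGraph V}
    (E : RootedDecomp H ι) (hE : ∀ i, (E.bag i).card ≤ j) (f : V → ℕ) (hf : f.Injective)
    (hfV : ∀ u < G.2.length, ∃ x, f x = u) (hadj : ∀ x y, adj G (f x) (f y) = true ↔ H.Adj x y) :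
    (attempt G j U).isSome := by
  -- The invariant: neighbours of `C` have topmost nodes no deeper than those of `C`. With `v` of
  -- least depth in `C`, it passes to the components of `C \ {v}`, whose neighbours are `v` or
  -- neighbours of `C`.
  refine hG.attempt_isSome hU (fun C => ∀ x y, f x ∈ nbhd G C → f y ∈ C →
    E.d (E.top x) ≤ E.d (E.top y)) ?_ ?_
  · intro C hC hCV hconn hPC
    have hne : ∃ y, f y ∈ C := by
      obtain ⟨u, hu⟩ := List.exists_mem_of_ne_nil _ hconn.1
      obtain ⟨y, rfl⟩ := hfV u (hCV u hu)
      exact ⟨y, hu⟩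
    have hex : ∃ n y, f y ∈ C ∧ E.d (E.top y) = n := by
      obtain ⟨y, hy⟩ := hne
      exact ⟨_, y, hy, rfl⟩
    classical
    obtain ⟨v, hv, hvn⟩ := Nat.find_spec hex
    have hmin : ∀ y, f y ∈ C → E.d (E.top v) ≤ E.d (E.top y) := fun y hy =>
      hvn ▸ Nat.find_min' hex ⟨y, hy, rfl⟩
    refine ⟨f v, hv, ?_, fun K hKC hnb x y hx hy => ?_⟩
    -- N(C) ∪ {v} lies in the bag of the topmost node of `v`, so its size is at most `j`.
    · have hsub : ∀ u ∈ f v :: nbhd G C, u ∈ ((E.bag (E.top v)).image f).toList := by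
        intro u hu
        rw [Finset.mem_toList, Finset.mem_image]
        rcases List.mem_cons.1 hu with rfl | hu
        · exact ⟨v, E.mem_top v, rfl⟩
        · obtain ⟨huV, huC, w, hw, hwu⟩ := mem_nbhd.1 hu
          obtain ⟨x, rfl⟩ := hfV u huV
          obtain ⟨y, rfl⟩ := hfV w (hCV w hw)
          refine ⟨x, E.mem_bag_of_adj (C := fun x => f x ∈ C) (fun A hAv hcl y hy => ?_) hmin
            hw ((hadj y x).1 hwu) (hPC x v hu hv), rfl⟩
          have := hconn.2 (fun u => ∀ x, f x = u → A x) ⟨f v, hv, fun x hx => hf hx ▸ hAv⟩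
            (fun a ha hAa b hb hab z hz => by
              obtain ⟨x, rfl⟩ := hfV a (hCV a ha)
              subst hz
              exact hcl x ha (hAa x rfl) z hb ((hadj x z).1 hab)) (f y) hy
          exact this y rfl
      have hnd : (f v :: nbhd G C).Nodup :=
        List.nodup_cons.2 ⟨fun h => (mem_nbhd.1 h).2.1 hv, nodup_nbhd C⟩
      calc (f v :: nbhd G C).length ≤ ((E.bag (E.top v)).image f).toList.length :=
            (List.subperm_of_subset hnd hsub).length_le
        _ ≤ (E.bag (E.top v)).card := by rw [Finset.length_toList]; exact Finset.card_image_le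
        _ ≤ j := hE _
    · rcases hnb _ hx with h | h
      · rw [hf h]
        exact hmin y (hKC _ hy).1
      · exact hPC x y h (hKC _ hy).1
  · intro K hK x y hx
    simp [hK] at hx

end Success
end StableMarriage

namespace StableMarriage
open Enc

namespace Instance

variable {a b : ℕ} (I : Instance a b)

/-! ### Existence of stable matchings -/

theorem pos_of_pM {m : Fin a} {w : Fin b} {r : ℕ} (h : I.pM m w = some r) : 0 < r := by
  obtain ⟨t, ht⟩ := I.ranksM m
  exact ((ht ▸ ⟨w, h⟩ : r ∈ Set.Icc 1 t)).1

theorem pos_of_pW {m : Fin a} {w : Fin b} {r : ℕ} (h : I.pW w m = some r) : 0 < r := by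
  obtain ⟨t, ht⟩ := I.ranksW w
  exact ((ht ▸ ⟨m, h⟩ : r ∈ Set.Icc 1 t)).1

/-- `m` and `w` accept each other, and `w` has no partner in `g` that she likes as much as `m`. -/
def Attracts (g : Fin b → Option (Fin a)) (m : Fin a) (w : Fin b) : Prop :=
  (I.pM m w).isSome ∧ (g w = none ∨ ∃ m', g w = some m' ∧ I.WomanPrefers w m m')

/-- The matchings `g` that are reached when men propose in the order of their preferences: matched
men are not in blocking pairs. -/
structure Proposed (g : Fin b → Option (Fin a)) : Prop where
  inj : ∀ w w' m, g w = some m → g w' = some m → w = w'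
  acceptable : ∀ w m, g w = some m → (I.pM m w).isSome
  not_attracts : ∀ m w w', g w' = some m → I.ManPrefers m w w' → ¬ I.Attracts g m w

/-- The total dissatisfaction of the women. -/
def regret (g : Fin b → Option (Fin a)) : ℕ :=
  ∑ w, (g w).elim (∑ m, (I.pW w m).getD 0 + 1) fun m => (I.pW w m).getD 0

/-- Deferred acceptance as an extremal argument: take a `Proposed` matching of least regret. If a
free man had a woman who would take him, matching him to the best such woman would keep the matching
`Proposed` and lower the regret. So every man with such a woman is matched, and `not_attracts` rules
out blocking pairs. -/
theorem exists_stable : ∃ μ : Fin a ≃. Fin b, I.Stable μ := by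
  classical
  have hex : ∃ n g, I.Proposed g ∧ I.regret g = n :=
    ⟨_, fun _ => none, ⟨by simp, by simp, by simp⟩, rfl⟩
  obtain ⟨g, hg, hgn⟩ := Nat.find_spec hex
  have hmin : ∀ g', I.Proposed g' → I.regret g ≤ I.regret g' := fun g' hg' =>
    hgn ▸ Nat.find_min' hex ⟨g', hg', rfl⟩
  have hmatched : ∀ m w, I.Attracts g m w → ∃ w', g w' = some m := by
    intro m w hw
    by_contra hfree
    push Not at hfree
    obtain ⟨v, hv, hvmin⟩ := (Finset.univ.filter fun w => I.Attracts g m w).exists_min_image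
      (fun w => (I.pM m w).getD 0) ⟨w, by simpa using hw⟩
    have hv : I.Attracts g m v := by simpa using hv
    have hvmin : ∀ w, I.Attracts g m w → (I.pM m v).getD 0 ≤ (I.pM m w).getD 0 := fun w hw =>
      hvmin w (by simpa using hw)
    obtain ⟨rv, hrv⟩ := Option.isSome_iff_exists.1 ((I.acceptable_iff m v).1 hv.1)
    -- Only `v` changes her partner, and strictly to her advantage, so no new man can attract
    -- anyone.
    have hatt : ∀ m' w', I.Attracts (Function.update g v (some m)) m' w' → I.Attracts g m' w' := by
      intro m' w' ⟨h₁, h₂⟩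
      refine ⟨h₁, ?_⟩
      by_cases hwv : w' = v
      · subst hwv
        rw [Function.update_self] at h₂
        rcases h₂ with h₂ | ⟨_, h₂, r, r', hr, hr', hlt⟩
        · cases h₂
        · cases h₂
          rcases hv.2 with h | ⟨m'', h, s, s', hs, hs', hlt'⟩
          · exact .inl h
          · cases hr'.symm.trans hs
            exact .inr ⟨m'', h, r, s', hr, hs', hlt.trans hlt'⟩
      · rwa [Function.update_of_ne hwv] at h₂
    have hprop : I.Proposed (Function.update g v (some m)) := by
      refine ⟨fun w₁ w₂ m' h₁ h₂ => ?_, fun w₁ m' h₁ => ?_, fun m' w₁ w₂ h₂ hpref hat => ?_⟩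
      · by_cases hw₁ : w₁ = v <;> by_cases hw₂ : w₂ = v
        · rw [hw₁, hw₂]
        · rw [hw₁, Function.update_self] at h₁
          rw [Function.update_of_ne hw₂, ← h₁] at h₂
          exact absurd h₂ (hfree _)
        · rw [hw₂, Function.update_self] at h₂
          rw [Function.update_of_ne hw₁, ← h₂] at h₁
          exact absurd h₁ (hfree _)
        · rw [Function.update_of_ne hw₁] at h₁
          rw [Function.update_of_ne hw₂] at h₂
          exact hg.inj _ _ _ h₁ h₂
      · by_cases hw₁ : w₁ = v
        · subst hw₁
          rw [Function.update_self] at h₁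
          cases h₁
          exact hv.1
        · rw [Function.update_of_ne hw₁] at h₁
          exact hg.acceptable _ _ h₁
      · by_cases hw₂ : w₂ = v
        · subst hw₂
          rw [Function.update_self] at h₂
          cases h₂
          obtain ⟨r, r', hr, hr', hlt⟩ := hpref
          have := hvmin _ (hatt _ _ hat)
          rw [hr, hr', Option.getD_some, Option.getD_some] at this
          omega
        · rw [Function.update_of_ne hw₂] at h₂
          exact hg.not_attracts _ _ _ h₂ hpref (hatt _ _ hat)
    -- The term of `v` drops: her new partner has a smaller rank than the old one, or she was free,
    -- which counts one more than the sum of all her ranks. A displaced man adds nothing, as only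
    -- women are counted.
    have hlt : I.regret (Function.update g v (some m)) < I.regret g := by
      refine Finset.sum_lt_sum (fun w' _ => ?_) ⟨v, Finset.mem_univ _, ?_⟩
      · by_cases hwv : w' = v
        · subst hwv
          rw [Function.update_self]
          rcases hv.2 with h | ⟨m', h, s, s', hs, hs', hlt⟩
          · rw [h]
            exact (Finset.single_le_sum (f := fun m => (I.pW w' m).getD 0) (fun _ _ => Nat.zero_le _)
              (Finset.mem_univ m)).trans (Nat.le_succ _)
          · rw [h, Option.elim_some, Option.elim_some, hs, hs']
            exact hlt.le
        · rw [Function.update_of_ne hwv]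
      · rw [Function.update_self]
        rcases hv.2 with h | ⟨m', h, s, s', hs, hs', hlt⟩
        · rw [h]
          exact Nat.lt_succ_of_le (Finset.single_le_sum (f := fun m => (I.pW v m).getD 0)
            (fun _ _ => Nat.zero_le _) (Finset.mem_univ m))
        · rw [h, Option.elim_some, Option.elim_some, hs, hs']
          exact hlt
    exact absurd (hmin _ hprop) (Nat.not_le.2 hlt)
  let μ : Fin a ≃. Fin b :=
    { toFun := fun m => if h : ∃ w, g w = some m then some h.choose else none
      invFun := g
      inv := fun m w => by
        constructor
        · intro h
          have hw : ∃ w, g w = some m := ⟨w, h⟩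
          rw [dif_pos hw, hg.inj _ _ _ hw.choose_spec h]
        · intro h
          split_ifs at h with hw
          cases h
          exact hw.choose_spec }
  have hμ : ∀ m w, μ m = some w ↔ g w = some m := fun m w => μ.inv m w |>.symm
  refine ⟨μ, fun m w h => hg.acceptable w m ((hμ m w).1 h), fun m w ⟨h₁, h₂, h₃⟩ => ?_⟩
  have hat : I.Attracts g m w := ⟨h₁, h₃⟩
  obtain ⟨w', hw'⟩ := hmatched m w hat
  rcases h₂ with h₂ | ⟨w'', h₂, hpref⟩
  · rw [(hμ m w').2 hw'] at h₂
    cases h₂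
  · exact hg.not_attracts _ _ _ ((hμ m w'').1 h₂) hpref hat

/-! ### The tables of an instance -/

/-- The tables of the ranks. -/
def tables : List (List ℕ) × List (List ℕ) :=
  (List.ofFn fun m => List.ofFn fun w => (I.pM m w).getD 0,
    List.ofFn fun w => List.ofFn fun m => (I.pW w m).getD 0)

theorem encode_eq : I.encode = enc I.tables := by
  simp only [encode, tables, enc, List.map_ofFn, Function.comp_def]

/-- The data that the algorithm works on. -/
def data : RankData := rankData I.tables

theorem data_fst : I.data.1 = a := by simp [data, rankData, tables]

theorem length_data : I.data.2.length = a + b := by simp [data, rankData, tables]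

theorem getD_data_man (m : Fin a) : I.data.2.getD m [] =
    List.replicate a 0 ++ List.ofFn fun w => (I.pM m w).getD 0 := by
  simp [data, rankData, tables, List.getElem?_append_left]

theorem getD_data_woman (w : Fin b) : I.data.2.getD (a + w) [] =
    (List.ofFn fun m => (I.pW w m).getD 0) ++ List.replicate b 0 := by
  simp [data, rankData, tables]

theorem rk_man_woman (m : Fin a) (w : Fin b) : rk I.data m (a + w) = (I.pM m w).getD 0 := by
  rw [rk, getD_data_man]
  simp

theorem rk_woman_man (w : Fin b) (m : Fin a) : rk I.data (a + w) m = (I.pW w m).getD 0 := by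
  rw [rk, getD_data_woman]
  simp [List.getElem?_append_left]

theorem rk_man_pos {m : Fin a} {u : ℕ} (h : 0 < rk I.data m u) : ∃ w : Fin b, u = a + w := by
  rw [rk, getD_data_man] at h
  by_cases hu : u < a
  · simp [List.getElem?_append_left, hu] at h
  · by_cases hub : u - a < b
    · exact ⟨⟨u - a, hub⟩, by simp; omega⟩
    · rw [List.getD_eq_default _ _ (by simp; omega)] at h
      exact absurd h (lt_irrefl _)

theorem rk_woman_pos {w : Fin b} {u : ℕ} (h : 0 < rk I.data (a + w) u) :
    ∃ m : Fin a, u = m := by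
  rw [rk, getD_data_woman] at h
  by_cases hu : u < a
  · exact ⟨⟨u, hu⟩, rfl⟩
  · rw [List.getD_eq_getElem?_getD, List.getElem?_append_right (by simpa using hu)] at h
    by_cases hub : u - a < b
    · simp [hub] at h
    · rw [List.getElem?_eq_none (by simp; omega)] at h
      exact absurd h (lt_irrefl _)

theorem lt_cases {u : ℕ} (hu : u < I.data.2.length) :
    (∃ m : Fin a, u = m) ∨ ∃ w : Fin b, u = a + w := by
  rw [length_data] at hu
  by_cases h : u < a
  · exact .inl ⟨⟨u, h⟩, rfl⟩
  · exact .inr ⟨⟨u - a, by omega⟩, by simp; omega⟩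

theorem getD_pos_iff_pM {m : Fin a} {w : Fin b} :
    0 < (I.pM m w).getD 0 ↔ (I.pM m w).isSome := by
  cases h : I.pM m w with
  | none => simp
  | some r => simpa using I.pos_of_pM h

theorem getD_pos_iff_pW {m : Fin a} {w : Fin b} :
    0 < (I.pW w m).getD 0 ↔ (I.pM m w).isSome := by
  rw [I.acceptable_iff]
  cases h : I.pW w m with
  | none => simp
  | some r => simpa using I.pos_of_pW h

theorem adj_man_woman {m : Fin a} {w : Fin b} :
    adj I.data m (a + w) = true ↔ (I.pM m w).isSome := by
  rw [adj, decide_eq_true_eq, rk_man_woman, getD_pos_iff_pM]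

theorem adj_woman_man {m : Fin a} {w : Fin b} :
    adj I.data (a + w) m = true ↔ (I.pM m w).isSome := by
  rw [adj, decide_eq_true_eq, rk_woman_man, getD_pos_iff_pW]

theorem adj_iff {u v : ℕ} : adj I.data u v = true ↔
    (∃ (m : Fin a) (w : Fin b), u = m ∧ v = a + w ∧ (I.pM m w).isSome) ∨
      ∃ (m : Fin a) (w : Fin b), u = a + w ∧ v = m ∧ (I.pM m w).isSome := by
  constructor
  · intro h
    have h' : 0 < rk I.data u v := by simpa [adj] using h
    rcases I.lt_cases (adj_lt_left h) with ⟨m, rfl⟩ | ⟨w, rfl⟩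
    · obtain ⟨w, rfl⟩ := I.rk_man_pos h'
      exact .inl ⟨m, w, rfl, rfl, I.adj_man_woman.1 h⟩
    · obtain ⟨m, rfl⟩ := I.rk_woman_pos h'
      exact .inr ⟨m, w, rfl, rfl, I.adj_woman_man.1 h⟩
  · rintro (⟨m, w, rfl, rfl, h⟩ | ⟨m, w, rfl, rfl, h⟩)
    · exact I.adj_man_woman.2 h
    · exact I.adj_woman_man.2 h

theorem proper_data : I.data.Proper where
  symm u w := by
    rw [Bool.eq_iff_iff, adj_iff, adj_iff]
    constructor
    · rintro (⟨m, w, h₁, h₂, h⟩ | ⟨m, w, h₁, h₂, h⟩)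
      exacts [.inr ⟨m, w, h₂, h₁, h⟩, .inl ⟨m, w, h₂, h₁, h⟩]
    · rintro (⟨m, w, h₁, h₂, h⟩ | ⟨m, w, h₁, h₂, h⟩)
      exacts [.inr ⟨m, w, h₂, h₁, h⟩, .inl ⟨m, w, h₂, h₁, h⟩]
  irrefl u := by
    rw [Bool.eq_false_iff, ne_eq, adj_iff]
    rintro (⟨m, w, h₁, h₂, -⟩ | ⟨m, w, h₁, h₂, -⟩) <;> omega

/-- The number of an agent. -/
def index : Fin a ⊕ Fin b → ℕ := Sum.elim (fun m => m) fun w => a + w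

theorem index_injective : (index (a := a) (b := b)).Injective := by
  rintro (m | w) (m' | w') h <;> simp only [index, Sum.elim_inl, Sum.elim_inr] at h
  · rw [Fin.ext h]
  · omega
  · omega
  · rw [Fin.ext (Nat.add_left_cancel h)]

theorem exists_index {u : ℕ} (hu : u < I.data.2.length) :
    ∃ x : Fin a ⊕ Fin b, index x = u := by
  rcases I.lt_cases hu with ⟨m, rfl⟩ | ⟨w, rfl⟩
  exacts [⟨.inl m, rfl⟩, ⟨.inr w, rfl⟩]

theorem adj_index (x y : Fin a ⊕ Fin b) :
    adj I.data (index x) (index y) = true ↔ I.primalGraph.Adj x y := by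
  rcases x with m | w <;> rcases y with m' | w'
  · simp only [index, Sum.elim_inl, adj_iff, primalGraph]
    constructor
    · rintro (⟨_, _, -, h, -⟩ | ⟨_, _, h, -, -⟩) <;> omega
    · simp
  · simp only [index, Sum.elim_inl, Sum.elim_inr, adj_man_woman, primalGraph]
    simp
  · simp only [index, Sum.elim_inl, Sum.elim_inr, adj_woman_man, primalGraph]
    simp
  · simp only [index, Sum.elim_inr, adj_iff, primalGraph]
    constructor
    · rintro (⟨_, _, h, -, -⟩ | ⟨_, _, -, h, -⟩) <;> omega
    · simp

/-! ### Stable matchings as assignments -/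

/-- The assignment that represents a matching. -/
def assignment (μ : Fin a ≃. Fin b) (u : ℕ) : ℕ :=
  if h : u < a then (μ ⟨u, h⟩).elim 1 fun w => a + w + 2
  else if h : u - a < b then (μ.symm ⟨u - a, h⟩).elim 1 fun m => m + 2 else 0

theorem assignment_man (μ : Fin a ≃. Fin b) (m : Fin a) :
    assignment μ m = (μ m).elim 1 fun w => a + w + 2 := by
  simp [assignment]

theorem assignment_woman (μ : Fin a ≃. Fin b) (w : Fin b) :
    assignment μ (a + w) = Option.elim (μ.symm w) (1 : ℕ) fun m => (m : ℕ) + 2 := by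
  simp [assignment]

theorem assignment_man_eq_iff (μ : Fin a ≃. Fin b) (m : Fin a) (w : Fin b) :
    assignment μ m = a + w + 2 ↔ μ m = some w := by
  rw [assignment_man]
  cases μ m with
  | none => simp
  | some w' => simp [Fin.ext_iff]

theorem assignment_woman_eq_iff (μ : Fin a ≃. Fin b) (m : Fin a) (w : Fin b) :
    assignment μ (a + w) = m + 2 ↔ μ m = some w := by
  rw [assignment_woman, ← PEquiv.eq_some_iff]
  cases μ.symm w with
  | none => simp
  | some w' => simp [Fin.ext_iff]

theorem assignment_le (μ : Fin a ≃. Fin b) (u : ℕ) :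
    assignment μ u ≤ I.data.2.length + 1 := by
  rw [length_data, assignment]
  split_ifs with h₁ h₂
  · cases μ ⟨u, h₁⟩ with
    | none => simp
    | some w => simp
  · cases μ.symm ⟨u - a, h₂⟩ with
    | none => simp
    | some w => simp; omega
  · omega

/-- Matched pairs accept each other. -/
def Acceptable (μ : Fin a ≃. Fin b) : Prop := ∀ m w, μ m = some w → (I.pM m w).isSome

theorem fits_assignment_man {μ : Fin a ≃. Fin b} {m : Fin a} :
    fits I.data m (assignment μ m) = true ↔ ∀ w, μ m = some w → (I.pM m w).isSome := by
  rw [assignment_man]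
  cases μ m with
  | none => simp [fits]
  | some w =>
    have : a + (w : ℕ) + 2 - 2 = a + w := by omega
    simp [fits, this, rk_man_woman, getD_pos_iff_pM]

theorem fits_assignment_woman {μ : Fin a ≃. Fin b} {w : Fin b} :
    fits I.data (a + w) (assignment μ (a + w)) = true ↔
      ∀ m, μ m = some w → (I.pM m w).isSome := by
  have : (∀ m, μ m = some w → (I.pM m w).isSome) ↔
      ∀ m, μ.symm w = some m → (I.pM m w).isSome := by
    simp_rw [PEquiv.eq_some_iff]
  rw [assignment_woman, this]
  cases μ.symm w with
  | none => simp [fits]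
  | some m => simp [fits, rk_woman_man, getD_pos_iff_pW]

theorem wants_man_iff {μ : Fin a ≃. Fin b} (hμ : I.Acceptable μ) {m : Fin a} {w : Fin b}
    (hw : (I.pM m w).isSome) : wants I.data m (assignment μ m) (a + w) = true ↔
      μ m = none ∨ ∃ w', μ m = some w' ∧ I.ManPrefers m w w' := by
  rw [assignment_man]
  cases h : μ m with
  | none => simp [wants]
  | some w' =>
    have h₁ : a + (w' : ℕ) + 2 - 2 = a + w' := by omega
    obtain ⟨r, hr⟩ := Option.isSome_iff_exists.1 hw
    obtain ⟨r', hr'⟩ := Option.isSome_iff_exists.1 (hμ m w' h)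
    simp [wants, h₁, rk_man_woman, hr, hr', ManPrefers]

theorem wants_woman_iff {μ : Fin a ≃. Fin b} (hμ : I.Acceptable μ) {m : Fin a} {w : Fin b}
    (hw : (I.pM m w).isSome) : wants I.data (a + w) (assignment μ (a + w)) m = true ↔
      μ.symm w = none ∨ ∃ m', μ.symm w = some m' ∧ I.WomanPrefers w m m' := by
  rw [assignment_woman]
  cases h : μ.symm w with
  | none => simp [wants]
  | some m' =>
    obtain ⟨r, hr⟩ := Option.isSome_iff_exists.1 ((I.acceptable_iff m w).1 hw)
    obtain ⟨r', hr'⟩ := Option.isSome_iff_exists.1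
      ((I.acceptable_iff m' w).1 (hμ m' w (PEquiv.eq_some_iff _ |>.1 h)))
    simp [wants, rk_woman_man, hr, hr', WomanPrefers]

theorem compat_assignment_iff {μ : Fin a ≃. Fin b} (hμ : I.Acceptable μ) {m : Fin a}
    {w : Fin b} : compat I.data m (assignment μ m) (a + w) (assignment μ (a + w)) = true ↔
      ¬ I.Blocking μ m w := by
  by_cases hw : (I.pM m w).isSome
  · have h₁ := I.wants_man_iff hμ hw
    have h₂ := I.wants_woman_iff hμ hw
    have h₃ : (decide (assignment μ m = a + w + 2) ==
        decide (assignment μ (a + w) = m + 2)) = true := by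
      rw [beq_iff_eq, decide_eq_decide, assignment_man_eq_iff, assignment_woman_eq_iff]
    rw [compat, I.adj_man_woman.2 hw, h₃, Blocking, ← h₁, ← h₂]
    simp only [hw, true_and]
    cases wants I.data m (assignment μ m) (a + w) <;>
      cases wants I.data (a + w) (assignment μ (a + w)) m <;> simp
  · rw [compat_of_not_adj (Bool.eq_false_iff.2 fun h => hw (I.adj_man_woman.1 h))]
    simp [Blocking, hw]

/-- For the assignment of a matching, the mutuality clause of `compat` holds automatically. What
remains is acceptability from `fits` and the absence of blocking pairs from `wants`. -/
theorem sat_assignment_iff {μ : Fin a ≃. Fin b} :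
    Sat I.data (assignment μ) (verts I.data) (verts I.data) ↔ I.Stable μ := by
  have hman : ∀ m : Fin a, (m : ℕ) ∈ verts I.data := fun m => by
    rw [mem_verts, length_data]
    omega
  have hwoman : ∀ w : Fin b, a + (w : ℕ) ∈ verts I.data := fun w => by
    rw [mem_verts, length_data]
    omega
  constructor
  · intro h
    have hμ : I.Acceptable μ := fun m => I.fits_assignment_man.1 (h m (hman m)).1
    exact ⟨hμ, fun m w => (I.compat_assignment_iff hμ).1 ((h m (hman m)).2 _ (hwoman w))⟩
  · rintro ⟨hμ, hb⟩ u hu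
    refine ⟨?_, fun v hv => ?_⟩
    · rcases I.lt_cases (mem_verts.1 hu) with ⟨m, rfl⟩ | ⟨w, rfl⟩
      · exact I.fits_assignment_man.2 fun w => hμ m w
      · exact I.fits_assignment_woman.2 fun m => hμ m w
    · cases huv : adj I.data u v with
      | false => exact compat_of_not_adj huv
      | true =>
        rcases I.adj_iff.1 huv with ⟨m, w, rfl, rfl, -⟩ | ⟨m, w, rfl, rfl, -⟩
        · exact (I.compat_assignment_iff hμ).2 (hb m w)
        · exact I.proper_data.compat_symm ((I.compat_assignment_iff hμ).2 (hb m w))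

/-- The mutuality clause of `compat` is what makes the men's and women's values inverse to each
other, so that they define a partial equivalence. -/
theorem exists_assignment_eq {f : ℕ → ℕ} (hf : Sat I.data f (verts I.data) (verts I.data)) :
    ∃ μ : Fin a ≃. Fin b, ∀ u < a + b, assignment μ u = f u := by
  have hman : ∀ m : Fin a, (m : ℕ) ∈ verts I.data := fun m => by
    rw [mem_verts, length_data]
    omega
  have hwoman : ∀ w : Fin b, a + (w : ℕ) ∈ verts I.data := fun w => by
    rw [mem_verts, length_data]
    omega
  have hfm : ∀ m : Fin a, f m = 1 ∨ ∃ w : Fin b, f m = a + w + 2 ∧ (I.pM m w).isSome := by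
    intro m
    have h := (hf m (hman m)).1
    simp only [fits, Bool.or_eq_true, Bool.and_eq_true, decide_eq_true_eq] at h
    rcases h with h | ⟨h₁, h₂⟩
    · exact .inl h
    · obtain ⟨w, hw⟩ := I.rk_man_pos h₂
      rw [hw, rk_man_woman, getD_pos_iff_pM] at h₂
      exact .inr ⟨w, by omega, h₂⟩
  have hfw : ∀ w : Fin b, f (a + w) = 1 ∨ ∃ m : Fin a, f (a + w) = m + 2 ∧ (I.pM m w).isSome := by
    intro w
    have h := (hf _ (hwoman w)).1
    simp only [fits, Bool.or_eq_true, Bool.and_eq_true, decide_eq_true_eq] at h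
    rcases h with h | ⟨h₁, h₂⟩
    · exact .inl h
    · obtain ⟨m, hm⟩ := I.rk_woman_pos h₂
      rw [hm, rk_woman_man, getD_pos_iff_pW] at h₂
      exact .inr ⟨m, by omega, h₂⟩
  have hmut : ∀ (m : Fin a) (w : Fin b), (I.pM m w).isSome →
      (f m = a + w + 2 ↔ f (a + w) = m + 2) := by
    intro m w hw
    have h := (hf m (hman m)).2 _ (hwoman w)
    rw [compat, I.adj_man_woman.2 hw] at h
    simp only [Bool.not_true, Bool.false_or, Bool.and_eq_true, beq_iff_eq, decide_eq_decide] at h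
    exact h.1
  let μ : Fin a ≃. Fin b :=
    { toFun := fun m => if h : a + 2 ≤ f m ∧ f m - 2 - a < b then some ⟨f m - 2 - a, h.2⟩ else none
      invFun := fun w => if h : 2 ≤ f (a + w) ∧ f (a + w) - 2 < a then some ⟨f (a + w) - 2, h.2⟩
        else none
      inv := fun m w => by
        have h₁ : (∃ h : 2 ≤ f (a + w) ∧ f (a + w) - 2 < a, (⟨f (a + w) - 2, h.2⟩ : Fin a) = m) ↔
            f (a + w) = m + 2 := by
          simp only [Fin.ext_iff, exists_prop]
          omega
        have h₂ : (∃ h : a + 2 ≤ f m ∧ f m - 2 - a < b, (⟨f m - 2 - a, h.2⟩ : Fin b) = w) ↔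
            f m = a + w + 2 := by
          simp only [Fin.ext_iff, exists_prop]
          omega
        simp only [Option.dite_none_right_eq_some, Option.some.injEq]
        rw [h₁, h₂]
        constructor
        · intro h
          rcases hfw w with h' | ⟨m', h', hm'⟩
          · omega
          · obtain rfl : m' = m := Fin.ext (by omega)
            exact (hmut m' w hm').2 h
        · intro h
          rcases hfm m with h' | ⟨w', h', hw'⟩
          · omega
          · obtain rfl : w' = w := Fin.ext (by omega)
            exact (hmut m w' hw').1 h }
  have hμm : ∀ m, μ m = if h : a + 2 ≤ f m ∧ f m - 2 - a < b then some ⟨f m - 2 - a, h.2⟩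
      else none := fun m => rfl
  have hμw : ∀ w, μ.symm w = if h : 2 ≤ f (a + w) ∧ f (a + w) - 2 < a then
      some ⟨f (a + w) - 2, h.2⟩ else none := fun w => rfl
  refine ⟨μ, fun u hu => ?_⟩
  rcases I.lt_cases (u := u) (by rwa [length_data]) with ⟨m, rfl⟩ | ⟨w, rfl⟩
  · rw [assignment_man, hμm]
    rcases hfm m with h | ⟨w, h, -⟩
    · rw [dif_neg (by omega), h]
      rfl
    · rw [dif_pos (by omega)]
      simp only [Option.elim_some]
      omega
  · rw [assignment_woman, hμw]
    rcases hfw w with h | ⟨m, h, -⟩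
    · rw [dif_neg (by omega), h]
      rfl
    · rw [dif_pos (by omega)]
      simp only [Option.elim_some]
      omega

theorem list_sum_map_range {M : Type} [AddCommMonoid M] (f : ℕ → M) (n : ℕ) :
    ((List.range n).map f).sum = ∑ i ∈ Finset.range n, f i := by
  induction n with
  | zero => rfl
  | succ n ih => simp [List.range_succ, Finset.sum_range_succ, ih]

theorem totalCost_assignment (μ : Fin a ≃. Fin b) :
    totalCost I.data (verts I.data) (assignment μ) = (I.satM μ, I.satW μ, matchingSize μ) := by
  have h : totalCost I.data (verts I.data) (assignment μ) =
      ∑ m : Fin a, (μ m).elim (0, 0, 0) fun w => ((I.pM m w).getD 0, (I.pW w m).getD 0, 1) := by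
    rw [totalCost, verts, length_data, list_sum_map_range, Finset.sum_range_add,
      Finset.sum_range, Finset.sum_range]
    have hw : ∀ w : Fin b, cost I.data (a + w) (assignment μ (a + w)) = 0 := by
      intro w
      simp [cost, data_fst]
    simp only [hw, Finset.sum_const_zero, add_zero]
    refine Finset.sum_congr rfl fun m _ => ?_
    rw [assignment_man]
    cases μ m with
    | none => simp [cost]
    | some w =>
      have h₁ : a + (w : ℕ) + 2 - 2 = a + w := by omega
      simp [cost, data_fst, h₁, rk_man_woman, rk_woman_man]
  rw [h]
  refine Prod.ext ?_ (Prod.ext ?_ ?_)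
  · rw [Prod.fst_sum, satM]
    exact Finset.sum_congr rfl fun m _ => by cases μ m <;> rfl
  · rw [Prod.snd_sum, Prod.fst_sum, satW]
    exact Finset.sum_congr rfl fun m _ => by cases μ m <;> rfl
  · rw [Prod.snd_sum, Prod.snd_sum, matchingSize, Finset.card_filter]
    exact Finset.sum_congr rfl fun m _ => by cases μ m <;> rfl

end Instance
end StableMarriage

namespace StableMarriage
open Enc

/-! ### Selecting the best solution -/

theorem exists_best {le : Cost → Cost → Bool} (htotal : ∀ c d, le c d = true ∨ le d c = true)
    (htrans : ∀ c d e, le c d = true → le d e = true → le c e = true) {R : List Row} (hR : R ≠ []) :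
    ∃ r ∈ R, best le R = some r ∧ ∀ s ∈ R, le r.1 s.1 = true := by
  induction R using List.reverseRecOn with
  | nil => exact absurd rfl hR
  | append_singleton R s ih =>
    rw [best, List.foldl_append]
    by_cases hR' : R = []
    · subst hR'
      exact ⟨s, by simp, rfl, fun r hr => by
        rw [show r = s by simpa using hr]
        simpa using htotal s.1 s.1⟩
    · obtain ⟨r, hr, hb, hmin⟩ := ih hR'
      rw [best] at hb
      rw [hb]
      cases h : le s.1 r.1 with
      | false =>
        refine ⟨r, by simp [hr], by simp [h], fun q hq => ?_⟩
        rcases List.mem_append.1 hq with hq | hq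
        · exact hmin q hq
        · rw [List.mem_singleton.1 hq]
          simpa [h] using htotal s.1 r.1
      | true =>
        refine ⟨s, by simp, by simp [h], fun q hq => ?_⟩
        rcases List.mem_append.1 hq with hq | hq
        · exact htrans _ _ _ h (hmin q hq)
        · rw [List.mem_singleton.1 hq]
          simpa using htotal s.1 s.1

/-! ### Treewidth -/

/-- The decomposition with a single bag shows that the infimum is over a nonempty set, hence
attained. -/
theorem exists_treeDecomposition {V : Type} [Fintype V] (H : SimpleGraph V) :
    ∃ (N : ℕ) (D : TreeDecomposition H N), ∀ i, (D.bag i).card ≤ treewidth H + 1 := by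
  have hne : {w | ∃ (N : ℕ) (D : TreeDecomposition H N), D.width = w}.Nonempty := by
    refine ⟨_, 1, ⟨⊥, SimpleGraph.IsTree.of_subsingleton, fun _ => Finset.univ, fun x y _ =>
      ⟨0, Finset.mem_univ x, Finset.mem_univ y⟩, fun x => ?_⟩, rfl⟩
    have : Nonempty {i : Fin 1 | x ∈ (Finset.univ : Finset V)} := ⟨⟨0, Finset.mem_univ x⟩⟩
    exact SimpleGraph.IsTree.of_subsingleton
  obtain ⟨N, D, hD⟩ := Nat.sInf_mem hne
  refine ⟨N, D, fun i => ?_⟩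
  have h₁ : (D.bag i).card ≤ Finset.univ.sup fun i => (D.bag i).card :=
    Finset.le_sup (f := fun i => (D.bag i).card) (Finset.mem_univ i)
  have h₂ : D.width = treewidth H := hD
  rw [TreeDecomposition.width] at h₂
  omega

/-! ### Sizes -/

/-- Each of the `t` ranks is taken by one of the `k` possible partners. This keeps costs, and the
unary input, polynomial in the number of agents. -/
theorem card_le_of_ranks {k : ℕ} (p : Fin k → Option ℕ) {t : ℕ}
    (h : {r | ∃ w, p w = some r} = Set.Icc 1 t) : t ≤ k := by
  have hsub : Finset.Icc 1 t ⊆ Finset.univ.image fun w => (p w).getD 0 := by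
    intro r hr
    have hr' : r ∈ {r | ∃ w, p w = some r} := h ▸ Finset.mem_Icc.1 hr
    obtain ⟨w, hw⟩ := hr'
    exact Finset.mem_image.2 ⟨w, Finset.mem_univ _, by simp [hw]⟩
  simpa using (Finset.card_le_card hsub).trans Finset.card_image_le

namespace Instance

variable {a b : ℕ} (I : Instance a b)

theorem getD_pM_le (m : Fin a) (w : Fin b) : (I.pM m w).getD 0 ≤ a + b := by
  cases h : I.pM m w with
  | none => simp
  | some r =>
    obtain ⟨t, ht⟩ := I.ranksM m
    have h₁ : r ∈ Set.Icc 1 t := ht ▸ ⟨w, h⟩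
    have h₂ := card_le_of_ranks _ ht
    have := h₁.2
    simp only [Option.getD_some]
    omega

theorem getD_pW_le (m : Fin a) (w : Fin b) : (I.pW w m).getD 0 ≤ a + b := by
  cases h : I.pW w m with
  | none => simp
  | some r =>
    obtain ⟨t, ht⟩ := I.ranksW w
    have h₁ : r ∈ Set.Icc 1 t := ht ▸ ⟨m, h⟩
    have h₂ := card_le_of_ranks _ ht
    have := h₁.2
    simp only [Option.getD_some]
    omega

theorem sz_ofFn_le {k l n : ℕ} (f : Fin k → Fin l → ℕ) (hf : ∀ i j, f i j ≤ n) :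
    sz (List.ofFn fun i => List.ofFn fun j => f i j) ≤ k * (l * (n + 1) + 1) := by
  refine sz_list_le (by simp) fun L hL => ?_
  obtain ⟨i, rfl⟩ := List.mem_ofFn.1 hL
  refine sz_list_le (by simp) fun x hx => ?_
  obtain ⟨j, rfl⟩ := List.mem_ofFn.1 hx
  simpa using hf i j

theorem sz_tables_le {N : ℕ} (hn : a + b ≤ N) (hN : 2 ≤ N) : sz I.tables + 2 ≤ N ^ 8 := by
  have h₁ : sz I.tables.1 ≤ N * (N * (N + 1) + 1) :=
    (sz_ofFn_le _ I.getD_pM_le).trans (by gcongr <;> omega)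
  have h₂ : sz I.tables.2 ≤ N * (N * (N + 1) + 1) :=
    (sz_ofFn_le _ fun w m => I.getD_pW_le m w).trans (by gcongr <;> omega)
  have h₃ : N * (N * (N + 1) + 1) ≤ N * N ^ 4 := by
    gcongr
    nlinarith [Nat.pow_le_pow_left hN 2, Nat.pow_le_pow_left hN 3, pow_succ N 3, pow_succ N 2]
  have h₄ : 2 ^ 5 ≤ N ^ 5 := Nat.pow_le_pow_left hN 5
  have h₅ : N ^ 5 * 2 ^ 3 ≤ N ^ 5 * N ^ 3 := Nat.mul_le_mul_left _ (Nat.pow_le_pow_left hN 3)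
  rw [sz_pair]
  have : N ^ 8 = N ^ 5 * N ^ 3 := by ring
  have : N * N ^ 4 = N ^ 5 := by ring
  omega

theorem rk_data_le (u v : ℕ) : rk I.data u v ≤ a + b := by
  by_cases h : 0 < rk I.data u v
  · have h' : adj I.data u v = true := by simpa [adj] using h
    rcases I.adj_iff.1 h' with ⟨m, w, rfl, rfl, -⟩ | ⟨m, w, rfl, rfl, -⟩
    · rw [rk_man_woman]
      exact I.getD_pM_le m w
    · rw [rk_woman_man]
      exact I.getD_pW_le m w
  · omega

theorem sz_data_le {N : ℕ} (hn : a + b ≤ N) (hN : 2 ≤ N) : sz I.data ≤ N ^ 8 := by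
  have h₁ : sz I.data.2 ≤ N * (N * (N + 1) + 1) := by
    refine sz_list_le (by rw [length_data]; exact hn) fun L hL => ?_
    obtain ⟨u, hu, rfl⟩ := List.mem_iff_getElem.1 hL
    have hlen : I.data.2[u].length = a + b := by
      have hg : I.data.2[u] = I.data.2.getD u [] := by
        rw [List.getD_eq_getElem _ _ hu]
      rcases I.lt_cases hu with ⟨m, rfl⟩ | ⟨w, rfl⟩
      · rw [hg, getD_data_man]
        simp
      · rw [hg, getD_data_woman]
        simp
    refine sz_list_le (hlen.le.trans hn) fun x hx => ?_
    obtain ⟨v, hv, rfl⟩ := List.mem_iff_getElem.1 hx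
    have : rk I.data u v = I.data.2[u][v] := by
      rw [rk, List.getD_eq_getElem _ _ hu, List.getD_eq_getElem _ _ hv]
    rw [sz_nat, ← this]
    exact (I.rk_data_le u v).trans hn
  have h₃ : N * (N * (N + 1) + 1) ≤ N * N ^ 4 := by
    gcongr
    nlinarith [Nat.pow_le_pow_left hN 2, Nat.pow_le_pow_left hN 3, pow_succ N 3, pow_succ N 2]
  have h₄ : N * 2 ^ 4 ≤ N * N ^ 4 := Nat.mul_le_mul_left _ (Nat.pow_le_pow_left hN 4)
  have h₅ : N ^ 5 * 2 ^ 3 ≤ N ^ 5 * N ^ 3 := Nat.mul_le_mul_left _ (Nat.pow_le_pow_left hN 3)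
  have : N ^ 8 = N ^ 5 * N ^ 3 := by ring
  have : N * N ^ 4 = N ^ 5 := by ring
  have := I.data_fst
  rw [sz_pair, sz_nat]
  omega

end Instance

/-! ### Growth of the list of assignments -/

theorem length_extend_le {G : RankData} {N : ℕ} (hG : G.2.length ≤ N) (hN : 2 ≤ N)
    (U : List (List ℕ)) : (extend G U).length ≤ U.length * N ^ 4 := by
  have h : (extend G U).length = U.length * (1 + G.2.length * (G.2.length + 2)) := by
    simp [extend, List.length_flatMap, verts]
    ring
  rw [h]
  gcongr
  calc 1 + G.2.length * (G.2.length + 2) ≤ 1 + N * (N + 2) := by gcongr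
    _ ≤ N ^ 4 := by
      nlinarith [Nat.pow_le_pow_left hN 2, Nat.pow_le_pow_left hN 3, pow_succ N 3, pow_succ N 2]

theorem sz_row_le {G : RankData} {N : ℕ} (hG : G.2.length ≤ N) (f : ℕ → ℕ)
    (hf : ∀ u, f u ≤ G.2.length + 1) : sz ((verts G).map f) ≤ N * (N + 2) := by
  refine sz_list_le (by simpa [verts] using hG) fun x hx => ?_
  obtain ⟨u, -, rfl⟩ := List.mem_map.1 hx
  rw [sz_nat]
  exact (hf u).trans (by omega)

/-- The universe of the `j`-th iteration. -/
def universeAt (G : RankData) (j : ℕ) : List (List ℕ) := (extend G)^[j] [zeroRow G]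

theorem universe_universeAt (G : RankData) (j : ℕ) : Universe G j (universeAt G j) := by
  induction j with
  | zero => exact universe_zero
  | succ j ih =>
    rw [universeAt, Function.iterate_succ_apply']
    exact ih.extend

theorem next_iterate (G : RankData) (j : ℕ) :
    next^[j] (G, 0, [zeroRow G]) = (G, j, universeAt G j) := by
  induction j with
  | zero => rfl
  | succ j ih =>
    rw [Function.iterate_succ_apply', ih, next, universeAt, universeAt,
      Function.iterate_succ_apply']

theorem length_universeAt_le {G : RankData} {N : ℕ} (hG : G.2.length ≤ N) (hN : 2 ≤ N) (j : ℕ) :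
    (universeAt G j).length ≤ N ^ (4 * j) := by
  induction j with
  | zero => simp [universeAt]
  | succ j ih =>
    rw [universeAt, Function.iterate_succ_apply']
    refine (length_extend_le hG hN _).trans ?_
    rw [Nat.mul_succ, pow_add]
    exact Nat.mul_le_mul_right _ ih

/-- Fixes the length of the member lists, so that the bound on their values becomes a bound on their
sizes. -/
theorem eq_map_of_mem_universeAt {G : RankData} {j : ℕ} {t : List ℕ} (ht : t ∈ universeAt G j) :
    t = (verts G).map (look t) := by
  have hmap : ∀ f : ℕ → ℕ, (verts G).map f = (verts G).map (look ((verts G).map f)) := by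
    intro f
    refine List.map_congr_left fun u hu => ?_
    rw [look_map_verts, if_pos (mem_verts.1 hu)]
  induction j generalizing t with
  | zero =>
    rw [List.mem_singleton.1 ht]
    exact hmap _
  | succ j ih =>
    rw [universeAt, Function.iterate_succ_apply'] at ht
    rcases List.mem_append.1 ht with ht | ht
    · exact ih ht
    · simp only [List.mem_flatMap, List.mem_map] at ht
      obtain ⟨t, -, w, -, x, -, rfl⟩ := ht
      exact hmap _

theorem sz_universeAt_le {G : RankData} {N : ℕ} (hG : G.2.length ≤ N) (hN : 2 ≤ N) (j : ℕ) :
    sz (universeAt G j) ≤ N ^ (4 * j) * N ^ 4 := by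
  have hrow : ∀ t ∈ universeAt G j, sz t ≤ N * (N + 2) := by
    intro t ht
    rw [eq_map_of_mem_universeAt ht]
    exact sz_row_le hG _ ((universe_universeAt G j).le t ht)
  refine (sz_list_le (length_universeAt_le hG hN j) hrow).trans (Nat.mul_le_mul_left _ ?_)
  nlinarith [Nat.pow_le_pow_left hN 2, Nat.pow_le_pow_left hN 3, pow_succ N 3, pow_succ N 2]

/-- The size of the `j`-th state, with some slack. -/
theorem sz_state_le {G : RankData} {N : ℕ} (hG : G.2.length ≤ N) (hN : 2 ≤ N) (hGs : sz G ≤ N ^ 8)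
    (j : ℕ) : sz (G, j, universeAt G j) + 2 ≤ N ^ (4 * j + 11) := by
  have h₁ := sz_universeAt_le hG hN j
  have h₂ : j ≤ N ^ (4 * j) * N ^ 4 :=
    calc j ≤ 2 ^ j := Nat.lt_two_pow_self.le
      _ ≤ N ^ j := Nat.pow_le_pow_left hN j
      _ ≤ N ^ (4 * j + 4) := Nat.pow_le_pow_right (by omega) (by omega)
      _ = _ := pow_add _ _ _
  have h₃ : 1 ≤ N ^ (4 * j) := Nat.one_le_pow _ _ (by omega)
  have h₄ : 2 ^ 4 ≤ N ^ 4 := Nat.pow_le_pow_left hN 4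
  have h₅ : 2 ^ 3 ≤ N ^ 3 := Nat.pow_le_pow_left hN 3
  have h₆ : N ^ (4 * j + 11) = N ^ (4 * j) * (N ^ 4 * N ^ 4 * N ^ 3) := by ring
  have h₇ : N ^ 8 = N ^ 4 * N ^ 4 := by ring
  have h₀ : sz (G, j, universeAt G j) = sz G + (sz j + sz (universeAt G j) + 1) + 1 := rfl
  rw [h₀, sz_nat, h₆]
  generalize N ^ (4 * j) = A at *
  generalize N ^ 4 = B at *
  generalize N ^ 3 = C at *
  generalize sz (universeAt G j) = u at *
  have h₈ : A * B * 16 ≤ A * B * B := Nat.mul_le_mul_left _ h₄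
  have h₉ : B * B ≤ A * (B * B) := Nat.le_mul_of_pos_left _ h₃
  have h₁₀ : A * B * B * 8 ≤ A * B * B * C := Nat.mul_le_mul_left _ h₅
  have h₁₁ : 1 * 16 ≤ A * B := Nat.mul_le_mul h₃ h₄
  have h₁₂ : A * (B * B * C) = A * B * B * C := by ring
  have h₁₃ : A * (B * B) = A * B * B := by ring
  omega

/-! ### The main theorem -/

namespace Instance

variable {a b : ℕ} (I : Instance a b)

/-- The costs of a matching that the algorithm computes. -/
def costs (μ : Fin a ≃. Fin b) : Cost := (I.satM μ, I.satW μ, matchingSize μ)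

theorem enc_output {μ : Fin a ≃. Fin b} {r : List ℕ} (h : ∀ u < a + b, assignment μ u = look r u) :
    enc ((List.range a).map fun m => look r m - (a + 1)) = encodeMatching μ := by
  have hl : ((List.range a).map fun m => look r m - (a + 1)) =
      List.ofFn fun m => (μ m).elim 0 fun w => w.val + 1 := by
    refine List.ext_getElem (by simp) fun m h₁ h₂ => ?_
    have hm : m < a := by simpa using h₁
    rw [List.getElem_map, List.getElem_range, List.getElem_ofFn, ← h m (by omega)]
    rw [show assignment μ m = _ from assignment_man μ ⟨m, hm⟩]
    cases μ ⟨m, hm⟩ with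
    | none => simp
    | some w => simp only [Option.elim_some]; omega
  rw [hl]
  simp only [encodeMatching, enc, List.map_ofFn, Function.comp_def]

/-- Whatever the algorithm returns is optimal. -/
theorem optimal_of_result {le : Cost → Cost → Bool} (htotal : ∀ c d, le c d = true ∨ le d c = true)
    (htrans : ∀ c d e, le c d = true → le d e = true → le c e = true) {j : ℕ} {R : List Row}
    (hR : attempt I.data j (universeAt I.data j) = some R) :
    ∃ (y : List ℕ) (μ : Fin a ≃. Fin b), result le (I.data, j, universeAt I.data j) = some y ∧
      enc y = encodeMatching μ ∧ I.Stable μ ∧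
        ∀ ν, I.Stable ν → le (I.costs μ) (I.costs ν) = true := by
  have hex := I.proper_data.exact_attempt (universe_universeAt I.data j) hR
  have hcomp : ∀ ν, I.Stable ν → ∃ r ∈ R, r.1 = I.costs ν := by
    intro ν hν
    obtain ⟨r, hr, -, h⟩ := hex.complete (assignment ν) (I.assignment_le ν)
      (I.sat_assignment_iff.2 hν)
    exact ⟨r, hr, h.trans (I.totalCost_assignment ν)⟩
  -- A stable matching guarantees that there is a row to choose from.
  obtain ⟨ν, hν⟩ := I.exists_stable
  obtain ⟨r₀, hr₀, -⟩ := hcomp ν hν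
  obtain ⟨r, hr, hb, hmin⟩ := exists_best htotal htrans (List.ne_nil_of_mem hr₀)
  obtain ⟨hs, hc⟩ := hex.sound r hr
  obtain ⟨μ, hμ⟩ := I.exists_assignment_eq hs
  have hμV : ∀ u ∈ verts I.data, assignment μ u = look r.2 u := fun u hu =>
    hμ u (by rw [← I.length_data]; exact mem_verts.1 hu)
  have hcost : r.1 = I.costs μ := by
    rw [hc, ← totalCost_congr hμV]
    exact I.totalCost_assignment μ
  refine ⟨(List.range a).map fun m => look r.2 m - (a + 1), μ, ?_, enc_output hμ, ?_, ?_⟩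
  · simp only [result, hR, hb, Option.bind_some, Option.map_some, data_fst]
  · refine I.sat_assignment_iff.1 fun u hu => ?_
    rw [hμV u hu]
    exact ⟨(hs u hu).1, fun w hw => by rw [hμV w hw]; exact (hs u hu).2 w hw⟩
  · intro ν hν
    obtain ⟨s, hs, hsc⟩ := hcomp ν hν
    rw [← hcost, ← hsc]
    exact hmin s hs

/-- The summand `1` turns the width into a bag size. -/
theorem attempt_isSome :
    (attempt I.data (treewidth I.primalGraph + 1)
      (universeAt I.data (treewidth I.primalGraph + 1))).isSome := by
  obtain ⟨N, D, hD⟩ := exists_treeDecomposition I.primalGraph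
  obtain ⟨E, hE⟩ := D.exists_rootedDecomp
  exact I.proper_data.attempt_isSome_of_rootedDecomp (universe_universeAt _ _) E
    (fun i => hE ▸ hD i) index index_injective (fun u hu => I.exists_index hu) I.adj_index

end Instance

/-- Optimization over the stable matchings with respect to a polynomial-time computable total
preorder on the costs. -/
theorem solvableInXPTime_of_le {le : Cost → Cost → Bool}
    (hle : PT fun p : Cost × Cost => le p.1 p.2) (htotal : ∀ c d, le c d = true ∨ le d c = true)
    (htrans : ∀ c d e, le c d = true → le d e = true → le c e = true) {Q : Problem}
    (hQ : ∀ {a b : ℕ} (I : Instance a b) (μ : Fin a ≃. Fin b), I.Stable μ →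
      (∀ ν, I.Stable ν → le (I.costs μ) (I.costs ν) = true) → Q.IsSolution I μ) :
    Q.SolvableInXPTime := by
  obtain ⟨P₂, c, hP₂⟩ := exists_search_program (PT.result hle) PT.next
  obtain ⟨-, P₁, T, ⟨c₀, hT⟩, hP₁⟩ := PT.start
  obtain ⟨P, hP⟩ := exists_program_comp P₁ P₂
  -- `8 * c₀` pays for the start state, computed from tables of size below `N ^ 8`. `19 * c` pays
  -- for one round, since states have size at most `N ^ (4 * j + 11)` with `j ≤ 2 * K` and `1 ≤ K`.
  -- Of the `10`, `3` is for the number of rounds and `7` for constant factors.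
  refine ⟨P, 8 * c₀ + 19 * c + 10, fun a b I _ => ?_⟩
  let N := max (a + b) 2
  let K := max (treewidth I.primalGraph) 1
  have hn : a + b ≤ N := le_max_left _ _
  have hN : 2 ≤ N := le_max_right _ _
  have hstart : start I.tables = (I.data, 0, [zeroRow I.data]) := rfl
  have hex : ∃ j, (result le (next^[j] (start I.tables))).isSome := by
    obtain ⟨R, hR⟩ := Option.isSome_iff_exists.1 I.attempt_isSome
    obtain ⟨y, -, hy, -⟩ := I.optimal_of_result htotal htrans hR
    exact ⟨_, by rw [hstart, next_iterate, hy]; rfl⟩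
  have hle_tw : Nat.find hex ≤ treewidth I.primalGraph + 1 := by
    obtain ⟨R, hR⟩ := Option.isSome_iff_exists.1 I.attempt_isSome
    obtain ⟨y, -, hy, -⟩ := I.optimal_of_result htotal htrans hR
    exact Nat.find_min' hex (by rw [hstart, next_iterate, hy]; rfl)
  have hnone : ∀ j < Nat.find hex, result le (next^[j] (start I.tables)) = none := fun j hj => by
    simpa using Nat.find_min hex hj
  have hsome := Nat.find_spec hex
  -- The first success `m` may come before tw + 1; the optimality of the output does not depend on
  -- which `m` it is.
  generalize Nat.find hex = m at hle_tw hnone hsome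
  have hatt : ∃ R, attempt I.data m (universeAt I.data m) = some R := by
    rw [hstart, next_iterate] at hsome
    cases h : attempt I.data m (universeAt I.data m) with
    | none => simp [result, h] at hsome
    | some R => exact ⟨R, rfl⟩
  obtain ⟨R, hR⟩ := hatt
  obtain ⟨y, μ, hy, hyμ, hμ, hmin⟩ := I.optimal_of_result htotal htrans hR
  have hmK : m ≤ 2 * K := by omega
  -- The subtracted `2` cancels the one in the time bound `(M + 2) ^ c` of the search.
  have hsize : ∀ j ≤ m, sz (next^[j] (start I.tables)) ≤ N ^ (19 * K) - 2 := by
    intro j hj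
    rw [hstart, next_iterate]
    have h₁ := sz_state_le (by rw [I.length_data]; exact hn) hN (I.sz_data_le hn hN) j
    have h₂ : N ^ (4 * j + 11) ≤ N ^ (19 * K) :=
      Nat.pow_le_pow_right (by omega) (by omega)
    omega
  have hN2 : 2 ≤ N ^ (19 * K) := hN.trans (Nat.le_self_pow (by omega) N)
  have heval := hP₂ m (start I.tables) y _ hnone (by rw [hstart, next_iterate]; exact hy) hsize
  obtain ⟨t, ht, hout⟩ := hP (hP₁ I.tables) heval
  refine ⟨μ, t, hQ I μ hμ hmin, ?_, ht.trans ?_⟩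
  · rw [I.encode_eq, ← hyμ]
    exact hout
  · show T I.tables + (m + 1) * ((N ^ (19 * K) - 2 + 2) ^ c + 10) + 3 ≤
      N ^ ((8 * c₀ + 19 * c + 10) * K)
    rw [Nat.sub_add_cancel hN2]
    have h₁ : T I.tables ≤ N ^ (8 * c₀ * K) :=
      calc T I.tables ≤ (sz I.tables + 2) ^ c₀ := hT I.tables
        _ ≤ (N ^ 8) ^ c₀ := Nat.pow_le_pow_left (I.sz_tables_le hn hN) _
        _ = N ^ (8 * c₀ * 1) := by rw [← pow_mul, mul_one]
        _ ≤ N ^ (8 * c₀ * K) := Nat.pow_le_pow_right (by omega)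
          (Nat.mul_le_mul_left _ (by omega))
    have h₂ : (N ^ (19 * K)) ^ c = N ^ (19 * c * K) := by rw [← pow_mul]; congr 1; ring
    have h₃ : m + 1 ≤ N ^ (3 * K) :=
      calc m + 1 ≤ 3 * K := by omega
        _ ≤ 2 ^ (3 * K) := Nat.lt_two_pow_self.le
        _ ≤ N ^ (3 * K) := Nat.pow_le_pow_left hN _
    have h₄ : N ^ ((8 * c₀ + 19 * c + 10) * K) =
        N ^ (8 * c₀ * K) * N ^ (19 * c * K) * N ^ (3 * K) * N ^ (7 * K) := by
      rw [← pow_add, ← pow_add, ← pow_add]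
      congr 1
      ring
    have h₅ : 2 ^ 7 ≤ N ^ (7 * K) := (Nat.pow_le_pow_left hN 7).trans
      (Nat.pow_le_pow_right (by omega) (by omega))
    have p₁ : 1 ≤ N ^ (8 * c₀ * K) := Nat.one_le_pow _ _ (by omega)
    have p₂ : 1 ≤ N ^ (19 * c * K) := Nat.one_le_pow _ _ (by omega)
    have p₃ : 1 ≤ N ^ (3 * K) := Nat.one_le_pow _ _ (by omega)
    rw [h₂, h₄]
    generalize N ^ (8 * c₀ * K) = A at *
    generalize N ^ (19 * c * K) = B at *
    generalize N ^ (3 * K) = C at *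
    generalize N ^ (7 * K) = D at *
    calc T I.tables + (m + 1) * (B + 10) + 3 ≤ A + C * (B + 10 * B) + 3 := by gcongr; omega
      _ = A * 1 * 1 + 1 * (11 * B) * C + 3 := by ring
      _ ≤ A * B * C + A * (11 * B) * C + 3 * (1 * 1 * 1) := by gcongr
      _ ≤ A * B * C + A * (11 * B) * C + 3 * (A * B * C) := by gcongr
      _ = A * B * C * 15 := by ring
      _ ≤ A * B * C * D := by gcongr; omega

/-! ### The four objectives -/

theorem SESM_solvable : SESM.SolvableInXPTime := by
  -- With truncated subtraction, `(x - y) + (y - x)` is the distance of `x` and `y`.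
  refine solvableInXPTime_of_le (le := fun c d => decide
    ((c.1 - c.2.1) + (c.2.1 - c.1) ≤ (d.1 - d.2.1) + (d.2.1 - d.1))) (by fun_prop)
    (fun c d => ?_) (fun c d e h₁ h₂ => ?_) fun I μ hμ h => ⟨hμ, fun ν hν => ?_⟩
  · simp only [decide_eq_true_eq]
    omega
  · simp only [decide_eq_true_eq] at *
    omega
  · have := of_decide_eq_true (h ν hν)
    simp only [Instance.costs] at this
    rw [Instance.delta, Instance.delta]
    rcases abs_cases ((I.satM μ : ℤ) - I.satW μ) with h₁ | h₁ <;>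
      rcases abs_cases ((I.satM ν : ℤ) - I.satW ν) with h₂ | h₂ <;> omega

theorem BSM_solvable : BSM.SolvableInXPTime := by
  -- With truncated subtraction, `x + (y - x)` is the maximum of `x` and `y`.
  refine solvableInXPTime_of_le (le := fun c d => decide
    (c.1 + (c.2.1 - c.1) ≤ d.1 + (d.2.1 - d.1))) (by fun_prop)
    (fun c d => ?_) (fun c d e h₁ h₂ => ?_) fun I μ hμ h => ⟨hμ, fun ν hν => ?_⟩
  · simp only [decide_eq_true_eq]
    omega
  · simp only [decide_eq_true_eq] at *
    omega
  · have := of_decide_eq_true (h ν hν)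
    simp only [Instance.costs] at this
    rw [Instance.bal, Instance.bal]
    omega

theorem maxSMT_solvable : maxSMT.SolvableInXPTime := by
  refine solvableInXPTime_of_le (le := fun c d => decide (d.2.2 ≤ c.2.2)) (by fun_prop)
    (fun c d => ?_) (fun c d e h₁ h₂ => ?_) fun I μ hμ h => ⟨hμ, fun ν hν => ?_⟩
  · simp only [decide_eq_true_eq]
    omega
  · simp only [decide_eq_true_eq] at *
    omega
  · exact of_decide_eq_true (h ν hν)

theorem minSMT_solvable : minSMT.SolvableInXPTime := by
  refine solvableInXPTime_of_le (le := fun c d => decide (c.2.2 ≤ d.2.2)) (by fun_prop)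
    (fun c d => ?_) (fun c d e h₁ h₂ => ?_) fun I μ hμ h => ⟨hμ, fun ν hν => ?_⟩
  · simp only [decide_eq_true_eq]
    omega
  · simp only [decide_eq_true_eq] at *
    omega
  · exact of_decide_eq_true (h ν hν)

end StableMarriage

theorem theorem2 :
    StableMarriage.SESM.SolvableInXPTime ∧ StableMarriage.BSM.SolvableInXPTime ∧
      StableMarriage.maxSMT.SolvableInXPTime ∧ StableMarriage.minSMT.SolvableInXPTime :=
  ⟨StableMarriage.SESM_solvable, StableMarriage.BSM_solvable, StableMarriage.maxSMT_solvable,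
    StableMarriage.minSMT_solvable⟩
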